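/- Let $\mathcal O\subset\mathbb R^d$ be a bounded open set, $H=L^2(\mathcal O)$, and let $A$ be the realization in $H$ of the Laplacian with Dirichlet boundary conditions. Let $\{e_k\}_{k\ge1}$ be a complete orthonormal basis of $H$ of eigenvectors of $A$, $Ae_k=-\alpha_ke_k$, with $0<\alpha_1\le\alpha_k\le\alpha_{k+1}$. Let $H^{-1}$ be the completion of $H$ in the norm $|u|_{H^{-1}}^2=\sum_k\alpha_k^{-1}\langle u,e_k\rangle_H^2$, and $\mathcal H=H\times H^{-1}$. Let $Q$ be a bounded operator on $H$ with $Qe_k=\lambda_ke_k$ and $\sum_k\lambda_k^2/\alpha_k<\infty$; $Q^{-1}$, with domain $D(Q^{-1})=\mathrm{Im}\,Q$, is its inverse (the pseudo-inverse, with values in $(\ker Q)^\perp$, if $Q$ is not injective). Let $F:H\to\mathbb R$ be of class $C^1$ with $F(0)=0$, $F(x)\ge0$ and $\langle DF(x),x\rangle_H\ge0$ for all $x\in H$, and with $DF:H\to H$ Lipschitz continuous, and let $B=-Q^2DF$. For $\mu>0$ let $S_\mu(t)$ be the semigroup on $\mathcal H$ generated by $A_\mu(u,v)=\left(v,\tfrac1\mu(Au-v)\right)$,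 and put $Q_\mu v=\tfrac1\mu(0,Qv)$. For $T>0$ and $z=(\varphi,v)\in C([0,T];\mathcal H)$ let $$I^\mu_{0,T}(z)=\tfrac12\inf\int_0^T|\psi(s)|_H^2\,ds\in[0,\infty],$$ where the infimum (equal to $+\infty$ if there is no such $\psi$) is over all $\psi\in L^2((0,T);H)$ such that, for all $t\in[0,T]$, $$z(t)=S_\mu(t)z(0)+\int_0^tS_\mu(t-s)\left(0,\tfrac1\mu B(\varphi(s))\right)ds+\int_0^tS_\mu(t-s)Q_\mu\psi(s)\,ds .$$ For $\varphi\in C([0,T];H)$ define $I_{0,T}(\varphi)\in[0,\infty]$ in the same way, with the equation $$\varphi(t)=e^{tA}\varphi(0)+\int_0^te^{(t-s)A}B(\varphi(s))\,ds+\int_0^te^{(t-s)A}Q\psi(s)\,ds .$$ The wave and heat quasi-potentials are, for $(x,y)\in\mathcal H$, $$V^\mu(x,y)=\inf\{I^\mu_{0,T}(z):T>0,\ z\in C([0,T];\mathcal H),\ z(0)=0,\ z(T)=(x,y)\},$$ $$V(x)=\inf\{I_{0,T}(\varphi):T>0,\ \varphi\in C([0,T];H),\ \varphi(0)=0,\ \varphi(T)=x\}.$$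 **Theorem.** For every $\mu>0$ and every $(x,y)\in D((-A)^{1/2}Q^{-1})\times D(Q^{-1})$, $$V^\mu(x,y)=\left|(-A)^{1/2}Q^{-1}x\right|_H^2+2F(x)+\mu\left|Q^{-1}y\right|_H^2 .$$ Moreover, for every $x\in D((-A)^{1/2}Q^{-1})$, $$V(x)=\left|(-A)^{1/2}Q^{-1}x\right|_H^2+2F(x).$$ In particular, for every $\mu>0$ and every $x\in H$, $$\inf_{y\in H^{-1}}V^\mu(x,y)=V^\mu(x,0)=V(x),$$ as elements of $[0,\infty]$. -/

import Mathlib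

open MeasureTheory Set Filter Topology
open scoped ENNReal ContDiff

noncomputable section

/-! ### The Dirichlet Laplacian on `L²(𝒪)` and its eigenbasis -/

/-- The real Hilbert space `L²(𝒪)`. -/
abbrev L2Dom {d : ℕ} (O : Set (EuclideanSpace ℝ (Fin d))) : Type :=
  Lp ℝ 2 (volume.restrict O)

/-- `φ ∈ C_c^∞(𝒪)`. -/
def IsTestFun {d : ℕ} (O : Set (EuclideanSpace ℝ (Fin d)))
    (φ : EuclideanSpace ℝ (Fin d) → ℝ) : Prop :=
  ContDiff ℝ ∞ φ ∧ HasCompactSupport φ ∧ tsupport φ ⊆ O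

/-- The partial derivative `∂φ/∂ξᵢ`. -/
def partialDer {d : ℕ} (i : Fin d) (φ : EuclideanSpace ℝ (Fin d) → ℝ) :
    EuclideanSpace ℝ (Fin d) → ℝ :=
  fun ξ => fderiv ℝ φ ξ (EuclideanSpace.single i 1)

/-- `u ∈ H¹₀(𝒪)` with weak gradient `g`: the pair `(u, g)` is the limit in `L²(𝒪)` of
`(φₙ, ∇φₙ)` for some test functions `φₙ`. -/
def HasH10Gradient {d : ℕ} (O : Set (EuclideanSpace ℝ (Fin d)))
    (u : L2Dom O) (g : Fin d → L2Dom O) : Prop :=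
  ∃ φ : ℕ → EuclideanSpace ℝ (Fin d) → ℝ, (∀ n, IsTestFun O (φ n)) ∧
    Tendsto (fun n => eLpNorm (fun ξ => φ n ξ - u ξ) 2 (volume.restrict O)) atTop (𝓝 0) ∧
    ∀ i, Tendsto (fun n => eLpNorm (fun ξ => partialDer i (φ n) ξ - g i ξ) 2
      (volume.restrict O)) atTop (𝓝 0)

/-- The graph of the realization `A` in `L²(𝒪)` of the Laplacian with Dirichlet boundary
conditions: `u ∈ D(A)` and `A u = f` iff `u ∈ H¹₀(𝒪)` and
`∫ ∇u · ∇φ = - ∫ f φ` for all test functions `φ`. -/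
def IsDirichletLaplacian {d : ℕ} (O : Set (EuclideanSpace ℝ (Fin d)))
    (u f : L2Dom O) : Prop :=
  ∃ g : Fin d → L2Dom O, HasH10Gradient O u g ∧
    ∀ φ, IsTestFun O φ →
      ∑ i, ∫ ξ in O, g i ξ * partialDer i φ ξ = -∫ ξ in O, f ξ * φ ξ

/-- `e` is a complete orthonormal basis of `L²(𝒪)` of eigenvectors of the Dirichlet Laplacian
`A`, with eigenvalues `-α k`, where `0 < α 0 ≤ α 1 ≤ …`. -/
structure IsDirichletEigenbasis {d : ℕ} (O : Set (EuclideanSpace ℝ (Fin d)))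
    (e : HilbertBasis ℕ ℝ (L2Dom O)) (α : ℕ → ℝ) : Prop where
  eigen : ∀ k, IsDirichletLaplacian O (e k) (-(α k) • e k)
  pos : 0 < α 0
  mono : Monotone α

/-! ### Diagonal operators, fractional powers and inverses

From here on `H` is a real Hilbert space with a complete orthonormal basis `e`, and
`A` is the operator with `A (e k) = -α k • e k`. -/

section Abstract

variable {H : Type*} [NormedAddCommGroup H] [InnerProductSpace ℝ H]

/-- The subspace `{v | ∑ (m k ⟨v, e k⟩)² < ∞}` of `H`. -/
def diagDomain (e : HilbertBasis ℕ ℝ H) (m : ℕ → ℝ) : Submodule ℝ H where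
  carrier := {v | Memℓp (fun k => m k * e.repr v k) 2}
  zero_mem' := by
    have h : (fun k => m k * e.repr (0 : H) k) = (0 : ℕ → ℝ) := by
      funext k; simp
    change Memℓp (fun k => m k * e.repr (0 : H) k) 2
    rw [h]
    exact zero_memℓp
  add_mem' := by
    intro a b ha hb
    have h : (fun k => m k * e.repr (a + b) k)
        = (fun k => m k * e.repr a k) + fun k => m k * e.repr b k := by
      funext k; simp [mul_add]
    change Memℓp (fun k => m k * e.repr (a + b) k) 2
    rw [h]
    exact Memℓp.add ha hb
  smul_mem' := by
    intro c a ha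
    have h : (fun k => m k * e.repr (c • a) k)
        = c • fun k => m k * e.repr a k := by
      funext k; simp [mul_left_comm]
    change Memℓp (fun k => m k * e.repr (c • a) k) 2
    rw [h]
    exact Memℓp.const_smul ha c

/-- The sequence `(m k ⟨v, e k⟩)` as an element of `ℓ²`, for `v` in `diagDomain e m`. -/
def diagSeq (e : HilbertBasis ℕ ℝ H) (m : ℕ → ℝ) : diagDomain e m →ₗ[ℝ] lp (fun _ : ℕ => ℝ) 2 where
  toFun v := ⟨fun k => m k * e.repr (v : H) k, v.2⟩
  map_add' a b := by
    apply Subtype.ext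
    funext k
    change m k * e.repr ((a : H) + b) k = m k * e.repr (a : H) k + m k * e.repr (b : H) k
    simp [mul_add]
  map_smul' c a := by
    apply Subtype.ext
    funext k
    change m k * e.repr (c • (a : H)) k = c * (m k * e.repr (a : H) k)
    simp [mul_left_comm]

/-- The (in general unbounded) self-adjoint operator `v ↦ ∑ m k ⟨v, e k⟩ e k`, with its maximal
domain `{v | ∑ (m k ⟨v, e k⟩)² < ∞}`. -/
def diagPMap (e : HilbertBasis ℕ ℝ H) (m : ℕ → ℝ) : H →ₗ.[ℝ] H where
  domain := diagDomain e m
  toFun := e.repr.symm.toLinearEquiv.toLinearMap ∘ₗ diagSeq e m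

/-- The operator `(-A)^{1/2}` with its domain. -/
def sqrtNeg (e : HilbertBasis ℕ ℝ H) (α : ℕ → ℝ) : H →ₗ.[ℝ] H :=
  diagPMap e fun k => Real.sqrt (α k)

/-- The operator `Q⁻¹` with domain `D(Q⁻¹) = Im Q`. It is the inverse of the restriction of `Q` to
`(ker Q)ᗮ`, hence the ordinary inverse if `Q` is injective and the pseudo-inverse otherwise. -/
def opInv (Q : H →L[ℝ] H) : H →ₗ.[ℝ] H :=
  ((Q : H →ₗ[ℝ] H).toPMap (LinearMap.ker (Q : H →ₗ[ℝ] H))ᗮ).inverse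

/-! ### The spaces `H^δ` and `ℋ = H × H⁻¹` -/

/-- The space `H^δ`, described by Fourier coefficients: sequences `c` with norm
`|c|² = ∑ (α k)^δ (c k)²`. -/
abbrev HSob (α : ℕ → ℝ) (δ : ℝ) : Type :=
  Lp ℝ 2 ((Measure.count : Measure ℕ).withDensity fun k => ENNReal.ofReal (α k ^ δ))

open Classical in
/-- The element of `H^δ` with Fourier coefficients `c` (and `0` if there is none). -/
def HSob.ofCoeff (α : ℕ → ℝ) (δ : ℝ) (c : ℕ → ℝ) : HSob α δ :=
  if h : MemLp c 2 ((Measure.count : Measure ℕ).withDensity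
    fun k => ENNReal.ofReal (α k ^ δ)) then h.toLp c else 0

/-- The inclusion `H ⊆ H⁻¹`. -/
def toHNeg (e : HilbertBasis ℕ ℝ H) (α : ℕ → ℝ) (y : H) : HSob α (-1) :=
  HSob.ofCoeff α (-1) fun k => e.repr y k

/-- The phase space `ℋ = H × H⁻¹`. -/
abbrev Phase (H : Type*) [NormedAddCommGroup H] [InnerProductSpace ℝ H] (α : ℕ → ℝ) : Type _ :=
  H × HSob α (-1)

/-! ### The semigroups `e^{tA}` and `S_μ(t)` -/

/-- The semigroup `e^{tA}` (for `t ≥ 0`). -/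
def heatSemigroup (e : HilbertBasis ℕ ℝ H) (α : ℕ → ℝ) (t : ℝ) (u : H) : H :=
  ∑' k, (Real.exp (-(α k) * t) * e.repr u k) • e k

/-- The matrix of `A_μ (u, v) = (v, (A u - v) / μ)` on the span of `(e k, 0)` and `(0, e k)`, where
`A (e k) = -a • e k`. -/
def waveMatrix (μ a : ℝ) : Matrix (Fin 2) (Fin 2) ℝ :=
  !![0, 1; -(a / μ), -(1 / μ)]

/-- The coefficients of `S_μ(t) z` with respect to `(e k, 0)` and `(0, e k)`. -/
def waveCoeff (e : HilbertBasis ℕ ℝ H) (α : ℕ → ℝ) (μ t : ℝ) (z : Phase H α) (k : ℕ) :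
    Fin 2 → ℝ :=
  (NormedSpace.exp (t • waveMatrix μ (α k))).mulVec ![e.repr z.1 k, z.2 k]

/-- The semigroup `S_μ(t)` (for `t ≥ 0`) on `ℋ` generated by
`A_μ (u, v) = (v, (A u - v) / μ)`. -/
def waveSemigroup (e : HilbertBasis ℕ ℝ H) (α : ℕ → ℝ) (μ t : ℝ) (z : Phase H α) :
    Phase H α :=
  (∑' k, waveCoeff e α μ t z k 0 • e k, HSob.ofCoeff α (-1) fun k => waveCoeff e α μ t z k 1)

/-! ### Skeleton equations, rate functionals and quasi-potentials -/

/-- The element `(0, v / μ)` of `ℋ`, for `v ∈ H`. -/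
def forcing (e : HilbertBasis ℕ ℝ H) (α : ℕ → ℝ) (μ : ℝ) (v : H) : Phase H α :=
  (0, (1 / μ) • toHNeg e α v)

/-- `z` is on `[t₁, t₂]` the mild solution, starting from `z t₁`, of
`μ φ'' = A φ - φ' + B(φ) + Q ψ`, `z = (φ, φ')`. -/
def IsWaveSkeleton (e : HilbertBasis ℕ ℝ H) (α : ℕ → ℝ) (Q : H →L[ℝ] H) (B : H → H)
    (μ t₁ t₂ : ℝ) (ψ : ℝ → H) (z : ℝ → Phase H α) : Prop :=
  ∀ t ∈ Icc t₁ t₂,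
    z t = waveSemigroup e α μ (t - t₁) (z t₁)
      + (∫ s in t₁..t, waveSemigroup e α μ (t - s) (forcing e α μ (B (z s).1)))
      + ∫ s in t₁..t, waveSemigroup e α μ (t - s) (forcing e α μ (Q (ψ s)))

/-- `φ` is on `[t₁, t₂]` the mild solution, starting from `φ t₁`, of `φ' = A φ + B(φ) + Q ψ`. -/
def IsHeatSkeleton (e : HilbertBasis ℕ ℝ H) (α : ℕ → ℝ) (Q : H →L[ℝ] H) (B : H → H)
    (t₁ t₂ : ℝ) (ψ : ℝ → H) (φ : ℝ → H) : Prop :=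
  ∀ t ∈ Icc t₁ t₂,
    φ t = heatSemigroup e α (t - t₁) (φ t₁)
      + (∫ s in t₁..t, heatSemigroup e α (t - s) (B (φ s)))
      + ∫ s in t₁..t, heatSemigroup e α (t - s) (Q (ψ s))

/-- The rate functional `I^μ_{t₁,t₂}(z) = ½ inf |ψ|²_{L²((t₁,t₂);H)}`, over all controls `ψ` that
produce `z`; it is `∞` if there are none. -/
def waveRate (e : HilbertBasis ℕ ℝ H) (α : ℕ → ℝ) (Q : H →L[ℝ] H) (B : H → H)
    (μ t₁ t₂ : ℝ) (z : ℝ → Phase H α) : ℝ≥0∞ :=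
  (1 / 2) * ⨅ (ψ : ℝ → H) (_ : MemLp ψ 2 (volume.restrict (Ioo t₁ t₂)))
    (_ : IsWaveSkeleton e α Q B μ t₁ t₂ ψ z), ∫⁻ s in Ioo t₁ t₂, ‖ψ s‖ₑ ^ 2

/-- The rate functional `I_{t₁,t₂}(φ)` of the heat equation. -/
def heatRate (e : HilbertBasis ℕ ℝ H) (α : ℕ → ℝ) (Q : H →L[ℝ] H) (B : H → H)
    (t₁ t₂ : ℝ) (φ : ℝ → H) : ℝ≥0∞ :=
  (1 / 2) * ⨅ (ψ : ℝ → H) (_ : MemLp ψ 2 (volume.restrict (Ioo t₁ t₂)))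
    (_ : IsHeatSkeleton e α Q B t₁ t₂ ψ φ), ∫⁻ s in Ioo t₁ t₂, ‖ψ s‖ₑ ^ 2

/-- The wave quasi-potential
`V^μ(x, y) = inf {I^μ_{0,T}(z) : T > 0, z ∈ C([0,T]; ℋ), z(0) = 0, z(T) = (x, y)}`. -/
def waveQuasiPotential (e : HilbertBasis ℕ ℝ H) (α : ℕ → ℝ) (Q : H →L[ℝ] H) (B : H → H)
    (μ : ℝ) (x : H) (y : HSob α (-1)) : ℝ≥0∞ :=
  ⨅ (T : ℝ) (_ : 0 < T) (z : ℝ → Phase H α) (_ : ContinuousOn z (Icc 0 T))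
    (_ : z 0 = 0) (_ : z T = (x, y)), waveRate e α Q B μ 0 T z

/-- The heat quasi-potential
`V(x) = inf {I_{0,T}(φ) : T > 0, φ ∈ C([0,T]; H), φ(0) = 0, φ(T) = x}`. -/
def heatQuasiPotential (e : HilbertBasis ℕ ℝ H) (α : ℕ → ℝ) (Q : H →L[ℝ] H) (B : H → H)
    (x : H) : ℝ≥0∞ :=
  ⨅ (T : ℝ) (_ : 0 < T) (φ : ℝ → H) (_ : ContinuousOn φ (Icc 0 T))
    (_ : φ 0 = 0) (_ : φ T = x), heatRate e α Q B 0 T φ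

end Abstract

end

/-!
The quasi-potential is computed by reversing time in the uncontrolled equation.

Write paths as `φ = Q η`. Since `Q` is diagonal in the eigenbasis of `A`, a control `ψ` produces
`φ` from `0` exactly when `η` solves `μ η'' = A η - η' - Q DF(Q η) + ψ` (with `μ = 0` for the heat
equation), and `Q DF(Q η)` is the gradient `N(η)` of `η ↦ F(Q η)`. Let
`E(η, η') = |(-A)^{1/2} η|² + 2 F(Q η) + μ |η'|²`.

*Lower bound.* For vectors, `|ψ|² / 2 = |ψ - 2 η'|² / 2 + 2 ⟨ψ - η', η'⟩`, and along a
solution `2 ⟨ψ - η', η'⟩` is the time derivative of `E`. Hence every control costs at least `E`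
at the final time (`IsPotential.wave_lower`, `IsPotential.heat_lower`). Mild solutions are not
regular enough for this computation in `H`, so it is done for each Fourier coefficient
(`wave_mode_spec`, `heat_mode_spec`), where Duhamel's formula gives absolutely continuous functions,
and then summed over the modes (`energy_sum`, `IsPotential.action_ge`). The nonlinear term is
handled by the chain rule for `F` along an absolutely continuous curve (`integral_inner_gradient`).
The control determines the final `η` only up to the kernel of `Q`; the preimage of least energy is
the pseudo-inverse (`energy_opInv_le`).

*Upper bound.* Equality would hold for `ψ = 2 η'`, that is, for the time reversal of an uncontrolled
solution `u` starting at `(Q⁻¹ x, -Q⁻¹ y)`, which satisfies `E(0) = E(T) + 2 ∫₀ᵀ |u'|²`. Such a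
solution is square-integrable on `[0, ∞)` together with `u'`, because `⟨N(u), u⟩ ≥ 0` and `α` is
bounded below (`IsPotential.wave_relaxation`, `IsPotential.heat_relaxation`). It follows that there
are late unit time intervals on which `u` and `u'` are small in `L²`, and there the reversed path
can be joined to `0` by a smooth cut-off at small cost (`IsPotential.exists_cheap_time`). No decay
of `u` at a rate is needed. In the wave equation the cut-off costs the time derivatives of `u` up to
first order only, since `μ u''` is eliminated by the equation.

For the last claim, minimizing over the final velocity removes the term `μ |Q⁻¹ y|²`, and if `x` is
not in the domain of `(-A)^{1/2} Q⁻¹` the lower bound shows that no control reaches it.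
-/

noncomputable section

/-! ### Fourier coefficients and diagonal operators -/

section Diagonal

variable {H : Type*} [NormedAddCommGroup H] [InnerProductSpace ℝ H]

lemma HilbertBasis.repr_inj (e : HilbertBasis ℕ ℝ H) {x y : H}
    (h : ∀ k, e.repr x k = e.repr y k) : x = y :=
  e.repr.injective (lp.ext (funext h))

lemma HilbertBasis.hasSum_repr_sq (e : HilbertBasis ℕ ℝ H) (v : H) :
    HasSum (fun k => e.repr v k ^ 2) (‖v‖ ^ 2) := by
  have h := lp.hasSum_norm (p := 2) (by norm_num) (e.repr v)
  simpa [e.repr.norm_map] using h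

lemma HilbertBasis.hasSum_repr_mul_repr (e : HilbertBasis ℕ ℝ H) (u v : H) :
    HasSum (fun k => e.repr u k * e.repr v k) (inner ℝ u v) := by
  have h := e.hasSum_inner_mul_inner u v
  refine h.congr_fun fun k => ?_
  simp [e.repr_apply_apply, real_inner_comm]

/-- The element of `H` with prescribed square-summable Fourier coefficients. -/
lemma HilbertBasis.exists_repr_eq (e : HilbertBasis ℕ ℝ H) {c : ℕ → ℝ}
    (hc : Summable fun k => c k ^ 2) : ∃ v : H, ∀ k, e.repr v k = c k := by
  have hm : Memℓp c 2 := by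
    apply memℓp_gen
    simpa using hc
  exact ⟨e.repr.symm ⟨c, hm⟩, fun k => by rw [LinearIsometryEquiv.apply_symm_apply]⟩

lemma HilbertBasis.tsum_repr_smul (e : HilbertBasis ℕ ℝ H) (v : H) :
    ∑' k, e.repr v k • e k = v :=
  (e.hasSum_repr v).tsum_eq

/-- The `k`-th Fourier coefficient as a continuous linear functional. -/
def coeffCLM (e : HilbertBasis ℕ ℝ H) (k : ℕ) : H →L[ℝ] ℝ :=
  innerSL ℝ (e k)

@[simp]
lemma coeffCLM_apply (e : HilbertBasis ℕ ℝ H) (k : ℕ) (v : H) :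
    coeffCLM e k v = e.repr v k := by
  simp [coeffCLM, e.repr_apply_apply]

lemma IntervalIntegrable.repr {f : ℝ → H} {a b : ℝ} (hf : IntervalIntegrable f volume a b)
    (e : HilbertBasis ℕ ℝ H) (k : ℕ) :
    IntervalIntegrable (fun s => e.repr (f s) k) volume a b := by
  rw [intervalIntegrable_iff] at hf ⊢
  simpa [IntegrableOn] using (coeffCLM e k).integrable_comp hf

/-- If the coefficients of `w` are continuous and dominated by a square-summable sequence, then
`w` is continuous. -/
lemma continuousOn_of_repr {X : Type*} [TopologicalSpace X] {s : Set X}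
    (e : HilbertBasis ℕ ℝ H) {w : X → H} {b : ℕ → ℝ} (hb : Summable fun k => b k ^ 2)
    (hw : ∀ k, ContinuousOn (fun t => e.repr (w t) k) s)
    (hwb : ∀ k, ∀ t ∈ s, |e.repr (w t) k| ≤ b k) : ContinuousOn w s := by
  intro t₀ ht₀
  have h1 : ContinuousOn (fun t => ∑' k, e.repr (w t - w t₀) k ^ 2) s := by
    refine continuousOn_tsum (u := fun k => 4 * b k ^ 2) (fun k => ?_) (hb.mul_left 4) ?_
    · refine (((hw k).sub (continuousOn_const (c := e.repr (w t₀) k))).pow 2).congr fun t _ => ?_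
      simp
    · intro k t ht
      have h2 := abs_le.1 (hwb k t ht)
      have h3 := abs_le.1 (hwb k t₀ ht₀)
      simp only [map_sub, lp.coeFn_sub, Pi.sub_apply, norm_pow, Real.norm_eq_abs, sq_abs]
      nlinarith
  have h2 : Tendsto (fun t => ‖w t - w t₀‖ ^ 2) (𝓝[s] t₀) (𝓝 0) := by
    have := h1 t₀ ht₀
    simp only [ContinuousWithinAt, (e.hasSum_repr_sq _).tsum_eq] at this
    simpa using this
  rw [ContinuousWithinAt, tendsto_iff_norm_sub_tendsto_zero]
  have h3 := (Real.continuous_sqrt.tendsto 0).comp h2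
  simpa [Function.comp_def] using h3

open Classical in
/-- The bounded operator `v ↦ ∑ m k ⟨v, e k⟩ e k`, for a bounded sequence `m` (and `0` if `m` is
not bounded). -/
def diagOp (e : HilbertBasis ℕ ℝ H) (m : ℕ → ℝ) : H →L[ℝ] H :=
  if h : ∃ C, ∀ k, |m k| ≤ C then
    LinearMap.mkContinuous
      { toFun := fun v => e.repr.symm ⟨fun k => m k * e.repr v k, by
          obtain ⟨C, hC⟩ := h
          apply memℓp_gen
          refine Summable.of_nonneg_of_le (fun k => by positivity) (fun k => ?_)
            ((e.hasSum_repr_sq v).summable.mul_left (C ^ 2))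
          have h1 : |m k| ^ 2 ≤ C ^ 2 := pow_le_pow_left₀ (abs_nonneg _) (hC k) 2
          simp only [norm_mul, Real.norm_eq_abs, ENNReal.toReal_ofNat, Real.rpow_ofNat, mul_pow,
            sq_abs] at h1 ⊢
          gcongr⟩
        map_add' := fun u v => by
          rw [← map_add]
          congr 1
          apply Subtype.ext
          funext k
          change m k * e.repr (u + v) k = m k * e.repr u k + m k * e.repr v k
          simp [mul_add]
        map_smul' := fun c v => by
          rw [RingHom.id_apply, ← map_smul]
          congr 1
          apply Subtype.ext
          funext k
          change m k * e.repr (c • v) k = c * (m k * e.repr v k)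
          simp [mul_left_comm] }
      h.choose fun v => by
        have hC := h.choose_spec
        have h0 : 0 ≤ h.choose := (abs_nonneg _).trans (hC 0)
        refine (sq_le_sq₀ (norm_nonneg _) (by positivity)).1 ?_
        refine hasSum_le (fun k => ?_) (e.hasSum_repr_sq _)
          (by simpa only [mul_pow] using (e.hasSum_repr_sq v).mul_left (h.choose ^ 2))
        have h1 : |m k| ^ 2 ≤ h.choose ^ 2 := pow_le_pow_left₀ (abs_nonneg _) (hC k) 2
        simp only [LinearMap.coe_mk, AddHom.coe_mk, LinearIsometryEquiv.apply_symm_apply, mul_pow,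
          sq_abs] at h1 ⊢
        gcongr
  else 0

lemma repr_diagOp (e : HilbertBasis ℕ ℝ H) {m : ℕ → ℝ} {C : ℝ} (h : ∀ k, |m k| ≤ C) (v : H)
    (k : ℕ) : e.repr (diagOp e m v) k = m k * e.repr v k := by
  rw [diagOp, dif_pos ⟨C, h⟩]
  simp

lemma norm_diagOp_le (e : HilbertBasis ℕ ℝ H) {m : ℕ → ℝ} {C : ℝ} (h : ∀ k, |m k| ≤ C) :
    ‖diagOp e m‖ ≤ C := by
  have h0 : 0 ≤ C := (abs_nonneg _).trans (h 0)
  refine ContinuousLinearMap.opNorm_le_bound _ h0 fun v => ?_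
  refine (sq_le_sq₀ (norm_nonneg _) (by positivity)).1 ?_
  refine hasSum_le (fun k => ?_) (e.hasSum_repr_sq _)
    (by simpa only [mul_pow] using (e.hasSum_repr_sq v).mul_left (C ^ 2))
  have h1 : |m k| ^ 2 ≤ C ^ 2 := pow_le_pow_left₀ (abs_nonneg _) (h k) 2
  rw [repr_diagOp e h, mul_pow]
  rw [sq_abs] at h1
  gcongr

lemma repr_of_diag (e : HilbertBasis ℕ ℝ H) {Q : H →L[ℝ] H} {lam : ℕ → ℝ}
    (hQ : ∀ k, Q (e k) = lam k • e k) (v : H) (k : ℕ) :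
    e.repr (Q v) k = lam k * e.repr v k := by
  have h1 : HasSum (fun j => e.repr v j • Q (e j)) (Q v) := by
    simpa using (e.hasSum_repr v).mapL Q
  have h2 := h1.mapL (coeffCLM e k)
  rw [coeffCLM_apply] at h2
  refine h2.unique ?_
  convert hasSum_ite_eq k (lam k * e.repr v k) using 1
  funext j
  rw [map_smul, hQ, map_smul]
  by_cases hjk : j = k
  · subst hjk
    simp [e.repr_self, mul_comm]
  · simp [e.repr_self, hjk, lp.single_apply]

/-- An operator that is diagonal in an orthonormal basis is self-adjoint. -/
lemma inner_of_diag (e : HilbertBasis ℕ ℝ H) {Q : H →L[ℝ] H} {lam : ℕ → ℝ}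
    (hQ : ∀ k, Q (e k) = lam k • e k) (u v : H) : inner ℝ (Q u) v = inner ℝ u (Q v) := by
  refine (e.hasSum_repr_mul_repr (Q u) v).unique ?_
  convert e.hasSum_repr_mul_repr u (Q v) using 1
  funext k
  rw [repr_of_diag e hQ, repr_of_diag e hQ]
  ring

lemma diagOp_comm (e : HilbertBasis ℕ ℝ H) {m : ℕ → ℝ} {C : ℝ} (h : ∀ k, |m k| ≤ C)
    {Q : H →L[ℝ] H} {lam : ℕ → ℝ} (hQ : ∀ k, Q (e k) = lam k • e k) (v : H) :
    diagOp e m (Q v) = Q (diagOp e m v) := by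
  refine e.repr_inj fun k => ?_
  rw [repr_diagOp e h, repr_of_diag e hQ, repr_of_diag e hQ, repr_diagOp e h]
  ring

/-! ### Convolution with strongly continuous kernels -/

/-- The operators with symbols `κ k t`; negative times are sent to time `0`, so that the kernel is
strongly continuous on all of `ℝ`. -/
def diagKernel (e : HilbertBasis ℕ ℝ H) (κ : ℕ → ℝ → ℝ) (t : ℝ) : H →L[ℝ] H :=
  diagOp e fun k => κ k (max t 0)

/-- A family of symbols that are continuous in time and bounded by `C` on `[0, ∞)`. -/
structure IsKernel (κ : ℕ → ℝ → ℝ) (C : ℝ) : Prop where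
  continuous : ∀ k, Continuous (κ k)
  bound : ∀ k, ∀ t, 0 ≤ t → |κ k t| ≤ C

lemma IsKernel.nonneg {κ : ℕ → ℝ → ℝ} {C : ℝ} (h : IsKernel κ C) : 0 ≤ C :=
  (abs_nonneg _).trans (h.bound 0 0 le_rfl)

variable {κ : ℕ → ℝ → ℝ} {C : ℝ}

lemma IsKernel.repr_apply (h : IsKernel κ C) (e : HilbertBasis ℕ ℝ H) {t : ℝ} (ht : 0 ≤ t) (v : H)
    (k : ℕ) : e.repr (diagKernel e κ t v) k = κ k t * e.repr v k := by
  rw [diagKernel, repr_diagOp e fun k => h.bound k _ (le_max_right _ _), max_eq_left ht]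

lemma IsKernel.norm_le (h : IsKernel κ C) (e : HilbertBasis ℕ ℝ H) (t : ℝ) :
    ‖diagKernel e κ t‖ ≤ C :=
  norm_diagOp_le e fun k => h.bound k _ (le_max_right _ _)

lemma IsKernel.norm_apply_le (h : IsKernel κ C) (e : HilbertBasis ℕ ℝ H) (t : ℝ) (v : H) :
    ‖diagKernel e κ t v‖ ≤ C * ‖v‖ :=
  (diagKernel e κ t).le_of_opNorm_le (h.norm_le e t) v

lemma IsKernel.comm (h : IsKernel κ C) (e : HilbertBasis ℕ ℝ H) {Q : H →L[ℝ] H} {lam : ℕ → ℝ}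
    (hQ : ∀ k, Q (e k) = lam k • e k) (t : ℝ) (v : H) :
    diagKernel e κ t (Q v) = Q (diagKernel e κ t v) :=
  diagOp_comm e (fun k => h.bound k _ (le_max_right _ _)) hQ v

lemma IsKernel.continuous_uncurry (h : IsKernel κ C) (e : HilbertBasis ℕ ℝ H) :
    Continuous fun q : ℝ × H => diagKernel e κ q.1 q.2 := by
  have hv : ∀ v, Continuous fun t => diagKernel e κ t v := by
    intro v
    rw [← continuousOn_univ]
    refine continuousOn_of_repr e (b := fun k => C * |e.repr v k|) ?_ (fun k => ?_)
      fun k t _ => ?_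
    · simpa only [mul_pow, sq_abs] using (e.hasSum_repr_sq v).summable.mul_left (C ^ 2)
    · refine Continuous.continuousOn ?_
      have h1 : (fun t => e.repr (diagKernel e κ t v) k)
          = fun t => κ k (max t 0) * e.repr v k := by
        funext t
        rw [diagKernel, repr_diagOp e fun k => h.bound k _ (le_max_right _ _)]
      rw [h1]
      exact ((h.continuous k).comp (continuous_id.max continuous_const)).mul continuous_const
    · rw [diagKernel, repr_diagOp e fun k => h.bound k _ (le_max_right _ _), abs_mul]
      exact mul_le_mul_of_nonneg_right (h.bound k _ (le_max_right _ _)) (abs_nonneg _)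
  rw [continuous_iff_continuousAt]
  rintro ⟨t₀, v₀⟩
  rw [ContinuousAt, tendsto_iff_norm_sub_tendsto_zero]
  have h1 : Tendsto (fun q : ℝ × H => C * ‖q.2 - v₀‖
      + ‖diagKernel e κ q.1 v₀ - diagKernel e κ t₀ v₀‖) (𝓝 (t₀, v₀)) (𝓝 0) := by
    have h2 : Continuous fun q : ℝ × H => C * ‖q.2 - v₀‖
        + ‖diagKernel e κ q.1 v₀ - diagKernel e κ t₀ v₀‖ :=
      (continuous_const.mul (continuous_snd.sub continuous_const).norm).add
        (((hv v₀).comp continuous_fst).sub continuous_const).norm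
    simpa using h2.tendsto (t₀, v₀)
  refine squeeze_zero (fun _ => norm_nonneg _) (fun q => ?_) h1
  calc ‖diagKernel e κ q.1 q.2 - diagKernel e κ t₀ v₀‖
      = ‖diagKernel e κ q.1 (q.2 - v₀) + (diagKernel e κ q.1 v₀ - diagKernel e κ t₀ v₀)‖ := by
        rw [map_sub]; abel_nf
    _ ≤ _ := (norm_add_le _ _).trans (by gcongr; exact h.norm_apply_le e _ _)

lemma IsKernel.intervalIntegrable (h : IsKernel κ C) (e : HilbertBasis ℕ ℝ H) {f : ℝ → H}
    {a b : ℝ} (hf : IntervalIntegrable f volume a b) (t : ℝ) :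
    IntervalIntegrable (fun s => diagKernel e κ (t - s) (f s)) volume a b := by
  rw [intervalIntegrable_iff] at hf ⊢
  have hm : AEStronglyMeasurable (fun s => (t - s, f s)) (volume.restrict (uIoc a b)) :=
    (by fun_prop : Continuous fun s : ℝ => t - s).aestronglyMeasurable.prodMk hf.1
  refine Integrable.mono' (hf.norm.const_mul C)
    ((h.continuous_uncurry e).comp_aestronglyMeasurable hm) ?_
  exact Eventually.of_forall fun s => h.norm_apply_le e _ _

/-- The convolution `t ↦ ∫₀ᵗ K(t - s) f(s) ds`. -/
def conv (e : HilbertBasis ℕ ℝ H) (κ : ℕ → ℝ → ℝ) (f : ℝ → H) (t : ℝ) : H :=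
  ∫ s in (0 : ℝ)..t, diagKernel e κ (t - s) (f s)

lemma IsKernel.continuous_conv [CompleteSpace H] (h : IsKernel κ C) (e : HilbertBasis ℕ ℝ H)
    {f : ℝ → H} (hf : Continuous f) : Continuous (conv e κ f) := by
  refine intervalIntegral.continuous_parametric_intervalIntegral_of_continuous
    (f := fun t s => diagKernel e κ (t - s) (f s)) ?_ continuous_id
  exact (h.continuous_uncurry e).comp
    (((continuous_fst.sub continuous_snd)).prodMk (hf.comp continuous_snd))

lemma IsKernel.repr_conv [CompleteSpace H] (h : IsKernel κ C) (e : HilbertBasis ℕ ℝ H) {f : ℝ → H}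
    {t : ℝ} (ht : 0 ≤ t) (hf : IntervalIntegrable f volume 0 t) (k : ℕ) :
    e.repr (conv e κ f t) k = ∫ s in (0 : ℝ)..t, κ k (t - s) * e.repr (f s) k := by
  rw [← coeffCLM_apply, conv,
    ← ContinuousLinearMap.intervalIntegral_comp_comm _ (h.intervalIntegrable e hf t)]
  refine intervalIntegral.integral_congr fun s hs => ?_
  rw [uIcc_of_le ht] at hs
  simp only [coeffCLM_apply]
  rw [h.repr_apply e (by linarith [hs.2])]

end Diagonal

/-! ### Square-integrable functions with values in `H` -/

section SquareIntegrable

variable {H : Type*} [NormedAddCommGroup H] [InnerProductSpace ℝ H]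
  {Ω : Type*} [MeasurableSpace Ω] {ν : Measure Ω}

lemma MeasureTheory.MemLp.integrable_inner_real {f p : Ω → H} (hf : MemLp f 2 ν)
    (hp : MemLp p 2 ν) : Integrable (fun t => inner ℝ (f t) (p t)) ν := by
  refine Integrable.mono' (hf.integrable_norm_pow (by norm_num) |>.add
    (hp.integrable_norm_pow (by norm_num))) (hf.1.inner hp.1) (Eventually.of_forall fun t => ?_)
  have h1 := norm_inner_le_norm (𝕜 := ℝ) (f t) (p t)
  simp only [Pi.add_apply]
  norm_num
  norm_num at h1
  nlinarith [sq_nonneg (‖f t‖ - ‖p t‖), sq_nonneg (‖f t‖), sq_nonneg ‖p t‖]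

lemma MeasureTheory.MemLp.repr {f : Ω → H} (hf : MemLp f 2 ν) (e : HilbertBasis ℕ ℝ H) (k : ℕ) :
    MemLp (fun t => e.repr (f t) k) 2 ν := by
  simpa [Function.comp_def] using (coeffCLM e k).comp_memLp' hf

lemma summable_integral_repr_sq {f : Ω → H} (hf : MemLp f 2 ν) (e : HilbertBasis ℕ ℝ H) :
    Summable fun k => ∫ t, e.repr (f t) k ^ 2 ∂ν := by
  have hi : ∀ k, Integrable (fun t => e.repr (f t) k ^ 2) ν := fun k => (hf.repr e k).integrable_sq
  refine summable_of_sum_le (c := ∫ t, ‖f t‖ ^ 2 ∂ν)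
    (fun k => integral_nonneg fun t => sq_nonneg _) fun u => ?_
  rw [← integral_finsetSum _ fun k _ => hi k]
  refine integral_mono (integrable_finsetSum _ fun k _ => hi k)
    (by simpa using hf.integrable_norm_pow (by norm_num)) fun t => ?_
  exact sum_le_hasSum u (fun k _ => sq_nonneg _) (e.hasSum_repr_sq (f t))

/-- Parseval's identity in `L²(ν; H)`. -/
lemma hasSum_integral_repr_mul_repr {f p : Ω → H} (hf : MemLp f 2 ν) (hp : MemLp p 2 ν)
    (e : HilbertBasis ℕ ℝ H) :
    HasSum (fun k => ∫ t, e.repr (f t) k * e.repr (p t) k ∂ν)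
      (∫ t, inner ℝ (f t) (p t) ∂ν) := by
  have hf2 : ∀ k, Integrable (fun t => e.repr (f t) k ^ 2) ν := fun k => (hf.repr e k).integrable_sq
  have hp2 : ∀ k, Integrable (fun t => e.repr (p t) k ^ 2) ν := fun k => (hp.repr e k).integrable_sq
  have hi : ∀ k, Integrable (fun t => e.repr (f t) k * e.repr (p t) k) ν :=
    fun k => (hf.repr e k).integrable_mul (hp.repr e k)
  have h1 := hasSum_integral_of_summable_integral_norm hi
    (Summable.of_nonneg_of_le (fun k => integral_nonneg fun t => norm_nonneg _) (fun k => ?_)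
      ((summable_integral_repr_sq hf e).add (summable_integral_repr_sq hp e)))
  · simpa only [(e.hasSum_repr_mul_repr _ _).tsum_eq] using h1
  · rw [← integral_add (hf2 k) (hp2 k)]
    refine integral_mono (hi k).norm ((hf2 k).add (hp2 k)) fun t => ?_
    simp only [Real.norm_eq_abs, abs_mul]
    nlinarith [sq_nonneg (|e.repr (f t) k| - |e.repr (p t) k|), sq_abs (e.repr (f t) k),
      sq_abs (e.repr (p t) k), sq_nonneg (e.repr (f t) k), sq_nonneg (e.repr (p t) k)]

/-- The function with values in `H` whose Fourier coefficients are the scalar functions `p k`. -/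
def modeSum (e : HilbertBasis ℕ ℝ H) (p : ℕ → Ω → ℝ) (t : Ω) : H :=
  ∑' k, p k t • e k

omit [MeasurableSpace Ω] in
lemma repr_modeSum (e : HilbertBasis ℕ ℝ H) {p : ℕ → Ω → ℝ} {t : Ω}
    (h : Summable fun k => p k t ^ 2) (k : ℕ) : e.repr (modeSum e p t) k = p k t := by
  obtain ⟨v, hv⟩ := e.exists_repr_eq h
  have h1 : modeSum e p t = v := by
    rw [← e.tsum_repr_smul v]
    exact tsum_congr fun k => by rw [hv]
  rw [h1, hv]

/-- Scalar functions whose squares have summable integrals are the Fourier coefficients of a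
function in `L²(ν; H)`. -/
lemma memLp_modeSum (e : HilbertBasis ℕ ℝ H) {p : ℕ → Ω → ℝ} (hp : ∀ k, MemLp (p k) 2 ν)
    (hs : Summable fun k => ∫ t, p k t ^ 2 ∂ν) :
    MemLp (modeSum e p) 2 ν ∧ ∀ᵐ t ∂ν, ∀ k, e.repr (modeSum e p t) k = p k t := by
  have hi : ∀ k, Integrable (fun t => p k t ^ 2) ν := fun k => (hp k).integrable_sq
  have h1 : ∑' k, ∫⁻ t, ENNReal.ofReal (p k t ^ 2) ∂ν < ⊤ := by
    have h2 : ∀ k, ∫⁻ t, ENNReal.ofReal (p k t ^ 2) ∂ν = ENNReal.ofReal (∫ t, p k t ^ 2 ∂ν) :=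
      fun k => (ofReal_integral_eq_lintegral_ofReal (hi k)
        (Eventually.of_forall fun t => sq_nonneg _)).symm
    simp_rw [h2]
    exact hs.tsum_ofReal_lt_top
  rw [← lintegral_tsum fun k => (hi k).aestronglyMeasurable.aemeasurable.ennreal_ofReal] at h1
  have h3 : ∀ᵐ t ∂ν, Summable fun k => p k t ^ 2 := by
    have h4 := ae_lt_top' (AEMeasurable.tsum fun k =>
      (hi k).aestronglyMeasurable.aemeasurable.ennreal_ofReal) h1.ne
    filter_upwards [h4] with t ht
    have h5 := ENNReal.summable_toReal ht.ne
    refine h5.congr fun k => ?_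
    rw [ENNReal.toReal_ofReal (sq_nonneg _)]
  have h6 : ∀ᵐ t ∂ν, ∀ k, e.repr (modeSum e p t) k = p k t := by
    filter_upwards [h3] with t ht k using repr_modeSum e ht k
  refine ⟨⟨?_, ?_⟩, h6⟩
  · refine aestronglyMeasurable_of_tendsto_ae atTop
      (f := fun n t => ∑ k ∈ Finset.range n, p k t • e k) (fun n => ?_) ?_
    · exact Finset.aestronglyMeasurable_fun_sum _ fun k _ => (hp k).1.smul_const _
    · filter_upwards [h6] with t ht
      have h7 := (e.hasSum_repr (modeSum e p t)).tendsto_sum_nat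
      simpa only [ht] using h7
  · rw [eLpNorm_lt_top_iff_lintegral_rpow_enorm_lt_top (by norm_num) (by norm_num)]
    refine lt_of_eq_of_lt (lintegral_congr_ae ?_) h1
    filter_upwards [h6, h3] with t ht ht3
    have h8 := e.hasSum_repr_sq (modeSum e p t)
    simp only [ht] at h8
    rw [← ENNReal.ofReal_tsum_of_nonneg (fun k => sq_nonneg _) ht3, h8.tsum_eq,
      ENNReal.ofReal_pow (norm_nonneg _), ofReal_norm]
    norm_num

lemma integral_norm_sub_sq {f p : Ω → H} (hf : MemLp f 2 ν) (hp : MemLp p 2 ν) (c : ℝ) :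
    ∫ t, ‖f t - c • p t‖ ^ 2 ∂ν
      = ∫ t, ‖f t‖ ^ 2 ∂ν - 2 * c * ∫ t, inner ℝ (f t) (p t) ∂ν + c ^ 2 * ∫ t, ‖p t‖ ^ 2 ∂ν := by
  have h1 : Integrable (fun t => ‖f t‖ ^ 2) ν := by
    simpa using hf.integrable_norm_pow (by norm_num)
  have h2 : Integrable (fun t => ‖p t‖ ^ 2) ν := by
    simpa using hp.integrable_norm_pow (by norm_num)
  have h3 := hf.integrable_inner_real hp
  rw [← integral_const_mul, ← integral_const_mul, ← integral_sub h1 (h3.const_mul _),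
    ← integral_add (f := fun t => ‖f t‖ ^ 2 - 2 * c * inner ℝ (f t) (p t))
      (h1.sub (h3.const_mul _)) (h2.const_mul _)]
  refine integral_congr_ae (Eventually.of_forall fun t => ?_)
  simp only
  rw [norm_sub_sq_real, inner_smul_right, norm_smul, mul_pow, Real.norm_eq_abs, sq_abs]
  ring

/-- Summation over the modes of the energy identities `∫ fₖ pₖ = ½ E₁ₖ - ½ E₀ₖ + ∫ pₖ²`. It is
Young's inequality `fₖ pₖ ≤ ½ fₖ² + ½ pₖ²` that makes the velocities `pₖ` square-summable. -/
lemma energy_sum (e : HilbertBasis ℕ ℝ H) {f : Ω → H} (hf : MemLp f 2 ν) {p : ℕ → Ω → ℝ}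
    (hp : ∀ k, MemLp (p k) 2 ν) {E₀ E₁ : ℕ → ℝ} (hE₀ : Summable E₀) (hE₁ : ∀ k, 0 ≤ E₁ k)
    (h : ∀ k, ∫ t, e.repr (f t) k * p k t ∂ν
      = E₁ k / 2 - E₀ k / 2 + ∫ t, p k t ^ 2 ∂ν) :
    MemLp (modeSum e p) 2 ν ∧ (∀ᵐ t ∂ν, ∀ k, e.repr (modeSum e p t) k = p k t) ∧ Summable E₁ ∧
      ∫ t, inner ℝ (f t) (modeSum e p t) ∂ν
        = (∑' k, E₁ k) / 2 - (∑' k, E₀ k) / 2 + ∫ t, ‖modeSum e p t‖ ^ 2 ∂ν := by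
  have hs : Summable fun k => ∫ t, p k t ^ 2 ∂ν := by
    refine Summable.of_nonneg_of_le (fun k => integral_nonneg fun t => sq_nonneg _) (fun k => ?_)
      ((summable_integral_repr_sq hf e).add hE₀)
    have hfk := hf.repr e k
    have h1 : ∫ t, e.repr (f t) k * p k t ∂ν
        ≤ ∫ t, (e.repr (f t) k ^ 2 / 2 + p k t ^ 2 / 2) ∂ν := by
      refine integral_mono (hfk.integrable_mul (hp k))
        ((hfk.integrable_sq.div_const 2).add ((hp k).integrable_sq.div_const 2)) fun t => ?_
      simp only
      nlinarith [sq_nonneg (e.repr (f t) k - p k t)]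
    rw [integral_add (hfk.integrable_sq.div_const 2) ((hp k).integrable_sq.div_const 2),
      integral_div, integral_div] at h1
    linarith [h k, hE₁ k]
  obtain ⟨hP, hPk⟩ := memLp_modeSum e hp hs
  have h2 := hasSum_integral_repr_mul_repr hf hP e
  have h3 := hasSum_integral_repr_mul_repr hP hP e
  have h2' : HasSum (fun k => ∫ t, e.repr (f t) k * p k t ∂ν)
      (∫ t, inner ℝ (f t) (modeSum e p t) ∂ν) := by
    refine h2.congr_fun fun k => integral_congr_ae ?_
    filter_upwards [hPk] with t ht
    rw [ht]
  have h3' : HasSum (fun k => ∫ t, p k t ^ 2 ∂ν) (∫ t, ‖modeSum e p t‖ ^ 2 ∂ν) := by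
    simp only [real_inner_self_eq_norm_sq] at h3
    refine h3.congr_fun fun k => integral_congr_ae ?_
    filter_upwards [hPk] with t ht
    rw [ht, sq]
  have h4 : HasSum E₁ (2 * (∫ t, inner ℝ (f t) (modeSum e p t) ∂ν
      - ∫ t, ‖modeSum e p t‖ ^ 2 ∂ν) + ∑' k, E₀ k) := by
    refine (((h2'.sub h3').mul_left 2).add hE₀.hasSum).congr_fun fun k => ?_
    rw [h k]; ring
  refine ⟨hP, hPk, h4.summable, ?_⟩
  rw [h4.tsum_eq]
  ring

end SquareIntegrable

/-! ### Absolutely continuous functions and the chain rule -/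

section ChainRule

/-- The fundamental theorem of calculus for absolutely continuous functions. -/
lemma AbsolutelyContinuousOnInterval.integral_eq_sub_of_ae_hasDerivAt {h h' : ℝ → ℝ} {a b : ℝ}
    (hac : AbsolutelyContinuousOnInterval h a b)
    (hd : ∀ᵐ x, x ∈ uIoc a b → HasDerivAt h (h' x) x) : ∫ x in a..b, h' x = h b - h a := by
  rw [← hac.integral_deriv_eq_sub]
  refine intervalIntegral.integral_congr_ae ?_
  filter_upwards [hd] with x hx hxab
  exact (hx hxab).deriv.symm

lemma IntervalIntegrable.ae_hasDerivAt_const_add_integral {E : Type*} [NormedAddCommGroup E]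
    [NormedSpace ℝ E] [CompleteSpace E] {f : ℝ → E} {a b : ℝ} (hf : IntervalIntegrable f volume a b)
    (c : E) : ∀ᵐ x, x ∈ uIoc a b → HasDerivAt (fun t => c + ∫ s in a..t, f s) (f x) x := by
  filter_upwards [hf.ae_hasDerivAt_integral] with x hx hxab
  exact (hx (uIoc_subset_uIcc hxab) a left_mem_uIcc).const_add c

variable {X : Type*} [PseudoMetricSpace X] {Y : Type*} [PseudoMetricSpace Y]

lemma AbsolutelyContinuousOnInterval.of_dist_le {f : ℝ → X} {g : ℝ → Y} {a b C : ℝ}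
    (hg : AbsolutelyContinuousOnInterval g a b)
    (h : ∀ x ∈ uIcc a b, ∀ y ∈ uIcc a b, dist (f x) (f y) ≤ C * dist (g x) (g y)) :
    AbsolutelyContinuousOnInterval f a b := by
  have h0 := (show Tendsto _ _ _ from hg).const_mul C
  rw [mul_zero] at h0
  refine squeeze_zero' (Eventually.of_forall fun _ => Finset.sum_nonneg fun _ _ => dist_nonneg) ?_
    h0
  refine eventually_inf_principal.2 (Eventually.of_forall fun E hE => ?_)
  rw [Finset.mul_sum]
  exact Finset.sum_le_sum fun i hi => h _ (hE.1 i hi).1 _ (hE.1 i hi).2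

variable {H : Type*} [NormedAddCommGroup H] [InnerProductSpace ℝ H] [CompleteSpace H]

/-- The chain rule for a `C¹` function with Lipschitz gradient along an absolutely continuous
curve. -/
lemma integral_inner_gradient {F : H → ℝ} (hF : ContDiff ℝ 1 F) {κ : ℝ}
    (hFlip : ∀ x y, ‖gradient F x - gradient F y‖ ≤ κ * ‖x - y‖) {φ q : ℝ → H} {T : ℝ}
    (hT : 0 ≤ T) (hq : IntervalIntegrable q volume 0 T)
    (hφ : ∀ t ∈ Icc 0 T, φ t = φ 0 + ∫ s in (0 : ℝ)..t, q s) :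
    ∫ s in (0 : ℝ)..T, inner ℝ (gradient F (φ s)) (q s) = F (φ T) - F (φ 0) := by
  set φ' : ℝ → H := fun t => φ 0 + ∫ s in (0 : ℝ)..t, q s with hφ'
  have hgrad : ∀ x, HasGradientAt F (gradient F x) x := fun x =>
    (hF.differentiable (by norm_num) x).hasGradientAt
  have hcont : ContinuousOn φ' (Icc 0 T) := by
    rw [← uIcc_of_le hT]
    exact continuousOn_const.add (intervalIntegral.continuousOn_primitive_interval
      ((intervalIntegrable_iff').1 hq))
  obtain ⟨R, hR⟩ := isCompact_Icc.exists_bound_of_continuousOn hcont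
  have hlipF : ∀ x ∈ Metric.closedBall (0 : H) R, ∀ y ∈ Metric.closedBall (0 : H) R,
      |F x - F y| ≤ (‖gradient F 0‖ + |κ| * R) * ‖x - y‖ := by
    intro x hx y hy
    refine (convex_closedBall (0 : H) R).norm_image_sub_le_of_norm_hasFDerivWithin_le
      (f' := fun z => fderiv ℝ F z) (fun z _ =>
        (hF.differentiable (by norm_num) z).hasFDerivAt.hasFDerivWithinAt) (fun z hz => ?_) hy hx
    rw [← toDual_gradient, LinearIsometryEquiv.norm_map]
    have h1 := hFlip z 0
    have h2 := norm_le_norm_add_norm_sub' (gradient F z) (gradient F 0)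
    have h3 : κ * ‖z - 0‖ ≤ |κ| * R := by
      rw [sub_zero]
      have := mem_closedBall_zero_iff.1 hz
      exact mul_le_mul (le_abs_self _) this (norm_nonneg _) (abs_nonneg _)
    linarith
  have hac1 : AbsolutelyContinuousOnInterval (fun t => ∫ s in (0 : ℝ)..t, ‖q s‖) 0 T :=
    hq.norm.absolutelyContinuousOnInterval_intervalIntegral left_mem_uIcc
  have hac : AbsolutelyContinuousOnInterval (fun t => F (φ' t)) 0 T := by
    refine hac1.of_dist_le (C := ‖gradient F 0‖ + |κ| * R) fun x hx y hy => ?_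
    have hx0 : IntervalIntegrable q volume 0 x := hq.mono_set (uIcc_subset_uIcc left_mem_uIcc hx)
    have hy0 : IntervalIntegrable q volume 0 y := hq.mono_set (uIcc_subset_uIcc left_mem_uIcc hy)
    rw [uIcc_of_le hT] at hx hy
    have hR0 : 0 ≤ R := (norm_nonneg _).trans (hR x hx)
    rw [Real.dist_eq, Real.dist_eq]
    refine (hlipF _ (mem_closedBall_zero_iff.2 (hR x hx)) _
      (mem_closedBall_zero_iff.2 (hR y hy))).trans ?_
    refine mul_le_mul_of_nonneg_left ?_ (by positivity)
    rw [hφ', add_sub_add_left_eq_sub, intervalIntegral.integral_interval_sub_left hx0 hy0,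
      intervalIntegral.integral_interval_sub_left hx0.norm hy0.norm]
    exact intervalIntegral.norm_integral_le_abs_integral_norm
  have hd : ∀ᵐ x, x ∈ uIoc 0 T →
      HasDerivAt (fun t => F (φ' t)) (inner ℝ (gradient F (φ' x)) (q x)) x := by
    filter_upwards [hq.ae_hasDerivAt_const_add_integral (φ 0)] with x hx hxT
    have := (hgrad (φ' x)).hasFDerivAt.comp_hasDerivAt x (hx hxT)
    rwa [InnerProductSpace.toDual_apply_apply] at this
  have h1 := hac.integral_eq_sub_of_ae_hasDerivAt hd
  have h0 : ∀ t ∈ Icc 0 T, φ t = φ' t := hφ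
  rw [h0 T ⟨hT, le_rfl⟩, h0 0 ⟨le_rfl, hT⟩, ← h1]
  refine intervalIntegral.integral_congr fun s hs => ?_
  rw [uIcc_of_le hT] at hs
  rw [h0 s hs]

end ChainRule

/-! ### Linear systems with integrable forcing -/

section Modes

variable {ι : Type*} [Fintype ι] [DecidableEq ι]

/-- `E t` is the matrix exponential `exp (t M)`, characterized by its differential equation and the
group law. -/
structure IsExpOf (M : Matrix ι ι ℝ) (E : ℝ → Matrix ι ι ℝ) : Prop where
  zero : E 0 = 1
  add : ∀ s t, E (s + t) = E s * E t
  comm : ∀ t, M * E t = E t * M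
  deriv : ∀ i j t, HasDerivAt (fun s => E s i j) ((M * E t) i j) t

variable {M : Matrix ι ι ℝ} {E : ℝ → Matrix ι ι ℝ}

lemma IsExpOf.continuous (hE : IsExpOf M E) (i j : ι) : Continuous fun t => E t i j :=
  continuous_iff_continuousAt.2 fun t => (hE.deriv i j t).continuousAt

lemma IsExpOf.mul_neg (hE : IsExpOf M E) (t : ℝ) : E t * E (-t) = 1 := by
  rw [← hE.add, add_neg_cancel, hE.zero]

/-- The solution of `X' = M X + f b`, `X 0 = x₀`, written as `exp (t M)` applied to an absolutely
continuous function. -/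
def modeSol (E : ℝ → Matrix ι ι ℝ) (b x₀ : ι → ℝ) (f : ℝ → ℝ) (i : ι) (t : ℝ) : ℝ :=
  ∑ j, E t i j * (x₀ j + ∫ s in (0 : ℝ)..t, (E (-s)).mulVec b j * f s)

lemma IsExpOf.continuous_mulVec (hE : IsExpOf M E) (b : ι → ℝ) (j : ι) :
    Continuous fun s => (E s).mulVec b j :=
  continuous_finsetSum _ fun k _ => (hE.continuous j k).mul continuous_const

lemma IsExpOf.integrable_weight (hE : IsExpOf M E) (b : ι → ℝ) {f : ℝ → ℝ} {T : ℝ}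
    (hf : IntervalIntegrable f volume 0 T) (j : ι) :
    IntervalIntegrable (fun s => (E (-s)).mulVec b j * f s) volume 0 T :=
  hf.continuousOn_mul ((hE.continuous_mulVec b j).comp continuous_neg).continuousOn

/-- Duhamel's formula for `modeSol`. -/
lemma IsExpOf.modeSol_eq (hE : IsExpOf M E) (b x₀ : ι → ℝ) {f : ℝ → ℝ} {t : ℝ}
    (hf : IntervalIntegrable f volume 0 t) (i : ι) :
    modeSol E b x₀ f i t
      = (E t).mulVec x₀ i + ∫ s in (0 : ℝ)..t, (E (t - s)).mulVec b i * f s := by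
  have h1 : ∀ s, (E (t - s)).mulVec b i * f s
      = ∑ j, E t i j * ((E (-s)).mulVec b j * f s) := by
    intro s
    rw [sub_eq_add_neg, hE.add, ← Matrix.mulVec_mulVec]
    simp only [Matrix.mulVec, dotProduct, Finset.sum_mul, mul_assoc]
  simp_rw [h1]
  rw [intervalIntegral.integral_finsetSum fun j _ => (hE.integrable_weight b hf j).const_mul _]
  simp only [modeSol, mul_add, Finset.sum_add_distrib, intervalIntegral.integral_const_mul]
  rfl

lemma IsExpOf.modeSol_zero (hE : IsExpOf M E) (b x₀ : ι → ℝ) (f : ℝ → ℝ) (i : ι) :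
    modeSol E b x₀ f i 0 = x₀ i := by
  simp [modeSol, hE.zero, Matrix.one_apply]

lemma IsExpOf.hasDerivAt_modeSol_aux (hE : IsExpOf M E) (b x₀ : ι → ℝ) {f : ℝ → ℝ} {t : ℝ}
    (h : ∀ j, HasDerivAt (fun t => x₀ j + ∫ s in (0 : ℝ)..t, (E (-s)).mulVec b j * f s)
      ((E (-t)).mulVec b j * f t) t) (i : ι) :
    HasDerivAt (modeSol E b x₀ f i) (∑ j, M i j * modeSol E b x₀ f j t + b i * f t) t := by
  have h1 := HasDerivAt.fun_sum (u := Finset.univ) fun j _ => (hE.deriv i j t).mul (h j)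
  refine h1.congr_deriv ?_
  rw [Finset.sum_add_distrib]
  congr 1
  · simp only [modeSol, Finset.mul_sum, Matrix.mul_apply, Finset.sum_mul]
    rw [Finset.sum_comm]
    simp only [mul_assoc]
  · have h2 : (E t).mulVec ((E (-t)).mulVec b) i = b i := by
      rw [Matrix.mulVec_mulVec, hE.mul_neg, Matrix.one_mulVec]
    rw [← h2, Matrix.mulVec, dotProduct, Finset.sum_mul]
    simp only [mul_assoc]

lemma IsExpOf.hasDerivAt_modeSol (hE : IsExpOf M E) (b x₀ : ι → ℝ) {f : ℝ → ℝ}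
    (hf : Continuous f) (i : ι) (t : ℝ) :
    HasDerivAt (modeSol E b x₀ f i) (∑ j, M i j * modeSol E b x₀ f j t + b i * f t) t := by
  refine hE.hasDerivAt_modeSol_aux b x₀ (fun j => ?_) i
  have hc : Continuous fun s => (E (-s)).mulVec b j * f s :=
    ((hE.continuous_mulVec b j).comp continuous_neg).mul hf
  exact (intervalIntegral.integral_hasDerivAt_right (hc.intervalIntegrable _ _)
    (hc.stronglyMeasurableAtFilter _ _) hc.continuousAt).const_add _

lemma IsExpOf.ae_hasDerivAt_modeSol (hE : IsExpOf M E) (b x₀ : ι → ℝ) {f : ℝ → ℝ} {T : ℝ}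
    (hf : IntervalIntegrable f volume 0 T) :
    ∀ᵐ t, t ∈ uIoc 0 T → ∀ i,
      HasDerivAt (modeSol E b x₀ f i) (∑ j, M i j * modeSol E b x₀ f j t + b i * f t) t := by
  have h1 : ∀ᵐ t, ∀ j, t ∈ uIoc 0 T →
      HasDerivAt (fun t => x₀ j + ∫ s in (0 : ℝ)..t, (E (-s)).mulVec b j * f s)
        ((E (-t)).mulVec b j * f t) t :=
    ae_all_iff.2 fun j => (hE.integrable_weight b hf j).ae_hasDerivAt_const_add_integral (x₀ j)
  filter_upwards [h1] with t ht htT i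
  exact hE.hasDerivAt_modeSol_aux b x₀ (fun j => ht j htT) i

lemma absolutelyContinuousOnInterval_const {X : Type*} [PseudoMetricSpace X] (c : X) (a b : ℝ) :
    AbsolutelyContinuousOnInterval (fun _ => c) a b :=
  (LipschitzWith.const c).lipschitzOnWith.absolutelyContinuousOnInterval

lemma AbsolutelyContinuousOnInterval.finset_sum {κ : Type*} (s : Finset κ) {f : κ → ℝ → ℝ}
    {a b : ℝ} (h : ∀ i ∈ s, AbsolutelyContinuousOnInterval (f i) a b) :
    AbsolutelyContinuousOnInterval (fun t => ∑ i ∈ s, f i t) a b := by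
  classical
  induction s using Finset.induction_on with
  | empty => simpa using absolutelyContinuousOnInterval_const (0 : ℝ) a b
  | insert i s hi ih =>
    simp only [Finset.sum_insert hi]
    exact (h i (Finset.mem_insert_self _ _)).fun_add
      (ih fun j hj => h j (Finset.mem_insert_of_mem hj))

lemma IsExpOf.absolutelyContinuous_modeSol (hE : IsExpOf M E) (b x₀ : ι → ℝ) {f : ℝ → ℝ} {T : ℝ}
    (hf : IntervalIntegrable f volume 0 T) (i : ι) :
    AbsolutelyContinuousOnInterval (modeSol E b x₀ f i) 0 T := by
  refine AbsolutelyContinuousOnInterval.finset_sum _ fun j _ => ?_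
  refine AbsolutelyContinuousOnInterval.fun_mul ?_ ?_
  · refine ContDiffOn.absolutelyContinuousOnInterval (ContDiff.contDiffOn ?_)
    rw [contDiff_one_iff_deriv]
    refine ⟨fun t => (hE.deriv i j t).differentiableAt, ?_⟩
    have h1 : _root_.deriv (fun t => E t i j) = fun t => (M * E t) i j :=
      funext fun t => (hE.deriv i j t).deriv
    rw [h1]
    exact continuous_finsetSum _ fun k _ => continuous_const.mul (hE.continuous k j)
  · exact (absolutelyContinuousOnInterval_const _ _ _).fun_add
      ((hE.integrable_weight b hf j).absolutelyContinuousOnInterval_intervalIntegral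
        left_mem_uIcc)

/-- A classical solution of `X' = M X + h b` is given by Duhamel's formula. -/
lemma IsExpOf.duhamel (hE : IsExpOf M E) {b : ι → ℝ} {X : ι → ℝ → ℝ} {h : ℝ → ℝ} {t : ℝ}
    (ht : 0 ≤ t) (hX : ∀ i, ContinuousOn (X i) (Icc 0 t)) (hh : ContinuousOn h (Icc 0 t))
    (hd : ∀ i, ∀ s ∈ Ioo 0 t, HasDerivAt (X i) (∑ j, M i j * X j s + b i * h s) s) (i : ι) :
    X i t = (E t).mulVec (fun j => X j 0) i
      + ∫ s in (0 : ℝ)..t, (E (t - s)).mulVec b i * h s := by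
  have hcE : ∀ j, Continuous fun s => E (t - s) i j := fun j =>
    (hE.continuous i j).comp (continuous_const.sub continuous_id)
  have h1 : ∫ s in (0 : ℝ)..t, (E (t - s)).mulVec b i * h s
      = ∑ j, E (t - t) i j * X j t - ∑ j, E (t - 0) i j * X j 0 := by
    refine intervalIntegral.integral_eq_sub_of_hasDerivAt_of_le ht
      (f := fun s => ∑ j, E (t - s) i j * X j s)
      (continuousOn_finsetSum _ fun j _ => (hcE j).continuousOn.mul (hX j)) (fun s hs => ?_) ?_
    · have h0 : ∀ j, HasDerivAt (fun s => E (t - s) i j) (-((M * E (t - s)) i j)) s := fun j =>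
        (hE.deriv i j (t - s)).comp_const_sub t s
      have h2 := HasDerivAt.fun_sum (u := Finset.univ) fun j _ => (h0 j).fun_mul (hd j s hs)
      refine h2.congr_deriv ?_
      have h3 : ∑ j, (M * E (t - s)) i j * X j s = ∑ j, E (t - s) i j * ∑ k, M j k * X k s := by
        rw [hE.comm]
        simp only [Matrix.mul_apply, Finset.sum_mul, Finset.mul_sum, mul_assoc]
        rw [Finset.sum_comm]
      simp only [mul_add, neg_mul, Finset.sum_add_distrib, Finset.sum_neg_distrib]
      rw [h3, Matrix.mulVec, dotProduct, Finset.sum_mul]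
      simp only [mul_assoc]
      ring
    · refine ContinuousOn.intervalIntegrable ?_
      rw [uIcc_of_le ht]
      exact ((hE.continuous_mulVec b i).comp
        (continuous_const.sub continuous_id)).continuousOn.mul hh
  rw [h1, sub_self, sub_zero, hE.zero]
  simp [Matrix.one_apply, Matrix.mulVec, dotProduct]

end Modes

/-! ### The modes of the heat equation and of the damped wave equation -/

section HeatWaveModes

/-- `exp (-a t)`, as a `1 × 1` matrix. -/
def heatExp (a t : ℝ) : Matrix Unit Unit ℝ := Matrix.of fun _ _ => Real.exp (-a * t)

lemma isExpOf_heatExp (a : ℝ) : IsExpOf (Matrix.of fun _ _ : Unit => -a) (heatExp a) where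
  zero := by ext i j; simp [heatExp]
  add s t := by ext i j; simp [heatExp, Matrix.mul_apply, mul_add, Real.exp_add]
  comm t := by ext i j; simp [heatExp, Matrix.mul_apply, mul_comm]
  deriv i j t := by
    have h1 := ((hasDerivAt_id t).const_mul (-a)).exp
    refine h1.congr_deriv ?_
    simp [heatExp, Matrix.mul_apply, mul_comm]

/-- `exp (t M)` for the matrix `M` of a mode of the damped wave equation. -/
def waveExp (μ a t : ℝ) : Matrix (Fin 2) (Fin 2) ℝ := NormedSpace.exp (t • waveMatrix μ a)

lemma isExpOf_waveExp (μ a : ℝ) : IsExpOf (waveMatrix μ a) (waveExp μ a) where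
  zero := by simp [waveExp]
  add s t := by
    simp only [waveExp, add_smul]
    exact Matrix.exp_add_of_commute _ _ (((Commute.refl _).smul_left s).smul_right t)
  comm t := by
    let _ : NormedRing (Matrix (Fin 2) (Fin 2) ℝ) := Matrix.linftyOpNormedRing
    let _ : NormedAlgebra ℝ (Matrix (Fin 2) (Fin 2) ℝ) := Matrix.linftyOpNormedAlgebra
    exact (((Commute.refl (waveMatrix μ a)).smul_right t).exp_right).eq
  deriv i j t := by
    let _ : NormedRing (Matrix (Fin 2) (Fin 2) ℝ) := Matrix.linftyOpNormedRing
    let _ : NormedAlgebra ℝ (Matrix (Fin 2) (Fin 2) ℝ) := Matrix.linftyOpNormedAlgebra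
    have h1 := hasDerivAt_exp_smul_const' (𝕂 := ℝ) (waveMatrix μ a) t
    have h2 : HasDerivAt (fun s => (waveExp μ a s)) (waveMatrix μ a * waveExp μ a t) t := h1
    exact (hasDerivAt_pi.1 ((hasDerivAt_pi.1 h2) i)) j

/-- The direction `(0, 1/μ)` in which the wave equation is forced. -/
def waveDir (μ : ℝ) : Fin 2 → ℝ := ![0, 1 / μ]

lemma wave_hasDerivAt_energy {μ a : ℝ} (hμ : 0 < μ) {u w : ℝ → ℝ} {f t : ℝ}
    (hu : HasDerivAt u (w t) t)
    (hw : HasDerivAt w (-(a / μ) * u t + -(1 / μ) * w t + 1 / μ * f) t) :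
    HasDerivAt (fun t => (a * u t ^ 2 + μ * w t ^ 2) / 2) (f * w t - w t ^ 2) t := by
  have h1 := (((hu.fun_pow 2).const_mul a).add ((hw.fun_pow 2).const_mul μ)).div_const 2
  refine h1.congr_deriv ?_
  field_simp
  ring

/-- The energy of the unforced damped oscillator decreases. -/
lemma waveExp_energy_le {μ a : ℝ} (hμ : 0 < μ) (x : Fin 2 → ℝ) {t : ℝ} (ht : 0 ≤ t) :
    a * (waveExp μ a t).mulVec x 0 ^ 2 + μ * (waveExp μ a t).mulVec x 1 ^ 2
      ≤ a * x 0 ^ 2 + μ * x 1 ^ 2 := by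
  have hE := isExpOf_waveExp μ a
  have hd : ∀ i s, HasDerivAt (fun s => (waveExp μ a s).mulVec x i)
      (∑ j, waveMatrix μ a i j * (waveExp μ a s).mulVec x j) s := by
    intro i s
    have h1 := HasDerivAt.fun_sum (u := Finset.univ) fun j _ => (hE.deriv i j s).mul_const (x j)
    refine h1.congr_deriv ?_
    simp only [Matrix.mul_apply, Matrix.mulVec, dotProduct, Finset.sum_mul, Finset.mul_sum,
      mul_assoc]
    rw [Finset.sum_comm]
  have hanti : Antitone fun s =>
      (a * (waveExp μ a s).mulVec x 0 ^ 2 + μ * (waveExp μ a s).mulVec x 1 ^ 2) / 2 := by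
    have h2 : ∀ s, HasDerivAt (fun s =>
        (a * (waveExp μ a s).mulVec x 0 ^ 2 + μ * (waveExp μ a s).mulVec x 1 ^ 2) / 2)
        (0 * (waveExp μ a s).mulVec x 1 - (waveExp μ a s).mulVec x 1 ^ 2) s := by
      intro s
      refine wave_hasDerivAt_energy hμ ?_ ?_
      · simpa [waveMatrix] using hd 0 s
      · simpa [waveMatrix] using hd 1 s
    refine antitone_of_deriv_nonpos (fun s => (h2 s).differentiableAt) fun s => ?_
    rw [(h2 s).deriv]
    nlinarith [sq_nonneg ((waveExp μ a s).mulVec x 1)]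
  have h3 := hanti ht
  simp only [waveExp, zero_smul, NormedSpace.exp_zero, Matrix.one_mulVec] at h3 ⊢
  linarith

lemma memLp_two_of_continuousOn {E : Type*} [NormedAddCommGroup E] {f : ℝ → E} {T : ℝ}
    (hf : ContinuousOn f (Icc 0 T)) :
    MemLp f 2 (volume.restrict (Ioc 0 T)) := by
  obtain ⟨C, hC⟩ := isCompact_Icc.exists_bound_of_continuousOn hf
  refine MemLp.of_bound
    ((hf.mono Ioc_subset_Icc_self).aestronglyMeasurable measurableSet_Ioc) C ?_
  exact (ae_restrict_iff' measurableSet_Ioc).2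
    (Eventually.of_forall fun t ht => hC t (Ioc_subset_Icc_self ht))

lemma MeasureTheory.MemLp.intervalIntegrable_two {E : Type*} [NormedAddCommGroup E] {f : ℝ → E}
    {T t : ℝ} (ht : t ∈ Icc 0 T) (hf : MemLp f 2 (volume.restrict (Ioc 0 T))) :
    IntervalIntegrable f volume 0 t := by
  rw [intervalIntegrable_iff_integrableOn_Ioc_of_le ht.1]
  exact IntegrableOn.mono_set (hf.integrable (by norm_num)) (Ioc_subset_Ioc_right ht.2)

variable {T : ℝ} {f : ℝ → ℝ}

/-- The solution of `u' = -a u + f`, `u(0) = ξ`. -/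
def heatMode (a ξ : ℝ) (f : ℝ → ℝ) (t : ℝ) : ℝ :=
  modeSol (heatExp a) (fun _ => 1) (fun _ => ξ) f () t

/-- The velocity of `heatMode`. -/
def heatVel (a ξ : ℝ) (f : ℝ → ℝ) (t : ℝ) : ℝ := f t - a * heatMode a ξ f t

/-- The solution of `μ u'' = -a u - u' + f`, `u(0) = ξ`, `u'(0) = ζ`. -/
def waveMode (μ a ξ ζ : ℝ) (f : ℝ → ℝ) (t : ℝ) : ℝ :=
  modeSol (waveExp μ a) (waveDir μ) ![ξ, ζ] f 0 t

/-- The velocity of `waveMode`. -/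
def waveVel (μ a ξ ζ : ℝ) (f : ℝ → ℝ) (t : ℝ) : ℝ :=
  modeSol (waveExp μ a) (waveDir μ) ![ξ, ζ] f 1 t

lemma heatMode_eq (a ξ : ℝ) {t : ℝ} (hf : IntervalIntegrable f volume 0 t) :
    heatMode a ξ f t
      = Real.exp (-a * t) * ξ + ∫ s in (0 : ℝ)..t, Real.exp (-a * (t - s)) * f s := by
  rw [heatMode, (isExpOf_heatExp a).modeSol_eq _ _ hf]
  simp [heatExp, Matrix.mulVec, dotProduct]

lemma waveMode_eq (μ a ξ ζ : ℝ) {t : ℝ} (hf : IntervalIntegrable f volume 0 t) :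
    waveMode μ a ξ ζ f t = (waveExp μ a t).mulVec ![ξ, ζ] 0
      + ∫ s in (0 : ℝ)..t, (waveExp μ a (t - s)).mulVec (waveDir μ) 0 * f s :=
  (isExpOf_waveExp μ a).modeSol_eq _ _ hf 0

lemma waveVel_eq (μ a ξ ζ : ℝ) {t : ℝ} (hf : IntervalIntegrable f volume 0 t) :
    waveVel μ a ξ ζ f t = (waveExp μ a t).mulVec ![ξ, ζ] 1
      + ∫ s in (0 : ℝ)..t, (waveExp μ a (t - s)).mulVec (waveDir μ) 1 * f s :=
  (isExpOf_waveExp μ a).modeSol_eq _ _ hf 1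

lemma heatMode_zero (a ξ : ℝ) (f : ℝ → ℝ) : heatMode a ξ f 0 = ξ :=
  (isExpOf_heatExp a).modeSol_zero _ _ _ _

lemma waveMode_zero (μ a ξ ζ : ℝ) (f : ℝ → ℝ) : waveMode μ a ξ ζ f 0 = ξ :=
  (isExpOf_waveExp μ a).modeSol_zero _ _ _ 0

lemma waveVel_zero (μ a ξ ζ : ℝ) (f : ℝ → ℝ) : waveVel μ a ξ ζ f 0 = ζ :=
  (isExpOf_waveExp μ a).modeSol_zero _ _ _ 1

lemma heatMode_hasDerivAt (a ξ : ℝ) (hf : Continuous f) (t : ℝ) :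
    HasDerivAt (heatMode a ξ f) (heatVel a ξ f t) t := by
  refine ((isExpOf_heatExp a).hasDerivAt_modeSol _ _ hf () t).congr_deriv ?_
  simp [heatVel, heatMode]
  ring

lemma waveMode_hasDerivAt (μ a ξ ζ : ℝ) (hf : Continuous f) (t : ℝ) :
    HasDerivAt (waveMode μ a ξ ζ f) (waveVel μ a ξ ζ f t) t := by
  refine ((isExpOf_waveExp μ a).hasDerivAt_modeSol _ _ hf 0 t).congr_deriv ?_
  simp [waveMatrix, waveDir, waveVel]

lemma waveVel_hasDerivAt (μ a ξ ζ : ℝ) (hf : Continuous f) (t : ℝ) :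
    HasDerivAt (waveVel μ a ξ ζ f)
      (-(a / μ) * waveMode μ a ξ ζ f t + -(1 / μ) * waveVel μ a ξ ζ f t + 1 / μ * f t) t := by
  refine ((isExpOf_waveExp μ a).hasDerivAt_modeSol _ _ hf 1 t).congr_deriv ?_
  simp [waveMatrix, waveDir, waveVel, waveMode]

/-- Energy identity for one mode of the heat equation. For merely square-integrable forcing the
equation holds almost everywhere, and absolute continuity allows integration. -/
lemma heat_mode_spec (hT : 0 ≤ T) (a ξ : ℝ) (hf : MemLp f 2 (volume.restrict (Ioc 0 T))) :
    MemLp (heatVel a ξ f) 2 (volume.restrict (Ioc 0 T)) ∧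
    (∀ t ∈ Icc 0 T, heatMode a ξ f t = ξ + ∫ s in (0 : ℝ)..t, heatVel a ξ f s) ∧
    ∫ s in Ioc 0 T, f s * heatVel a ξ f s
      = a * heatMode a ξ f T ^ 2 / 2 - a * ξ ^ 2 / 2 + ∫ s in Ioc 0 T, heatVel a ξ f s ^ 2 := by
  have hE := isExpOf_heatExp a
  have hfi : IntervalIntegrable f volume 0 T := hf.intervalIntegrable_two ⟨hT, le_rfl⟩
  have hac : AbsolutelyContinuousOnInterval (heatMode a ξ f) 0 T :=
    hE.absolutelyContinuous_modeSol _ _ hfi ()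
  have hd : ∀ᵐ t, t ∈ uIoc 0 T → HasDerivAt (heatMode a ξ f) (heatVel a ξ f t) t := by
    filter_upwards [hE.ae_hasDerivAt_modeSol (fun _ => 1) (fun _ => ξ) hfi] with t ht htT
    refine (ht htT ()).congr_deriv ?_
    simp [heatVel, heatMode]
    ring
  have hcu : MemLp (heatMode a ξ f) 2 (volume.restrict (Ioc 0 T)) :=
    memLp_two_of_continuousOn (by simpa [uIcc_of_le hT] using hac.continuousOn)
  have hp : MemLp (heatVel a ξ f) 2 (volume.restrict (Ioc 0 T)) := hf.sub (hcu.const_mul a)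
  refine ⟨hp, fun t ht => ?_, ?_⟩
  · have hsub : uIcc 0 t ⊆ uIcc 0 T := by
      rw [uIcc_of_le ht.1, uIcc_of_le hT]; exact Icc_subset_Icc_right ht.2
    have h1 := (hac.mono hsub).integral_eq_sub_of_ae_hasDerivAt (h' := heatVel a ξ f) (by
      filter_upwards [hd] with s hs hst
      refine hs ?_
      rw [uIoc_of_le ht.1] at hst
      rw [uIoc_of_le hT]
      exact Ioc_subset_Ioc_right ht.2 hst)
    rw [h1, heatMode_zero]
    ring
  · have h2 := ((hac.fun_mul hac).const_mul (a / 2)).integral_eq_sub_of_ae_hasDerivAt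
      (h' := fun t => f t * heatVel a ξ f t - heatVel a ξ f t ^ 2) (by
        filter_upwards [hd] with s hs hst
        refine (((hs hst).mul (hs hst)).const_mul (a / 2)).congr_deriv ?_
        simp only [heatVel]
        ring)
    rw [intervalIntegral.integral_of_le hT,
      integral_sub (f := fun t => f t * heatVel a ξ f t) (hf.integrable_mul hp) hp.integrable_sq,
      heatMode_zero] at h2
    linarith

/-- Energy identity for one mode of the wave equation. -/
lemma wave_mode_spec (hT : 0 ≤ T) {μ : ℝ} (hμ : 0 < μ) (a ξ ζ : ℝ)
    (hf : MemLp f 2 (volume.restrict (Ioc 0 T))) :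
    MemLp (waveVel μ a ξ ζ f) 2 (volume.restrict (Ioc 0 T)) ∧
    (∀ t ∈ Icc 0 T, waveMode μ a ξ ζ f t = ξ + ∫ s in (0 : ℝ)..t, waveVel μ a ξ ζ f s) ∧
    ∫ s in Ioc 0 T, f s * waveVel μ a ξ ζ f s
      = (a * waveMode μ a ξ ζ f T ^ 2 + μ * waveVel μ a ξ ζ f T ^ 2) / 2
        - (a * ξ ^ 2 + μ * ζ ^ 2) / 2 + ∫ s in Ioc 0 T, waveVel μ a ξ ζ f s ^ 2 := by
  have hE := isExpOf_waveExp μ a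
  have hfi : IntervalIntegrable f volume 0 T := hf.intervalIntegrable_two ⟨hT, le_rfl⟩
  have hacu : AbsolutelyContinuousOnInterval (waveMode μ a ξ ζ f) 0 T :=
    hE.absolutelyContinuous_modeSol _ _ hfi 0
  have hacp : AbsolutelyContinuousOnInterval (waveVel μ a ξ ζ f) 0 T :=
    hE.absolutelyContinuous_modeSol _ _ hfi 1
  have hd : ∀ᵐ t, t ∈ uIoc 0 T → HasDerivAt (waveMode μ a ξ ζ f) (waveVel μ a ξ ζ f t) t ∧
      HasDerivAt (waveVel μ a ξ ζ f)
        (-(a / μ) * waveMode μ a ξ ζ f t + -(1 / μ) * waveVel μ a ξ ζ f t + 1 / μ * f t) t := by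
    filter_upwards [hE.ae_hasDerivAt_modeSol (waveDir μ) ![ξ, ζ] hfi] with t ht htT
    refine ⟨(ht htT 0).congr_deriv ?_, (ht htT 1).congr_deriv ?_⟩
    · simp [waveMatrix, waveDir, waveVel]
    · simp [waveMatrix, waveDir, waveVel, waveMode]
  have hp : MemLp (waveVel μ a ξ ζ f) 2 (volume.restrict (Ioc 0 T)) :=
    memLp_two_of_continuousOn (by simpa [uIcc_of_le hT] using hacp.continuousOn)
  refine ⟨hp, fun t ht => ?_, ?_⟩
  · have hsub : uIcc 0 t ⊆ uIcc 0 T := by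
      rw [uIcc_of_le ht.1, uIcc_of_le hT]; exact Icc_subset_Icc_right ht.2
    have h1 := (hacu.mono hsub).integral_eq_sub_of_ae_hasDerivAt (h' := waveVel μ a ξ ζ f) (by
      filter_upwards [hd] with s hs hst
      refine (hs ?_).1
      rw [uIoc_of_le ht.1] at hst
      rw [uIoc_of_le hT]
      exact Ioc_subset_Ioc_right ht.2 hst)
    rw [h1, waveMode_zero]
    ring
  · have hacE : AbsolutelyContinuousOnInterval
        (fun t => (a * waveMode μ a ξ ζ f t ^ 2 + μ * waveVel μ a ξ ζ f t ^ 2) / 2) 0 T := by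
      have h3 := (((hacu.fun_mul hacu).const_mul a).fun_add
        ((hacp.fun_mul hacp).const_mul μ)).const_mul (1 / 2)
      convert h3 using 2
      ring
    have h2 := hacE.integral_eq_sub_of_ae_hasDerivAt
      (h' := fun t => f t * waveVel μ a ξ ζ f t - waveVel μ a ξ ζ f t ^ 2) (by
        filter_upwards [hd] with s hs hst
        exact wave_hasDerivAt_energy hμ (hs hst).1 (hs hst).2)
    rw [intervalIntegral.integral_of_le hT,
      integral_sub (f := fun t => f t * waveVel μ a ξ ζ f t) (hf.integrable_mul hp)
        hp.integrable_sq, waveMode_zero, waveVel_zero] at h2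
    linarith

end HeatWaveModes

/-! ### The pulled-back gradient and the action of a path -/

section Action

variable {H : Type*} [NormedAddCommGroup H] [InnerProductSpace ℝ H] [CompleteSpace H]

/-- The gradient `η ↦ Q (DF (Q η))` of `F ∘ Q`, for `Q` self-adjoint. -/
def pullGrad (Q : H →L[ℝ] H) (F : H → ℝ) (η : H) : H := Q (gradient F (Q η))

/-- The hypotheses on the diagonal operator `Q` and the potential `F`. -/
structure IsPotential (e : HilbertBasis ℕ ℝ H) (Q : H →L[ℝ] H) (lam : ℕ → ℝ) (F : H → ℝ)
    (κ : ℝ) : Prop where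
  diag : ∀ k, Q (e k) = lam k • e k
  contDiff : ContDiff ℝ 1 F
  map_zero : F 0 = 0
  nonneg : ∀ x, 0 ≤ F x
  mono : ∀ x, 0 ≤ inner ℝ (gradient F x) x
  lipschitz : ∀ x y, ‖gradient F x - gradient F y‖ ≤ κ * ‖x - y‖

variable {e : HilbertBasis ℕ ℝ H} {Q : H →L[ℝ] H} {lam : ℕ → ℝ} {F : H → ℝ} {κ : ℝ}

lemma IsPotential.gradient_zero (h : IsPotential e Q lam F κ) : gradient F 0 = 0 := by
  have h1 : IsLocalMin F 0 := Eventually.of_forall fun x => by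
    rw [h.map_zero]; exact h.nonneg x
  rw [gradient, h1.fderiv_eq_zero, _root_.map_zero]

lemma IsPotential.continuous_gradient (h : IsPotential e Q lam F κ) : Continuous (gradient F) := by
  refine (LipschitzWith.of_dist_le_mul (K := κ.toNNReal) fun x y => ?_).continuous
  rw [dist_eq_norm, dist_eq_norm]
  refine (h.lipschitz x y).trans ?_
  gcongr
  exact Real.le_coe_toNNReal κ

lemma IsPotential.pullGrad_lipschitz (h : IsPotential e Q lam F κ) (x y : H) :
    ‖pullGrad Q F x - pullGrad Q F y‖ ≤ ‖Q‖ * (|κ| * ‖Q‖) * ‖x - y‖ := by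
  rw [pullGrad, pullGrad, ← map_sub]
  calc ‖Q (gradient F (Q x) - gradient F (Q y))‖
      ≤ ‖Q‖ * (|κ| * (‖Q‖ * ‖x - y‖)) := by
        refine (Q.le_opNorm _).trans ?_
        gcongr
        refine (h.lipschitz _ _).trans ?_
        rw [← map_sub]
        exact mul_le_mul (le_abs_self κ) (Q.le_opNorm _) (norm_nonneg _) (abs_nonneg _)
    _ = _ := by ring

lemma IsPotential.pullGrad_zero (h : IsPotential e Q lam F κ) : pullGrad Q F 0 = 0 := by
  rw [pullGrad, _root_.map_zero, h.gradient_zero, _root_.map_zero]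

lemma IsPotential.norm_pullGrad_le (h : IsPotential e Q lam F κ) (x : H) :
    ‖pullGrad Q F x‖ ≤ ‖Q‖ * (|κ| * ‖Q‖) * ‖x‖ := by
  simpa [h.pullGrad_zero] using h.pullGrad_lipschitz x 0

lemma IsPotential.continuous_pullGrad (h : IsPotential e Q lam F κ) :
    Continuous (pullGrad Q F) :=
  Q.continuous.comp (h.continuous_gradient.comp Q.continuous)

lemma IsPotential.inner_pullGrad (h : IsPotential e Q lam F κ) (x y : H) :
    inner ℝ (pullGrad Q F x) y = inner ℝ (gradient F (Q x)) (Q y) :=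
  inner_of_diag e h.diag _ _

lemma IsPotential.inner_pullGrad_self_nonneg (h : IsPotential e Q lam F κ) (x : H) :
    0 ≤ inner ℝ (pullGrad Q F x) x := by
  rw [h.inner_pullGrad]; exact h.mono _

/-- The potential energy gained along a path `η` whose velocity has coefficients `p k`. -/
lemma IsPotential.integral_inner_pullGrad (h : IsPotential e Q lam F κ) {T : ℝ} (hT : 0 ≤ T)
    {η P : ℝ → H} {p : ℕ → ℝ → ℝ} (hP : MemLp P 2 (volume.restrict (Ioc 0 T)))
    (hPp : ∀ᵐ t ∂volume.restrict (Ioc 0 T), ∀ k, e.repr (P t) k = p k t)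
    (hη : ∀ k, ∀ t ∈ Icc 0 T, e.repr (η t) k = e.repr (η 0) k + ∫ s in (0 : ℝ)..t, p k s) :
    ∫ s in Ioc 0 T, inner ℝ (pullGrad Q F (η s)) (P s) = F (Q (η T)) - F (Q (η 0)) := by
  have hPi : ∀ t ∈ Icc 0 T, IntervalIntegrable P volume 0 t := fun t ht =>
    hP.intervalIntegrable_two ht
  have h1 : ∀ t ∈ Icc 0 T, η t = η 0 + ∫ s in (0 : ℝ)..t, P s := by
    intro t ht
    refine e.repr_inj fun k => ?_
    rw [map_add, lp.coeFn_add, Pi.add_apply, hη k t ht, ← coeffCLM_apply e k (∫ s in _..t, P s),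
      ← ContinuousLinearMap.intervalIntegral_comp_comm _ (hPi t ht)]
    congr 1
    refine intervalIntegral.integral_congr_ae ?_
    filter_upwards [(ae_restrict_iff' measurableSet_Ioc).1 hPp] with s hs hst
    rw [uIoc_of_le ht.1] at hst
    rw [coeffCLM_apply, hs (Ioc_subset_Ioc_right ht.2 hst)]
  have hQP := hPi T ⟨hT, le_rfl⟩
  have h2 := integral_inner_gradient h.contDiff h.lipschitz (φ := fun t => Q (η t))
    (q := fun t => Q (P t)) hT
    (by
      rw [intervalIntegrable_iff] at hQP ⊢
      exact Q.integrable_comp hQP)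
    (fun t ht => by
      rw [h1 t ht, map_add, Q.intervalIntegral_comp_comm (hPi t ht)])
  rw [← h2, intervalIntegral.integral_of_le hT]
  simp only [h.inner_pullGrad]

/-- The lower bound for the action: `∫ |ψ|² = ∫ |ψ - 2 P|² + 4 ∫ ⟨ψ, P⟩ - 4 ∫ |P|²`, where `P` is
the velocity of the path, and the last two terms are a total derivative. -/
lemma IsPotential.action_ge (h : IsPotential e Q lam F κ) {T : ℝ} (hT : 0 ≤ T)
    {η ψ : ℝ → H} {p : ℕ → ℝ → ℝ} {E₁ : ℕ → ℝ}
    (hψ : MemLp ψ 2 (volume.restrict (Ioc 0 T)))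
    (hf : MemLp (fun s => ψ s - pullGrad Q F (η s)) 2 (volume.restrict (Ioc 0 T)))
    (hp : ∀ k, MemLp (p k) 2 (volume.restrict (Ioc 0 T))) (hη0 : η 0 = 0)
    (hη : ∀ k, ∀ t ∈ Icc 0 T, e.repr (η t) k = ∫ s in (0 : ℝ)..t, p k s)
    (hE₁ : ∀ k, 0 ≤ E₁ k)
    (hen : ∀ k, ∫ s in Ioc 0 T, e.repr (ψ s - pullGrad Q F (η s)) k * p k s
      = E₁ k / 2 + ∫ s in Ioc 0 T, p k s ^ 2) :
    Summable E₁ ∧ 2 * ∑' k, E₁ k + 4 * F (Q (η T)) ≤ ∫ s in Ioc 0 T, ‖ψ s‖ ^ 2 := by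
  obtain ⟨hP, hPp, hE, hid⟩ := energy_sum e hf hp (E₀ := fun _ => 0) summable_zero hE₁
    (by simpa using hen)
  set P := modeSum e p
  refine ⟨hE, ?_⟩
  have h1 := h.integral_inner_pullGrad hT hP hPp (η := η) (by simpa [hη0] using hη)
  rw [hη0, _root_.map_zero, h.map_zero, sub_zero] at h1
  have hN : MemLp (fun s => pullGrad Q F (η s)) 2 (volume.restrict (Ioc 0 T)) := by
    simpa [Pi.sub_def] using hψ.sub hf
  have h2 : ∫ s in Ioc 0 T, inner ℝ (ψ s) (P s)
      = (∫ s in Ioc 0 T, inner ℝ (ψ s - pullGrad Q F (η s)) (P s))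
        + ∫ s in Ioc 0 T, inner ℝ (pullGrad Q F (η s)) (P s) := by
    rw [← integral_add (hf.integrable_inner_real hP) (hN.integrable_inner_real hP)]
    simp only [← inner_add_left, sub_add_cancel]
  have h3 := integral_norm_sub_sq hψ hP 2
  have h4 : 0 ≤ ∫ s in Ioc 0 T, ‖ψ s - (2 : ℝ) • P s‖ ^ 2 :=
    integral_nonneg fun s => sq_nonneg _
  simp only [tsum_zero] at hid
  linarith

end Action

/-! ### The two semigroups in terms of diagonal kernels -/

section Semigroups

variable {H : Type*} [NormedAddCommGroup H] [InnerProductSpace ℝ H]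

/-- The symbol of `e^{tA}`. -/
def heatSym (α : ℕ → ℝ) (k : ℕ) (t : ℝ) : ℝ := Real.exp (-α k * t)

/-- The symbol of the position component of `v ↦ S_μ(t) (0, v / μ)`. -/
def wavePosSym (α : ℕ → ℝ) (μ : ℝ) (k : ℕ) (t : ℝ) : ℝ :=
  (waveExp μ (α k) t).mulVec (waveDir μ) 0

/-- The symbol of the velocity component of `v ↦ S_μ(t) (0, v / μ)`. -/
def waveVelSym (α : ℕ → ℝ) (μ : ℝ) (k : ℕ) (t : ℝ) : ℝ :=
  (waveExp μ (α k) t).mulVec (waveDir μ) 1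

variable {α : ℕ → ℝ} {μ : ℝ}

lemma isKernel_heatSym (hα : ∀ k, 0 < α k) : IsKernel (heatSym α) 1 where
  continuous k := by unfold heatSym; fun_prop
  bound k t ht := by
    rw [heatSym, Real.abs_exp, Real.exp_le_one_iff]
    nlinarith [hα k]

lemma isKernel_wavePosSym (hα : 0 < α 0) (hmono : Monotone α) (hμ : 0 < μ) :
    IsKernel (wavePosSym α μ) (Real.sqrt (1 / (μ * α 0))) where
  continuous k := (isExpOf_waveExp μ (α k)).continuous_mulVec _ _
  bound k t ht := by
    have h1 := waveExp_energy_le (a := α k) hμ (waveDir μ) ht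
    refine Real.abs_le_sqrt ?_
    have h2 : α 0 * wavePosSym α μ k t ^ 2 ≤ α k * wavePosSym α μ k t ^ 2 := by
      gcongr; exact hmono (Nat.zero_le k)
    have h3 : α k * waveDir μ 0 ^ 2 + μ * waveDir μ 1 ^ 2 = 1 / μ := by
      simp [waveDir]; field_simp
    have h4 : 0 ≤ μ * waveVelSym α μ k t ^ 2 := by positivity
    unfold waveVelSym at h4
    rw [h3] at h1
    rw [one_div, mul_inv, ← div_eq_mul_inv, le_div_iff₀ hα, ← one_div]
    have h5 : wavePosSym α μ k t = (waveExp μ (α k) t).mulVec (waveDir μ) 0 := rfl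
    rw [← h5] at h1
    linarith

lemma isKernel_waveVelSym (hα : ∀ k, 0 < α k) (hμ : 0 < μ) :
    IsKernel (waveVelSym α μ) (1 / μ) where
  continuous k := (isExpOf_waveExp μ (α k)).continuous_mulVec _ _
  bound k t ht := by
    have h1 := waveExp_energy_le (a := α k) hμ (waveDir μ) ht
    refine abs_le_of_sq_le_sq ?_ (by positivity)
    have h3 : α k * waveDir μ 0 ^ 2 + μ * waveDir μ 1 ^ 2 = μ * (1 / μ) ^ 2 := by
      simp [waveDir]
    have h4 : 0 ≤ α k * wavePosSym α μ k t ^ 2 := by have := hα k; positivity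
    rw [h3] at h1
    unfold wavePosSym at h4
    exact le_of_mul_le_mul_left (by unfold waveVelSym; linarith) hμ

lemma heatSemigroup_eq (hα : ∀ k, 0 < α k) (e : HilbertBasis ℕ ℝ H) {t : ℝ} (ht : 0 ≤ t) (v : H) :
    heatSemigroup e α t v = diagKernel e (heatSym α) t v := by
  rw [heatSemigroup, ← e.tsum_repr_smul (diagKernel e (heatSym α) t v)]
  refine tsum_congr fun k => ?_
  rw [(isKernel_heatSym hα).repr_apply e ht, heatSym]

/-- The weighted counting measure behind `H^{-1}`. -/
abbrev negMeasure (α : ℕ → ℝ) : Measure ℕ :=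
  (Measure.count : Measure ℕ).withDensity fun k => ENNReal.ofReal (α k ^ (-1 : ℝ))

lemma lintegral_negMeasure_le (hα : 0 < α 0) (hmono : Monotone α) (e : HilbertBasis ℕ ℝ H) (y : H) :
    ∫⁻ k, ‖e.repr y k‖ₑ ^ 2 ∂negMeasure α ≤ ENNReal.ofReal ((α 0)⁻¹ * ‖y‖ ^ 2) := by
  rw [lintegral_withDensity_eq_lintegral_mul _ (measurable_of_countable _)
    (measurable_of_countable _), lintegral_count]
  have h1 := (e.hasSum_repr_sq y).mul_left (α 0)⁻¹
  rw [← h1.tsum_eq, ENNReal.ofReal_tsum_of_nonneg (fun k => by positivity) h1.summable]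
  refine ENNReal.tsum_le_tsum fun k => ?_
  rw [Pi.mul_apply, Real.rpow_neg_one, ENNReal.ofReal_mul (by positivity), Real.enorm_eq_ofReal_abs,
    ← ENNReal.ofReal_pow (abs_nonneg _), sq_abs]
  gcongr
  exact hmono (Nat.zero_le k)

lemma eLpNorm_negMeasure_le (hα : 0 < α 0) (hmono : Monotone α) (e : HilbertBasis ℕ ℝ H) (y : H) :
    eLpNorm (fun k => e.repr y k) 2 (negMeasure α)
      ≤ ENNReal.ofReal (Real.sqrt (α 0)⁻¹ * ‖y‖) := by
  have h1 : ENNReal.ofReal (Real.sqrt (α 0)⁻¹ * ‖y‖)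
      = ENNReal.ofReal ((α 0)⁻¹ * ‖y‖ ^ 2) ^ (1 / 2 : ℝ) := by
    rw [ENNReal.ofReal_rpow_of_nonneg (by positivity) (by norm_num), ← Real.sqrt_eq_rpow,
      Real.sqrt_mul (by positivity), Real.sqrt_sq (norm_nonneg y)]
  rw [eLpNorm_eq_lintegral_rpow_enorm_toReal (by norm_num) (by norm_num), h1]
  simp only [ENNReal.toReal_ofNat, ENNReal.rpow_ofNat]
  gcongr
  exact lintegral_negMeasure_le hα hmono e y

lemma memLp_negMeasure (hα : 0 < α 0) (hmono : Monotone α) (e : HilbertBasis ℕ ℝ H) (y : H) :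
    MemLp (fun k => e.repr y k) 2 (negMeasure α) :=
  ⟨(measurable_of_countable _).aestronglyMeasurable,
    (eLpNorm_negMeasure_le hα hmono e y).trans_lt ENNReal.ofReal_lt_top⟩

lemma forall_of_ae_negMeasure (hα : ∀ k, 0 < α k) {p : ℕ → Prop} (h : ∀ᵐ k ∂negMeasure α, p k)
    (k : ℕ) : p k := by
  by_contra hk
  have h1 : negMeasure α {k} = 0 := measure_mono_null (by simpa using hk) (ae_iff.1 h)
  rw [withDensity_apply _ (measurableSet_singleton k)] at h1
  simp only [Measure.restrict_singleton, Measure.count_singleton, one_smul, lintegral_dirac] at h1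
  have := Real.rpow_pos_of_pos (hα k) (-1)
  rw [ENNReal.ofReal_eq_zero] at h1
  linarith

lemma toHNeg_eq (hα : 0 < α 0) (hmono : Monotone α) (e : HilbertBasis ℕ ℝ H) (y : H) :
    toHNeg e α y = (memLp_negMeasure hα hmono e y).toLp _ := by
  rw [toHNeg, HSob.ofCoeff, dif_pos (memLp_negMeasure hα hmono e y)]

lemma toHNeg_apply (hα : 0 < α 0) (hmono : Monotone α) (e : HilbertBasis ℕ ℝ H) (y : H) (k : ℕ) :
    toHNeg e α y k = e.repr y k := by
  rw [toHNeg_eq hα hmono]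
  exact forall_of_ae_negMeasure (fun k => hα.trans_le (hmono (Nat.zero_le k)))
    (memLp_negMeasure hα hmono e y).coeFn_toLp k

lemma toHNeg_injective (hα : 0 < α 0) (hmono : Monotone α) (e : HilbertBasis ℕ ℝ H) :
    Function.Injective (toHNeg e α) := fun x y hxy => e.repr_inj fun k => by
  rw [← toHNeg_apply hα hmono, ← toHNeg_apply hα hmono, hxy]

/-- The inclusion `H ⊆ H⁻¹` as a continuous linear map. -/
def negIncl (hα : 0 < α 0) (hmono : Monotone α) (e : HilbertBasis ℕ ℝ H) :
    H →L[ℝ] HSob α (-1) :=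
  LinearMap.mkContinuous
    { toFun := toHNeg e α
      map_add' := fun x y => by
        rw [toHNeg_eq hα hmono, toHNeg_eq hα hmono, toHNeg_eq hα hmono, ← MemLp.toLp_add]
        congr 1
        funext k
        simp
      map_smul' := fun c x => by
        rw [toHNeg_eq hα hmono, toHNeg_eq hα hmono, RingHom.id_apply, ← MemLp.toLp_const_smul]
        congr 1
        funext k
        simp }
    (Real.sqrt (α 0)⁻¹) fun y => by
      rw [LinearMap.coe_mk, AddHom.coe_mk, toHNeg_eq hα hmono, Lp.norm_toLp]
      exact ENNReal.toReal_le_of_le_ofReal (by positivity) (eLpNorm_negMeasure_le hα hmono e y)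

@[simp]
lemma negIncl_apply (hα : 0 < α 0) (hmono : Monotone α) (e : HilbertBasis ℕ ℝ H) (y : H) :
    negIncl hα hmono e y = toHNeg e α y := rfl

lemma HSob.zero_apply (hα : ∀ k, 0 < α k) (k : ℕ) : (0 : HSob α (-1)) k = 0 :=
  forall_of_ae_negMeasure (p := fun k => (0 : HSob α (-1)) k = 0) hα (Lp.coeFn_zero _ _ _) k

lemma waveSemigroup_zero (hα : ∀ k, 0 < α k) (e : HilbertBasis ℕ ℝ H) (t : ℝ) :
    waveSemigroup e α μ t 0 = 0 := by
  have h1 : ∀ k, waveCoeff e α μ t 0 k = 0 := by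
    intro k
    have h2 : ![e.repr (0 : Phase H α).1 k, (0 : Phase H α).2 k] = 0 := by
      funext i
      fin_cases i
      · simp
      · simpa using HSob.zero_apply hα k
    rw [waveCoeff, h2, Matrix.mulVec_zero]
  have h3 : MemLp (fun _ : ℕ => (0 : ℝ)) 2 (negMeasure α) := MemLp.zero'
  rw [waveSemigroup]
  simp only [h1, Pi.zero_apply, zero_smul, tsum_zero]
  rw [HSob.ofCoeff, dif_pos h3]
  rfl

lemma waveSemigroup_forcing (hα : 0 < α 0) (hmono : Monotone α) (hμ : 0 < μ)
    (e : HilbertBasis ℕ ℝ H) {t : ℝ} (ht : 0 ≤ t) (v : H) :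
    waveSemigroup e α μ t (forcing e α μ v) = (diagKernel e (wavePosSym α μ) t v,
      toHNeg e α (diagKernel e (waveVelSym α μ) t v)) := by
  have hα' : ∀ k, 0 < α k := fun k => hα.trans_le (hmono (Nat.zero_le k))
  have h1 : ∀ k, waveCoeff e α μ t (forcing e α μ v) k
      = e.repr v k • (waveExp μ (α k) t).mulVec (waveDir μ) := by
    intro k
    have h2 : ![e.repr (forcing e α μ v).1 k, (forcing e α μ v).2 k]
        = e.repr v k • waveDir μ := by
      have h3 : (forcing e α μ v).2 k = 1 / μ * e.repr v k := by
        have h4 : (forcing e α μ v).2 = toHNeg e α ((1 / μ) • v) := by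
          simp only [forcing, ← negIncl_apply hα hmono, map_smul]
        rw [h4, toHNeg_apply hα hmono]
        simp
      funext i
      fin_cases i
      · simp [forcing, waveDir]
      · simp only [Fin.mk_one, Matrix.cons_val_one, Matrix.cons_val_fin_one, Pi.smul_apply,
          waveDir, smul_eq_mul]
        rw [h3]
        simp [mul_comm]
    rw [waveCoeff, h2, Matrix.mulVec_smul]
    rfl
  rw [waveSemigroup]
  refine Prod.ext ?_ ?_
  · simp only [h1]
    rw [← e.tsum_repr_smul (diagKernel e (wavePosSym α μ) t v)]
    refine tsum_congr fun k => ?_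
    rw [(isKernel_wavePosSym hα hmono hμ).repr_apply e ht, Pi.smul_apply, smul_eq_mul, mul_comm]
    rfl
  · simp only [h1, toHNeg]
    congr 1
    funext k
    rw [(isKernel_waveVelSym hα' hμ).repr_apply e ht, Pi.smul_apply, smul_eq_mul, mul_comm]
    rfl

end Semigroups

/-! ### The skeleton equations as convolution equations, and the lower bounds -/

section LowerBound

variable {H : Type*} [NormedAddCommGroup H] [InnerProductSpace ℝ H] [CompleteSpace H]
  {α : ℕ → ℝ} {μ : ℝ} {e : HilbertBasis ℕ ℝ H} {Q : H →L[ℝ] H} {lam : ℕ → ℝ} {F : H → ℝ} {κ : ℝ}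
  {κs : ℕ → ℝ → ℝ} {C T : ℝ}

omit [CompleteSpace H] in
lemma IsKernel.conv_add (h : IsKernel κs C) {f g : ℝ → H} {t : ℝ}
    (hf : IntervalIntegrable f volume 0 t) (hg : IntervalIntegrable g volume 0 t) :
    conv e κs (fun s => f s + g s) t = conv e κs f t + conv e κs g t := by
  simp only [conv, map_add]
  exact intervalIntegral.integral_add (h.intervalIntegrable e hf t) (h.intervalIntegrable e hg t)

lemma IsKernel.conv_comp (h : IsKernel κs C) (hQ : ∀ k, Q (e k) = lam k • e k) {f : ℝ → H}
    {t : ℝ} (hf : IntervalIntegrable f volume 0 t) :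
    conv e κs (fun s => Q (f s)) t = Q (conv e κs f t) := by
  simp only [conv, h.comm e hQ]
  exact Q.intervalIntegral_comp_comm (h.intervalIntegrable e hf t)

omit [CompleteSpace H] in
lemma integral_heatSemigroup (hα : ∀ k, 0 < α k) {v : ℝ → H} {t : ℝ} (ht : 0 ≤ t) :
    ∫ s in (0 : ℝ)..t, heatSemigroup e α (t - s) (v s) = conv e (heatSym α) v t := by
  refine intervalIntegral.integral_congr fun s hs => ?_
  rw [uIcc_of_le ht] at hs
  exact heatSemigroup_eq hα e (by linarith [hs.2]) _

lemma integral_waveSemigroup (hα : 0 < α 0) (hmono : Monotone α) (hμ : 0 < μ) {v : ℝ → H} {t : ℝ}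
    (ht : 0 ≤ t) (hv : IntervalIntegrable v volume 0 t) :
    ∫ s in (0 : ℝ)..t, waveSemigroup e α μ (t - s) (forcing e α μ (v s))
      = (conv e (wavePosSym α μ) v t, toHNeg e α (conv e (waveVelSym α μ) v t)) := by
  have hα' : ∀ k, 0 < α k := fun k => hα.trans_le (hmono (Nat.zero_le k))
  have h1 := (isKernel_wavePosSym hα hmono hμ).intervalIntegrable e hv t
  have h2 := (isKernel_waveVelSym hα' hμ).intervalIntegrable e hv t
  rw [← negIncl_apply hα hmono, conv, conv,
    ← ContinuousLinearMap.intervalIntegral_comp_comm _ h2]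
  rw [intervalIntegrable_iff_integrableOn_Ioc_of_le ht] at h1 h2
  rw [intervalIntegral.integral_of_le ht, intervalIntegral.integral_of_le ht,
    intervalIntegral.integral_of_le ht,
    ← integral_pair h1 ((negIncl hα hmono e).integrable_comp h2)]
  refine setIntegral_congr_fun measurableSet_Ioc fun s hs => ?_
  simp only [negIncl_apply]
  exact waveSemigroup_forcing hα hmono hμ e (by linarith [hs.2]) _

/-- The forcing `f = ψ - Q DF(φ)` of the linear equation solved by `Q⁻¹ φ`. -/
def netForcing (Q : H →L[ℝ] H) (F : H → ℝ) (ψ φ : ℝ → H) (s : ℝ) : H :=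
  ψ s - Q (gradient F (φ s))

lemma IsPotential.memLp_drift (h : IsPotential e Q lam F κ) {φ : ℝ → H}
    (hφ : ContinuousOn φ (Icc 0 T)) :
    MemLp (fun s => Q (gradient F (φ s))) 2 (volume.restrict (Ioc 0 T)) :=
  memLp_two_of_continuousOn
    ((Q.continuous.comp h.continuous_gradient).comp_continuousOn hφ)

lemma IsPotential.memLp_netForcing (h : IsPotential e Q lam F κ) {φ ψ : ℝ → H}
    (hφ : ContinuousOn φ (Icc 0 T)) (hψ : MemLp ψ 2 (volume.restrict (Ioc 0 T))) :
    MemLp (netForcing Q F ψ φ) 2 (volume.restrict (Ioc 0 T)) :=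
  hψ.sub (h.memLp_drift hφ)

/-- The two convolution terms of a skeleton equation combine into the convolution with
`netForcing`, and `Q` can be taken out of the convolution because it is diagonal. -/
lemma IsPotential.conv_split (h : IsPotential e Q lam F κ) (hK : IsKernel κs C) {φ ψ : ℝ → H}
    {B : H → H} (hB : ∀ x, B x = -Q (Q (gradient F x)))
    (hφ : ContinuousOn φ (Icc 0 T)) (hψ : MemLp ψ 2 (volume.restrict (Ioc 0 T))) {t : ℝ}
    (ht : t ∈ Icc 0 T) :
    IntervalIntegrable (fun s => B (φ s)) volume 0 t ∧
    IntervalIntegrable (fun s => Q (ψ s)) volume 0 t ∧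
    conv e κs (fun s => B (φ s)) t + conv e κs (fun s => Q (ψ s)) t
      = Q (conv e κs (netForcing Q F ψ φ) t) := by
  have h1 : IntervalIntegrable (fun s => B (φ s)) volume 0 t := by
    have h2 := (h.memLp_drift hφ).intervalIntegrable_two ht
    simp only [hB]
    rw [intervalIntegrable_iff] at h2 ⊢
    exact (Q.integrable_comp h2).neg
  have h3 : IntervalIntegrable (fun s => Q (ψ s)) volume 0 t := by
    have h2 := hψ.intervalIntegrable_two ht
    rw [intervalIntegrable_iff] at h2 ⊢
    exact Q.integrable_comp h2
  refine ⟨h1, h3, ?_⟩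
  rw [← hK.conv_add h1 h3,
    ← hK.conv_comp h.diag ((h.memLp_netForcing hφ hψ).intervalIntegrable_two ht)]
  congr 1
  funext s
  rw [hB, netForcing, map_sub]
  abel

/-- A path from `0` solves the skeleton equation iff it is the image under `Q` of the solution of
the linear equation forced by `netForcing`. Thus a controlled path has values in the range of `Q`,
in both components. -/
lemma IsPotential.isWaveSkeleton_iff (h : IsPotential e Q lam F κ) (hα : 0 < α 0)
    (hmono : Monotone α) (hμ : 0 < μ) {B : H → H} (hB : ∀ x, B x = -Q (Q (gradient F x)))
    {ψ : ℝ → H} (hψ : MemLp ψ 2 (volume.restrict (Ioc 0 T))) {z : ℝ → Phase H α}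
    (hz : ContinuousOn z (Icc 0 T)) (hz0 : z 0 = 0) :
    IsWaveSkeleton e α Q B μ 0 T ψ z ↔ ∀ t ∈ Icc 0 T,
      z t = (Q (conv e (wavePosSym α μ) (netForcing Q F ψ fun s => (z s).1) t),
        toHNeg e α (Q (conv e (waveVelSym α μ) (netForcing Q F ψ fun s => (z s).1) t))) := by
  have hα' : ∀ k, 0 < α k := fun k => hα.trans_le (hmono (Nat.zero_le k))
  have hφ : ContinuousOn (fun s => (z s).1) (Icc 0 T) := continuous_fst.comp_continuousOn hz
  refine forall₂_congr fun t ht => ?_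
  obtain ⟨h1, h2, h3⟩ := h.conv_split (isKernel_wavePosSym hα hmono hμ) hB hφ hψ ht
  obtain ⟨-, -, h4⟩ := h.conv_split (isKernel_waveVelSym hα' hμ) hB hφ hψ ht
  rw [hz0, waveSemigroup_zero hα', zero_add, integral_waveSemigroup hα hmono hμ ht.1 h1,
    integral_waveSemigroup hα hmono hμ ht.1 h2, Prod.mk_add_mk, h3, ← h4,
    ← negIncl_apply hα hmono, ← negIncl_apply hα hmono, ← negIncl_apply hα hmono, map_add]

/-- The analogue of `IsPotential.isWaveSkeleton_iff` for the heat equation. -/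
lemma IsPotential.isHeatSkeleton_iff (h : IsPotential e Q lam F κ) (hα : ∀ k, 0 < α k)
    {B : H → H} (hB : ∀ x, B x = -Q (Q (gradient F x)))
    {ψ : ℝ → H} (hψ : MemLp ψ 2 (volume.restrict (Ioc 0 T))) {φ : ℝ → H}
    (hφ : ContinuousOn φ (Icc 0 T)) (hφ0 : φ 0 = 0) :
    IsHeatSkeleton e α Q B 0 T ψ φ ↔ ∀ t ∈ Icc 0 T,
      φ t = Q (conv e (heatSym α) (netForcing Q F ψ φ) t) := by
  refine forall₂_congr fun t ht => ?_
  obtain ⟨h1, h2, h3⟩ := h.conv_split (isKernel_heatSym hα) hB hφ hψ ht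
  have h4 : heatSemigroup e α (t - 0) (0 : H) = 0 := by
    rw [sub_zero, heatSemigroup_eq hα e ht.1, _root_.map_zero]
  rw [hφ0, h4, zero_add, integral_heatSemigroup hα ht.1, integral_heatSemigroup hα ht.1, h3]

lemma repr_conv_heat (hα : ∀ k, 0 < α k) {f : ℝ → H} {t : ℝ} (ht : 0 ≤ t)
    (hf : IntervalIntegrable f volume 0 t) (k : ℕ) :
    e.repr (conv e (heatSym α) f t) k = heatMode (α k) 0 (fun s => e.repr (f s) k) t := by
  have hfk : IntervalIntegrable (fun s => e.repr (f s) k) volume 0 t :=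
    hf.repr e k
  rw [(isKernel_heatSym hα).repr_conv e ht hf, heatMode_eq _ _ hfk]
  simp [heatSym]

lemma repr_conv_wavePos (hα : 0 < α 0) (hmono : Monotone α) (hμ : 0 < μ) {f : ℝ → H} {t : ℝ}
    (ht : 0 ≤ t) (hf : IntervalIntegrable f volume 0 t) (k : ℕ) :
    e.repr (conv e (wavePosSym α μ) f t) k
      = waveMode μ (α k) 0 0 (fun s => e.repr (f s) k) t := by
  have hfk : IntervalIntegrable (fun s => e.repr (f s) k) volume 0 t :=
    hf.repr e k
  rw [(isKernel_wavePosSym hα hmono hμ).repr_conv e ht hf, waveMode_eq _ _ _ _ hfk]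
  simp [wavePosSym, Matrix.mulVec, dotProduct]

lemma repr_conv_waveVel (hα : ∀ k, 0 < α k) (hμ : 0 < μ) {f : ℝ → H} {t : ℝ}
    (ht : 0 ≤ t) (hf : IntervalIntegrable f volume 0 t) (k : ℕ) :
    e.repr (conv e (waveVelSym α μ) f t) k
      = waveVel μ (α k) 0 0 (fun s => e.repr (f s) k) t := by
  have hfk : IntervalIntegrable (fun s => e.repr (f s) k) volume 0 t :=
    hf.repr e k
  rw [(isKernel_waveVelSym hα hμ).repr_conv e ht hf, waveVel_eq _ _ _ _ hfk]
  simp [waveVelSym, Matrix.mulVec, dotProduct]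

/-- Every control of the wave equation costs at least the energy of the endpoint. -/
lemma IsPotential.wave_lower (h : IsPotential e Q lam F κ) (hα : 0 < α 0)
    (hmono : Monotone α) (hμ : 0 < μ) {B : H → H} (hB : ∀ x, B x = -Q (Q (gradient F x)))
    (hT : 0 ≤ T) {ψ : ℝ → H} (hψ : MemLp ψ 2 (volume.restrict (Ioc 0 T))) {z : ℝ → Phase H α}
    (hz : ContinuousOn z (Icc 0 T)) (hz0 : z 0 = 0) (hs : IsWaveSkeleton e α Q B μ 0 T ψ z) :
    ∃ η ζ : H, Q η = (z T).1 ∧ toHNeg e α (Q ζ) = (z T).2 ∧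
      Summable (fun k => α k * e.repr η k ^ 2) ∧
      ∑' k, α k * e.repr η k ^ 2 + 2 * F (Q η) + μ * ‖ζ‖ ^ 2
        ≤ (∫ s in Ioc 0 T, ‖ψ s‖ ^ 2) / 2 := by
  have hα' : ∀ k, 0 < α k := fun k => hα.trans_le (hmono (Nat.zero_le k))
  have hφ : ContinuousOn (fun s => (z s).1) (Icc 0 T) := continuous_fst.comp_continuousOn hz
  rw [h.isWaveSkeleton_iff hα hmono hμ hB hψ hz hz0] at hs
  set f := netForcing Q F ψ fun s => (z s).1 with hfdef
  have hf : MemLp f 2 (volume.restrict (Ioc 0 T)) := h.memLp_netForcing hφ hψ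
  set η := conv e (wavePosSym α μ) f with hη
  set ζ := conv e (waveVelSym α μ) f T with hζ
  have hTT : T ∈ Icc 0 T := ⟨hT, le_rfl⟩
  have hηk : ∀ k, ∀ t ∈ Icc 0 T,
      e.repr (η t) k = waveMode μ (α k) 0 0 (fun s => e.repr (f s) k) t := fun k t ht =>
    repr_conv_wavePos hα hmono hμ ht.1 (hf.intervalIntegrable_two ht) k
  have hζk : ∀ k, e.repr ζ k = waveVel μ (α k) 0 0 (fun s => e.repr (f s) k) T := fun k =>
    repr_conv_waveVel hα' hμ hT (hf.intervalIntegrable_two hTT) k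
  have hmode := fun k => wave_mode_spec hT hμ (α k) 0 0 (hf.repr e k)
  have hfη : ∀ s ∈ Icc 0 T, ψ s - pullGrad Q F (η s) = f s := by
    intro s hs'
    simp only [hfdef, netForcing, pullGrad, hs s hs']
  have hres : ∀ᵐ s ∂volume.restrict (Ioc 0 T), ψ s - pullGrad Q F (η s) = f s :=
    (ae_restrict_iff' measurableSet_Ioc).2
      (Eventually.of_forall fun s hs' => hfη s (Ioc_subset_Icc_self hs'))
  obtain ⟨hsum, hle⟩ := h.action_ge hT (η := η)
    (p := fun k => waveVel μ (α k) 0 0 (fun s => e.repr (f s) k))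
    (E₁ := fun k => α k * e.repr (η T) k ^ 2 + μ * e.repr ζ k ^ 2) hψ
    (hf.ae_eq (hres.mono fun s hs' => hs'.symm)) (fun k => (hmode k).1) (by simp [hη, conv])
    (fun k t ht => by rw [hηk k t ht, (hmode k).2.1 t ht, zero_add])
    (fun k => by have := hα' k; positivity)
    (fun k => by
      rw [hηk k T hTT, hζk]
      have h1 := (hmode k).2.2
      have h2 : ∫ s in Ioc 0 T, e.repr (ψ s - pullGrad Q F (η s)) k
            * waveVel μ (α k) 0 0 (fun s => e.repr (f s) k) s
          = ∫ s in Ioc 0 T, e.repr (f s) k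
            * waveVel μ (α k) 0 0 (fun s => e.repr (f s) k) s :=
        integral_congr_ae (hres.mono fun s hs' => by simp only [hs'])
      exact h2.trans (h1.trans (by ring)))
  -- the final energy of the velocity is `μ ‖ζ‖²`, which splits off the sum over the modes
  have hζs := (e.hasSum_repr_sq ζ).mul_left μ
  have hηs : Summable fun k => α k * e.repr (η T) k ^ 2 := by
    simpa using hsum.sub hζs.summable
  rw [hηs.tsum_add hζs.summable, hζs.tsum_eq] at hle
  refine ⟨η T, ζ, ?_, ?_, hηs, by linarith⟩
  · rw [hs T hTT]
  · rw [hs T hTT]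

/-- Every control of the heat equation costs at least the energy of the endpoint. -/
lemma IsPotential.heat_lower (h : IsPotential e Q lam F κ) (hα : ∀ k, 0 < α k)
    {B : H → H} (hB : ∀ x, B x = -Q (Q (gradient F x)))
    (hT : 0 ≤ T) {ψ : ℝ → H} (hψ : MemLp ψ 2 (volume.restrict (Ioc 0 T))) {φ : ℝ → H}
    (hφ : ContinuousOn φ (Icc 0 T)) (hφ0 : φ 0 = 0) (hs : IsHeatSkeleton e α Q B 0 T ψ φ) :
    ∃ η : H, Q η = φ T ∧ Summable (fun k => α k * e.repr η k ^ 2) ∧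
      ∑' k, α k * e.repr η k ^ 2 + 2 * F (Q η) ≤ (∫ s in Ioc 0 T, ‖ψ s‖ ^ 2) / 2 := by
  rw [h.isHeatSkeleton_iff hα hB hψ hφ hφ0] at hs
  set f := netForcing Q F ψ φ with hfdef
  have hf : MemLp f 2 (volume.restrict (Ioc 0 T)) := h.memLp_netForcing hφ hψ
  set η := conv e (heatSym α) f with hη
  have hTT : T ∈ Icc 0 T := ⟨hT, le_rfl⟩
  have hηk : ∀ k, ∀ t ∈ Icc 0 T,
      e.repr (η t) k = heatMode (α k) 0 (fun s => e.repr (f s) k) t := fun k t ht =>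
    repr_conv_heat hα ht.1 (hf.intervalIntegrable_two ht) k
  have hmode := fun k => heat_mode_spec hT (α k) 0 (hf.repr e k)
  have hfη : ∀ s ∈ Icc 0 T, ψ s - pullGrad Q F (η s) = f s := by
    intro s hs'
    simp only [hfdef, netForcing, pullGrad, hs s hs']
  have hres : ∀ᵐ s ∂volume.restrict (Ioc 0 T), ψ s - pullGrad Q F (η s) = f s :=
    (ae_restrict_iff' measurableSet_Ioc).2
      (Eventually.of_forall fun s hs' => hfη s (Ioc_subset_Icc_self hs'))
  obtain ⟨hsum, hle⟩ := h.action_ge hT (η := η)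
    (p := fun k => heatVel (α k) 0 (fun s => e.repr (f s) k))
    (E₁ := fun k => α k * e.repr (η T) k ^ 2) hψ
    (hf.ae_eq (hres.mono fun s hs' => hs'.symm)) (fun k => (hmode k).1) (by simp [hη, conv])
    (fun k t ht => by rw [hηk k t ht, (hmode k).2.1 t ht, zero_add])
    (fun k => by have := hα k; positivity)
    (fun k => by
      rw [hηk k T hTT]
      have h1 := (hmode k).2.2
      have h2 : ∫ s in Ioc 0 T, e.repr (ψ s - pullGrad Q F (η s)) k
            * heatVel (α k) 0 (fun s => e.repr (f s) k) s
          = ∫ s in Ioc 0 T, e.repr (f s) k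
            * heatVel (α k) 0 (fun s => e.repr (f s) k) s :=
        integral_congr_ae (hres.mono fun s hs' => by simp only [hs'])
      exact h2.trans (h1.trans (by ring)))
  exact ⟨η T, (hs T hTT).symm, hsum, by linarith⟩

end LowerBound

/-! ### The uncontrolled flow -/

section Flow

variable {H : Type*} [NormedAddCommGroup H] [InnerProductSpace ℝ H] [CompleteSpace H]
  {e : HilbertBasis ℕ ℝ H} {κs : ℕ → ℝ → ℝ} {C : ℝ}

omit [CompleteSpace H] in
/-- Convolution with a bounded kernel gains a factor `1 / l` in the norm weighted by
`exp (-l t)`. -/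
lemma IsKernel.norm_conv_sub_le (hK : IsKernel κs C) {g g' : ℝ → H} (hg : Continuous g)
    (hg' : Continuous g') {D l t : ℝ} (hl : 0 < l) (hD : 0 ≤ D) (ht : 0 ≤ t)
    (h : ∀ s, 0 ≤ s → ‖g s - g' s‖ ≤ D * Real.exp (l * s)) :
    ‖conv e κs g t - conv e κs g' t‖ ≤ C * D / l * Real.exp (l * t) := by
  have h1 : conv e κs g t - conv e κs g' t
      = ∫ s in (0 : ℝ)..t, diagKernel e κs (t - s) (g s - g' s) := by
    simp only [map_sub]
    exact (intervalIntegral.integral_sub (hK.intervalIntegrable e (hg.intervalIntegrable _ _) t)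
      (hK.intervalIntegrable e (hg'.intervalIntegrable _ _) t)).symm
  have hci : Continuous fun s => C * D * Real.exp (l * s) := by fun_prop
  have h2 : ∫ s in (0 : ℝ)..t, C * D * Real.exp (l * s)
      = C * D / l * Real.exp (l * t) - C * D / l * Real.exp (l * 0) := by
    refine intervalIntegral.integral_eq_sub_of_hasDerivAt
      (f := fun s => C * D / l * Real.exp (l * s)) (fun s _ => ?_) (hci.intervalIntegrable _ _)
    refine ((((hasDerivAt_id s).const_mul l).exp).const_mul (C * D / l)).congr_deriv ?_
    simp only [id]
    field_simp
  have hC := hK.nonneg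
  rw [h1]
  calc _ ≤ ∫ s in (0 : ℝ)..t, C * D * Real.exp (l * s) := by
        refine intervalIntegral.norm_integral_le_of_norm_le ht
          (Eventually.of_forall fun s hs => ?_) (hci.intervalIntegrable _ _)
        refine (hK.norm_apply_le e _ _).trans ?_
        rw [mul_assoc]
        exact mul_le_mul_of_nonneg_left (h s hs.1.le) hC
    _ ≤ _ := by
        rw [h2]
        have : 0 ≤ C * D / l * Real.exp (l * 0) := by positivity
        linarith

/-- Global existence for the integral equation `u = r - K * N(u)` with Lipschitz `N`: in the norm
weighted by `exp (-l t)`, for large `l`, the right-hand side is a contraction. -/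
lemma IsKernel.exists_mild (hK : IsKernel κs C) {N : H → H} {L : ℝ} (hL : 0 ≤ L)
    (hN : ∀ x y, ‖N x - N y‖ ≤ L * ‖x - y‖) (hN0 : N 0 = 0) (hNc : Continuous N)
    {r : ℝ → H} (hr : Continuous r) {R : ℝ} (hR : ∀ t, ‖r t‖ ≤ R) :
    ∃ u : ℝ → H, Continuous u ∧ ∀ t, 0 ≤ t → u t = r t - conv e κs (fun s => N (u s)) t := by
  have hC := hK.nonneg
  set l : ℝ := 2 * C * L + 1 with hl
  have hl0 : 0 < l := by positivity
  -- the unknown is `w t = exp (-l t) u t`; negative times, where nothing is claimed, are sent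
  -- to `0`
  have hlift : ∀ w : BoundedContinuousFunction ℝ H,
      Continuous fun s => Real.exp (l * max s 0) • w s := fun w =>
    (by fun_prop : Continuous fun s : ℝ => Real.exp (l * max s 0)).smul w.continuous
  have hbase : ∀ w w' : BoundedContinuousFunction ℝ H, ∀ s, 0 ≤ s →
      ‖N (Real.exp (l * max s 0) • w s) - N (Real.exp (l * max s 0) • w' s)‖
        ≤ L * dist w w' * Real.exp (l * s) := by
    intro w w' s hs
    refine (hN _ _).trans ?_
    rw [← smul_sub, norm_smul, max_eq_left hs, Real.norm_eq_abs, Real.abs_exp, ← dist_eq_norm]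
    have := w.dist_coe_le_dist (g := w') s
    calc L * (Real.exp (l * s) * dist (w s) (w' s))
        ≤ L * (Real.exp (l * s) * dist w w') := by gcongr
      _ = _ := by ring
  have hest : ∀ w w' : BoundedContinuousFunction ℝ H, ∀ t,
      Real.exp (-(l * max t 0)) *
        ‖conv e κs (fun s => N (Real.exp (l * max s 0) • w s)) (max t 0)
          - conv e κs (fun s => N (Real.exp (l * max s 0) • w' s)) (max t 0)‖
        ≤ 1 / 2 * dist w w' := by
    intro w w' t
    have h1 := hK.norm_conv_sub_le (e := e) (hNc.comp (hlift w)) (hNc.comp (hlift w')) hl0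
      (by positivity) (le_max_right t 0) (hbase w w')
    calc _ ≤ Real.exp (-(l * max t 0)) * (C * (L * dist w w') / l * Real.exp (l * max t 0)) := by
          gcongr
          exact h1
      _ = C * L / l * dist w w' := by
          rw [Real.exp_neg]
          field_simp
      _ ≤ 1 / 2 * dist w w' := by
          refine mul_le_mul_of_nonneg_right ?_ dist_nonneg
          rw [div_le_iff₀ hl0, hl]
          linarith
  have hbound : ∀ w : BoundedContinuousFunction ℝ H, ∀ t,
      ‖Real.exp (-(l * max t 0)) • (r (max t 0)
        - conv e κs (fun s => N (Real.exp (l * max s 0) • w s)) (max t 0))‖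
        ≤ R + 1 / 2 * dist w 0 := by
    intro w t
    have h1 := hest w 0 t
    have h2 : conv e κs (fun s => N (Real.exp (l * max s 0)
        • (0 : BoundedContinuousFunction ℝ H) s)) (max t 0) = 0 := by
      simp [conv, hN0]
    rw [h2, sub_zero] at h1
    rw [norm_smul, Real.norm_eq_abs, Real.abs_exp]
    have h3 : Real.exp (-(l * max t 0)) ≤ 1 := by
      rw [Real.exp_le_one_iff]
      have := le_max_right t 0
      nlinarith
    have h4 := hR (max t 0)
    calc _ ≤ Real.exp (-(l * max t 0)) * (‖r (max t 0)‖
          + ‖conv e κs (fun s => N (Real.exp (l * max s 0) • w s)) (max t 0)‖) := by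
          gcongr; exact norm_sub_le _ _
      _ ≤ _ := by
          rw [mul_add]
          refine add_le_add ?_ h1
          calc _ ≤ 1 * R := mul_le_mul h3 h4 (norm_nonneg _) zero_le_one
            _ = R := one_mul R
  let Φ : BoundedContinuousFunction ℝ H → BoundedContinuousFunction ℝ H := fun w =>
    BoundedContinuousFunction.ofNormedAddCommGroup
      (fun t => Real.exp (-(l * max t 0)) • (r (max t 0)
        - conv e κs (fun s => N (Real.exp (l * max s 0) • w s)) (max t 0)))
      ((by fun_prop : Continuous fun t : ℝ => Real.exp (-(l * max t 0))).smul
        ((hr.sub (hK.continuous_conv e (hNc.comp (hlift w)))).comp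
          (continuous_id.max continuous_const)))
      (R + 1 / 2 * dist w 0) (hbound w)
  have hΦ : ContractingWith (1 / 2) Φ := by
    refine ⟨by norm_num, LipschitzWith.of_dist_le_mul fun w w' => ?_⟩
    refine (BoundedContinuousFunction.dist_le (by positivity)).2 fun t => ?_
    have h1 := hest w w' t
    simp only [Φ, BoundedContinuousFunction.coe_ofNormedAddCommGroup]
    rw [dist_eq_norm, ← smul_sub, sub_sub_sub_cancel_left, norm_smul, norm_sub_rev,
      Real.norm_eq_abs, Real.abs_exp]
    simpa using h1
  obtain ⟨w, hw⟩ : ∃ w, Φ w = w := ⟨_, hΦ.fixedPoint_isFixedPt⟩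
  refine ⟨fun s => Real.exp (l * max s 0) • w s, hlift w, fun t ht => ?_⟩
  have h1 : w t = Real.exp (-(l * max t 0)) • (r (max t 0)
      - conv e κs (fun s => N (Real.exp (l * max s 0) • w s)) (max t 0)) := by
    conv_lhs => rw [← hw]
    rfl
  simp only
  rw [h1, smul_smul, ← Real.exp_add, add_neg_cancel, Real.exp_zero, one_smul, max_eq_left ht]

omit [CompleteSpace H] in
/-- A bounded continuous curve in `H` from continuous dominated coefficients. -/
lemma exists_curve (e : HilbertBasis ℕ ℝ H) {c : ℕ → ℝ → ℝ} (hc : ∀ k, Continuous (c k))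
    {b : ℕ → ℝ} (hb : Summable b) (hcb : ∀ k t, 0 ≤ t → c k t ^ 2 ≤ b k) :
    ∃ r : ℝ → H, Continuous r ∧ (∃ R, ∀ t, ‖r t‖ ≤ R) ∧
      ∀ t, 0 ≤ t → ∀ k, e.repr (r t) k = c k t := by
  have hb0 : ∀ k, 0 ≤ b k := fun k => (sq_nonneg _).trans (hcb k 0 le_rfl)
  have hs : ∀ t, 0 ≤ t → Summable fun k => c k t ^ 2 := fun t ht =>
    Summable.of_nonneg_of_le (fun k => sq_nonneg _) (fun k => hcb k t ht) hb
  have hrep : ∀ t k, e.repr (modeSum e c (max t 0)) k = c k (max t 0) := fun t k =>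
    repr_modeSum e (hs _ (le_max_right _ _)) k
  refine ⟨fun t => modeSum e c (max t 0), ?_, ⟨Real.sqrt (∑' k, b k), fun t => ?_⟩,
    fun t ht k => ?_⟩
  · rw [← continuousOn_univ]
    refine continuousOn_of_repr e (b := fun k => Real.sqrt (b k)) ?_ (fun k => ?_) fun k t _ => ?_
    · simpa only [Real.sq_sqrt (hb0 _)] using hb
    · simp only [hrep]
      exact ((hc k).comp (continuous_id.max continuous_const)).continuousOn
    · rw [hrep]
      exact Real.abs_le_sqrt (hcb k _ (le_max_right _ _))
  · refine Real.le_sqrt_of_sq_le ?_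
    refine hasSum_le (fun k => ?_) (e.hasSum_repr_sq _) hb.hasSum
    rw [hrep]
    exact hcb k _ (le_max_right _ _)
  · have h1 := hrep t k
    simpa only [max_eq_left ht] using h1

variable {Q : H →L[ℝ] H} {lam : ℕ → ℝ} {F : H → ℝ} {κ : ℝ} {α : ℕ → ℝ} {μ : ℝ}

/-- The coefficients of the force `-Q DF(Q u)` along a curve `u`. -/
def forceCoeff (e : HilbertBasis ℕ ℝ H) (Q : H →L[ℝ] H) (F : H → ℝ) (u : ℝ → H) (k : ℕ)
    (s : ℝ) : ℝ := e.repr (-pullGrad Q F (u s)) k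

lemma IsPotential.continuous_forceCoeff (h : IsPotential e Q lam F κ) {u : ℝ → H}
    (hu : Continuous u) (k : ℕ) : Continuous (forceCoeff e Q F u k) := by
  have h1 := (coeffCLM e k).continuous.comp (h.continuous_pullGrad.comp hu).neg
  change Continuous fun s => forceCoeff e Q F u k s
  simpa [forceCoeff, Function.comp_def] using h1

/-- Global solutions of `u' = A u - Q DF(Q u)`, described mode by mode. -/
lemma IsPotential.exists_heat_flow (h : IsPotential e Q lam F κ) (hα : ∀ k, 0 < α k) (ξ : H) :
    ∃ u : ℝ → H, Continuous u ∧ ∀ t, 0 ≤ t → ∀ k,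
      e.repr (u t) k = heatMode (α k) (e.repr ξ k) (forceCoeff e Q F u k) t := by
  have hK := isKernel_heatSym hα
  obtain ⟨r, hr, ⟨R, hR⟩, hrk⟩ := exists_curve e (c := fun k t => heatSym α k t * e.repr ξ k)
    (fun k => (hK.continuous k).mul continuous_const) (e.hasSum_repr_sq ξ).summable
    (fun k t ht => by
      rw [mul_pow]
      have h1 := hK.bound k t ht
      rw [← sq_le_sq₀ (abs_nonneg _) zero_le_one, sq_abs, one_pow] at h1
      nlinarith [sq_nonneg (e.repr ξ k)])
  obtain ⟨u, hu, huk⟩ := hK.exists_mild (e := e) (by positivity) h.pullGrad_lipschitz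
    h.pullGrad_zero h.continuous_pullGrad hr hR
  refine ⟨u, hu, fun t ht k => ?_⟩
  have hc : Continuous fun s => pullGrad Q F (u s) := h.continuous_pullGrad.comp hu
  have hfk := (h.continuous_forceCoeff hu k).intervalIntegrable (μ := volume) 0 t
  rw [huk t ht, map_sub, lp.coeFn_sub, Pi.sub_apply, hrk t ht, heatMode_eq _ _ hfk,
    hK.repr_conv e ht (hc.intervalIntegrable _ _), sub_eq_add_neg,
    ← intervalIntegral.integral_neg]
  simp [heatSym, forceCoeff]

/-- Global solutions of `μ u'' = A u - u' - Q DF(Q u)` with initial data of finite energy, described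
mode by mode. -/
lemma IsPotential.exists_wave_flow (h : IsPotential e Q lam F κ) (hα : 0 < α 0)
    (hmono : Monotone α) (hμ : 0 < μ) (ξ ζ : H) (hξ : Summable fun k => α k * e.repr ξ k ^ 2) :
    ∃ u w : ℝ → H, Continuous u ∧ Continuous w ∧ ∀ t, 0 ≤ t → ∀ k,
      e.repr (u t) k
        = waveMode μ (α k) (e.repr ξ k) (e.repr ζ k) (forceCoeff e Q F u k) t ∧
      e.repr (w t) k
        = waveVel μ (α k) (e.repr ξ k) (e.repr ζ k) (forceCoeff e Q F u k) t := by
  have hα' : ∀ k, 0 < α k := fun k => hα.trans_le (hmono (Nat.zero_le k))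
  have hK := isKernel_wavePosSym hα hmono hμ
  have hK' := isKernel_waveVelSym hα' hμ
  have hb : Summable fun k => α k * e.repr ξ k ^ 2 + μ * e.repr ζ k ^ 2 :=
    hξ.add ((e.hasSum_repr_sq ζ).summable.mul_left μ)
  have hen : ∀ k t, 0 ≤ t →
      α k * (waveExp μ (α k) t).mulVec ![e.repr ξ k, e.repr ζ k] 0 ^ 2
        + μ * (waveExp μ (α k) t).mulVec ![e.repr ξ k, e.repr ζ k] 1 ^ 2
      ≤ α k * e.repr ξ k ^ 2 + μ * e.repr ζ k ^ 2 := fun k t ht =>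
    waveExp_energy_le hμ ![e.repr ξ k, e.repr ζ k] ht
  obtain ⟨r, hr, ⟨R, hR⟩, hrk⟩ := exists_curve e
    (c := fun k t => (waveExp μ (α k) t).mulVec ![e.repr ξ k, e.repr ζ k] 0)
    (fun k => (isExpOf_waveExp μ (α k)).continuous_mulVec _ _) (hb.mul_left (α 0)⁻¹)
    (fun k t ht => by
      rw [le_inv_mul_iff₀ hα]
      refine le_trans ?_ (hen k t ht)
      have h1 : α 0 * (waveExp μ (α k) t).mulVec ![e.repr ξ k, e.repr ζ k] 0 ^ 2
          ≤ α k * (waveExp μ (α k) t).mulVec ![e.repr ξ k, e.repr ζ k] 0 ^ 2 := by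
        gcongr; exact hmono (Nat.zero_le k)
      have h2 : 0 ≤ μ * (waveExp μ (α k) t).mulVec ![e.repr ξ k, e.repr ζ k] 1 ^ 2 := by
        positivity
      linarith)
  obtain ⟨r', hr', -, hrk'⟩ := exists_curve e
    (c := fun k t => (waveExp μ (α k) t).mulVec ![e.repr ξ k, e.repr ζ k] 1)
    (fun k => (isExpOf_waveExp μ (α k)).continuous_mulVec _ _) (hb.mul_left μ⁻¹)
    (fun k t ht => by
      rw [le_inv_mul_iff₀ hμ]
      refine le_trans ?_ (hen k t ht)
      have := hα' k
      have h2 : 0 ≤ α k * (waveExp μ (α k) t).mulVec ![e.repr ξ k, e.repr ζ k] 0 ^ 2 := by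
        positivity
      linarith)
  obtain ⟨u, hu, huk⟩ := hK.exists_mild (e := e) (by positivity) h.pullGrad_lipschitz
    h.pullGrad_zero h.continuous_pullGrad hr hR
  have hc : Continuous fun s => pullGrad Q F (u s) := h.continuous_pullGrad.comp hu
  refine ⟨u, fun t => r' t - conv e (waveVelSym α μ) (fun s => pullGrad Q F (u s)) t, hu,
    hr'.sub (hK'.continuous_conv e hc), fun t ht k => ?_⟩
  have hfk := (h.continuous_forceCoeff hu k).intervalIntegrable (μ := volume) 0 t
  constructor
  · rw [huk t ht, map_sub, lp.coeFn_sub, Pi.sub_apply, hrk t ht, waveMode_eq _ _ _ _ hfk,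
      hK.repr_conv e ht (hc.intervalIntegrable _ _), sub_eq_add_neg,
      ← intervalIntegral.integral_neg]
    simp [wavePosSym, forceCoeff]
  · rw [map_sub, lp.coeFn_sub, Pi.sub_apply, hrk' t ht, waveVel_eq _ _ _ _ hfk,
      hK'.repr_conv e ht (hc.intervalIntegrable _ _), sub_eq_add_neg,
      ← intervalIntegral.integral_neg]
    simp [waveVelSym, forceCoeff]

end Flow

/-! ### Dissipation along the uncontrolled flow -/

section Relaxation

variable {H : Type*} [NormedAddCommGroup H] [InnerProductSpace ℝ H]

/-- A curve `u` on `[0, ∞)` with velocity `w`, whose Fourier coefficients are `U k` and `W k`, such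
that `u` is square-integrable on `[0, ∞)` and `2 ∫ |w|² ≤ M`. -/
structure IsRelaxation (e : HilbertBasis ℕ ℝ H) (u w : ℝ → H) (U W : ℕ → ℝ → ℝ) (M : ℝ) :
    Prop where
  continuous : Continuous u
  memLp : ∀ T, 0 ≤ T → MemLp w 2 (volume.restrict (Ioc 0 T))
  repr_pos : ∀ t, 0 ≤ t → ∀ k, e.repr (u t) k = U k t
  repr_vel : ∀ T, 0 ≤ T → ∀ᵐ t ∂volume.restrict (Ioc 0 T), ∀ k, e.repr (w t) k = W k t
  action_le : ∀ T, 0 ≤ T → 2 * ∫ t in Ioc 0 T, ‖w t‖ ^ 2 ≤ M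
  bound : ∃ C, ∀ T, 0 ≤ T → ∫ t in Ioc 0 T, ‖u t‖ ^ 2 ≤ C

lemma Continuous.memLp_two_Ioc {E : Type*} [NormedAddCommGroup E] {f : ℝ → E}
    (hf : Continuous f) (T : ℝ) :
    MemLp f 2 (volume.restrict (Ioc 0 T)) :=
  memLp_two_of_continuousOn hf.continuousOn

variable [CompleteSpace H]
  {e : HilbertBasis ℕ ℝ H} {Q : H →L[ℝ] H} {lam : ℕ → ℝ} {F : H → ℝ} {κ : ℝ} {α : ℕ → ℝ} {μ : ℝ}

/-- The energy balance along the uncontrolled flow. -/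
lemma IsPotential.energy_balance (h : IsPotential e Q lam F κ) {u : ℝ → H} (hu : Continuous u)
    {T : ℝ} (hT : 0 ≤ T) {p : ℕ → ℝ → ℝ} {E₀ E₁ : ℕ → ℝ}
    (hp : ∀ k, MemLp (p k) 2 (volume.restrict (Ioc 0 T)))
    (hup : ∀ k, ∀ t ∈ Icc 0 T, e.repr (u t) k = e.repr (u 0) k + ∫ s in (0 : ℝ)..t, p k s)
    (hE₀ : Summable E₀) (hE₁ : ∀ k, 0 ≤ E₁ k)
    (hen : ∀ k, ∫ s in Ioc 0 T, forceCoeff e Q F u k s * p k s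
      = E₁ k / 2 - E₀ k / 2 + ∫ s in Ioc 0 T, p k s ^ 2) :
    MemLp (modeSum e p) 2 (volume.restrict (Ioc 0 T)) ∧
    (∀ᵐ t ∂volume.restrict (Ioc 0 T), ∀ k, e.repr (modeSum e p t) k = p k t) ∧
    Summable E₁ ∧
    2 * (∫ s in Ioc 0 T, ‖modeSum e p s‖ ^ 2) + ∑' k, E₁ k + 2 * F (Q (u T))
      = ∑' k, E₀ k + 2 * F (Q (u 0)) := by
  have hf : MemLp (fun s => -pullGrad Q F (u s)) 2 (volume.restrict (Ioc 0 T)) :=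
    (h.continuous_pullGrad.comp hu).neg.memLp_two_Ioc T
  obtain ⟨hP, hPp, hE, hid⟩ := energy_sum e hf hp hE₀ hE₁ hen
  refine ⟨hP, hPp, hE, ?_⟩
  have h1 := h.integral_inner_pullGrad hT hP hPp hup
  simp only [inner_neg_left, integral_neg] at hid
  linarith

/-- Summation over the modes of a bound for `∫ Uₖ²`; monotonicity of `DF` makes the nonlinear term
favourable. -/
lemma IsPotential.integral_sq_le (h : IsPotential e Q lam F κ) {u : ℝ → H} (hu : Continuous u)
    {T a S : ℝ} {A : ℕ → ℝ} (hA : HasSum A S)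
    (hle : ∀ k, 2 * a * ∫ s in Ioc 0 T, e.repr (u s) k ^ 2
      ≤ A k + 2 * ∫ s in Ioc 0 T, forceCoeff e Q F u k s * e.repr (u s) k) :
    2 * a * ∫ s in Ioc 0 T, ‖u s‖ ^ 2 ≤ S := by
  have hf : MemLp (fun s => -pullGrad Q F (u s)) 2 (volume.restrict (Ioc 0 T)) :=
    (h.continuous_pullGrad.comp hu).neg.memLp_two_Ioc T
  have hu2 := hu.memLp_two_Ioc T
  have h1 := hasSum_integral_repr_mul_repr hf hu2 e
  have h2 := hasSum_integral_repr_mul_repr hu2 hu2 e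
  simp only [← sq, real_inner_self_eq_norm_sq] at h2
  have h3 := hasSum_le hle (h2.mul_left (2 * a)) (hA.add (h1.mul_left 2))
  have h4 : ∫ s in Ioc 0 T, inner ℝ (-pullGrad Q F (u s)) (u s) ≤ 0 := by
    refine integral_nonpos fun s => ?_
    simp only [inner_neg_left, Pi.zero_apply]
    linarith [h.inner_pullGrad_self_nonneg (u s)]
  linarith

/-- The solution of `u' = A u - Q DF(Q u)` from `ξ` dissipates at most its initial energy, and is
square-integrable because `|u|²` decreases at rate at least `2 α₀ |u|²`. -/
lemma IsPotential.heat_relaxation (h : IsPotential e Q lam F κ) (hα : 0 < α 0)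
    (hmono : Monotone α) (ξ : H) (hξ : Summable fun k => α k * e.repr ξ k ^ 2) :
    ∃ u w : ℝ → H, u 0 = ξ ∧ IsRelaxation e u w
      (fun k => heatMode (α k) (e.repr ξ k) (forceCoeff e Q F u k))
      (fun k => heatVel (α k) (e.repr ξ k) (forceCoeff e Q F u k))
      (∑' k, α k * e.repr ξ k ^ 2 + 2 * F (Q ξ)) := by
  have hα' : ∀ k, 0 < α k := fun k => hα.trans_le (hmono (Nat.zero_le k))
  obtain ⟨u, hu, hrep⟩ := h.exists_heat_flow hα' ξ
  have hfc := fun k => h.continuous_forceCoeff hu k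
  have hmode := fun (T : ℝ) (hT : 0 ≤ T) k =>
    heat_mode_spec hT (α k) (e.repr ξ k) ((hfc k).memLp_two_Ioc T)
  have hu0 : u 0 = ξ := e.repr_inj fun k => by rw [hrep 0 le_rfl, heatMode_zero]
  have hbal := fun (T : ℝ) (hT : 0 ≤ T) => h.energy_balance hu hT
    (p := fun k => heatVel (α k) (e.repr ξ k) (forceCoeff e Q F u k))
    (E₀ := fun k => α k * e.repr ξ k ^ 2) (E₁ := fun k => α k * e.repr (u T) k ^ 2)
    (fun k => (hmode T hT k).1)
    (fun k t ht => by rw [hu0, hrep t ht.1, (hmode T hT k).2.1 t ht]) hξ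
    (fun k => by have := hα' k; positivity)
    (fun k => by rw [hrep T hT]; exact (hmode T hT k).2.2)
  refine ⟨u, _, hu0, hu, fun T hT => (hbal T hT).1, hrep, fun T hT => (hbal T hT).2.1,
    fun T hT => ?_, ⟨‖ξ‖ ^ 2 / (2 * α 0), fun T hT => ?_⟩⟩
  · have h1 := (hbal T hT).2.2.2
    rw [hu0] at h1
    have h2 : 0 ≤ ∑' k, α k * e.repr (u T) k ^ 2 :=
      tsum_nonneg fun k => by have := hα' k; positivity
    linarith [h.nonneg (Q (u T))]
  · rw [le_div_iff₀ (by positivity), mul_comm]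
    refine h.integral_sq_le hu (e.hasSum_repr_sq ξ) fun k => ?_
    set U := heatMode (α k) (e.repr ξ k) (forceCoeff e Q F u k)
    have hd : ∀ t, HasDerivAt U (forceCoeff e Q F u k t - α k * U t) t := fun t =>
      heatMode_hasDerivAt _ _ (hfc k) t
    have hUc : Continuous U := continuous_iff_continuousAt.2 fun t => (hd t).continuousAt
    have hU2 : Continuous fun t => U t ^ 2 := hUc.pow 2
    have hfU : Continuous fun t => forceCoeff e Q F u k t * U t := (hfc k).mul hUc
    have h1 : ∫ t in (0 : ℝ)..T, (2 * (forceCoeff e Q F u k t * U t) - 2 * α k * U t ^ 2)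
        = U T ^ 2 - U 0 ^ 2 := by
      refine intervalIntegral.integral_eq_sub_of_hasDerivAt (f := fun t => U t ^ 2)
        (fun t _ => ?_) (((hfU.const_mul 2).sub (hU2.const_mul _)).intervalIntegrable _ _)
      refine ((hd t).fun_pow 2).congr_deriv ?_
      simp only [Nat.cast_ofNat, Nat.add_one_sub_one, pow_one]
      ring
    rw [intervalIntegral.integral_sub ((hfU.const_mul 2).intervalIntegrable _ _)
      ((hU2.const_mul _).intervalIntegrable _ _), intervalIntegral.integral_const_mul,
      intervalIntegral.integral_const_mul, intervalIntegral.integral_of_le hT,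
      intervalIntegral.integral_of_le hT] at h1
    have h2 : ∫ s in Ioc 0 T, e.repr (u s) k ^ 2 = ∫ s in Ioc 0 T, U s ^ 2 :=
      setIntegral_congr_fun measurableSet_Ioc fun s hs => by simp only [hrep s hs.1.le]; rfl
    have h3 : ∫ s in Ioc 0 T, forceCoeff e Q F u k s * e.repr (u s) k
        = ∫ s in Ioc 0 T, forceCoeff e Q F u k s * U s :=
      setIntegral_congr_fun measurableSet_Ioc fun s hs => by simp only [hrep s hs.1.le]; rfl
    have hU0 : U 0 = e.repr ξ k := heatMode_zero _ _ _
    rw [hU0] at h1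
    rw [h2, h3]
    have h4 : 0 ≤ ∫ s in Ioc 0 T, U s ^ 2 := integral_nonneg fun s => sq_nonneg _
    have h5 := mul_le_mul_of_nonneg_right (hmono (Nat.zero_le k)) h4
    nlinarith [sq_nonneg (U T)]

/-- The solution of `μ u'' = A u - u' - Q DF(Q u)` from `(ξ, ζ)` dissipates at most its initial
energy. Square-integrability of `u`, which the energy does not see, comes from testing the equation
with `u` instead of `u'`. -/
lemma IsPotential.wave_relaxation (h : IsPotential e Q lam F κ) (hα : 0 < α 0)
    (hmono : Monotone α) (hμ : 0 < μ) (ξ ζ : H) (hξ : Summable fun k => α k * e.repr ξ k ^ 2) :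
    ∃ u w : ℝ → H, u 0 = ξ ∧ w 0 = ζ ∧ Continuous w ∧
      (∀ t, 0 ≤ t → ∀ k, e.repr (w t) k
        = waveVel μ (α k) (e.repr ξ k) (e.repr ζ k) (forceCoeff e Q F u k) t) ∧
      IsRelaxation e u w
        (fun k => waveMode μ (α k) (e.repr ξ k) (e.repr ζ k) (forceCoeff e Q F u k))
        (fun k => waveVel μ (α k) (e.repr ξ k) (e.repr ζ k) (forceCoeff e Q F u k))
        (∑' k, α k * e.repr ξ k ^ 2 + 2 * F (Q ξ) + μ * ‖ζ‖ ^ 2) := by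
  have hα' : ∀ k, 0 < α k := fun k => hα.trans_le (hmono (Nat.zero_le k))
  obtain ⟨u, w, hu, hw, hrep⟩ := h.exists_wave_flow hα hmono hμ ξ ζ hξ
  have hfc := fun k => h.continuous_forceCoeff hu k
  have hmode := fun (T : ℝ) (hT : 0 ≤ T) k =>
    wave_mode_spec hT hμ (α k) (e.repr ξ k) (e.repr ζ k) ((hfc k).memLp_two_Ioc T)
  have hu0 : u 0 = ξ := e.repr_inj fun k => by rw [(hrep 0 le_rfl k).1, waveMode_zero]
  have hw0 : w 0 = ζ := e.repr_inj fun k => by rw [(hrep 0 le_rfl k).2, waveVel_zero]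
  have hζ := (e.hasSum_repr_sq ζ).mul_left μ
  have hE0 : ∑' k, (α k * e.repr ξ k ^ 2 + μ * e.repr ζ k ^ 2)
      = ∑' k, α k * e.repr ξ k ^ 2 + μ * ‖ζ‖ ^ 2 := by
    rw [hξ.tsum_add hζ.summable, hζ.tsum_eq]
  have hbal := fun (T : ℝ) (hT : 0 ≤ T) => h.energy_balance hu hT
    (p := fun k => waveVel μ (α k) (e.repr ξ k) (e.repr ζ k) (forceCoeff e Q F u k))
    (E₀ := fun k => α k * e.repr ξ k ^ 2 + μ * e.repr ζ k ^ 2)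
    (E₁ := fun k => α k * e.repr (u T) k ^ 2 + μ * e.repr (w T) k ^ 2)
    (fun k => (hmode T hT k).1)
    (fun k t ht => by rw [hu0, (hrep t ht.1 k).1, (hmode T hT k).2.1 t ht]) (hξ.add hζ.summable)
    (fun k => by have := hα' k; positivity)
    (fun k => by rw [(hrep T hT k).1, (hrep T hT k).2]; exact (hmode T hT k).2.2)
  have hweq : ∀ t, 0 ≤ t → modeSum e
      (fun k => waveVel μ (α k) (e.repr ξ k) (e.repr ζ k) (forceCoeff e Q F u k)) t = w t := by
    intro t ht
    rw [← e.tsum_repr_smul (w t)]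
    exact tsum_congr fun k => by rw [(hrep t ht k).2]
  set M := ∑' k, α k * e.repr ξ k ^ 2 + 2 * F (Q ξ) + μ * ‖ζ‖ ^ 2 with hM
  have hmain : ∀ T, 0 ≤ T → 2 * (∫ t in Ioc 0 T, ‖w t‖ ^ 2) + μ * ‖w T‖ ^ 2 ≤ M := by
    intro T hT
    have h1 := (hbal T hT).2.2.2
    rw [hu0, hE0] at h1
    have h2 : ∫ s in Ioc 0 T, ‖modeSum e (fun k => waveVel μ (α k) (e.repr ξ k) (e.repr ζ k)
        (forceCoeff e Q F u k)) s‖ ^ 2 = ∫ s in Ioc 0 T, ‖w s‖ ^ 2 :=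
      setIntegral_congr_fun measurableSet_Ioc fun s hs => by simp only [hweq s hs.1.le]
    have h3 : μ * ‖w T‖ ^ 2
        ≤ ∑' k, (α k * e.repr (u T) k ^ 2 + μ * e.repr (w T) k ^ 2) :=
      hasSum_le (fun k => by have := hα' k; simp only [le_add_iff_nonneg_left]; positivity)
        ((e.hasSum_repr_sq (w T)).mul_left μ) (hbal T hT).2.2.1.hasSum
    rw [h2] at h1
    linarith [h.nonneg (Q (u T))]
  refine ⟨u, w, hu0, hw0, hw, fun t ht k => (hrep t ht k).2, hu, fun T _ => hw.memLp_two_Ioc T,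
    fun t ht k => (hrep t ht k).1, fun T _ => (ae_restrict_iff' measurableSet_Ioc).2
      (Eventually.of_forall fun t ht k => (hrep t ht.1.le k).2), fun T hT => ?_,
    ⟨(2 * μ * M + 2 * μ * inner ℝ ξ ζ + ‖ξ‖ ^ 2) / (2 * α 0), fun T hT => ?_⟩⟩
  · have := hmain T hT
    have h2 : 0 ≤ μ * ‖w T‖ ^ 2 := by positivity
    linarith
  · rw [le_div_iff₀ (by positivity), mul_comm]
    have hwsum := hasSum_integral_repr_mul_repr (hw.memLp_two_Ioc T) (hw.memLp_two_Ioc T) e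
    simp only [← sq, real_inner_self_eq_norm_sq] at hwsum
    have hA := (((hwsum.mul_left (2 * μ)).add ((e.hasSum_repr_sq (w T)).mul_left (μ ^ 2))).add
      ((e.hasSum_repr_mul_repr ξ ζ).mul_left (2 * μ))).add (e.hasSum_repr_sq ξ)
    refine (h.integral_sq_le hu hA fun k => ?_).trans ?_
    · set U := waveMode μ (α k) (e.repr ξ k) (e.repr ζ k) (forceCoeff e Q F u k)
      set W := waveVel μ (α k) (e.repr ξ k) (e.repr ζ k) (forceCoeff e Q F u k)
      have hd : ∀ t, HasDerivAt U (W t) t := fun t => waveMode_hasDerivAt _ _ _ _ (hfc k) t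
      have hd' : ∀ t, HasDerivAt W (-(α k / μ) * U t + -(1 / μ) * W t
          + 1 / μ * forceCoeff e Q F u k t) t := fun t => waveVel_hasDerivAt _ _ _ _ (hfc k) t
      have hUc : Continuous U := continuous_iff_continuousAt.2 fun t => (hd t).continuousAt
      have hWc : Continuous W := continuous_iff_continuousAt.2 fun t => (hd' t).continuousAt
      have hU2 : Continuous fun t => U t ^ 2 := hUc.pow 2
      have hW2 : Continuous fun t => W t ^ 2 := hWc.pow 2
      have hfU : Continuous fun t => forceCoeff e Q F u k t * U t := (hfc k).mul hUc
      -- the derivative of `2 μ U W + U²` is the equation multiplied by `2 U`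
      have h1 : ∫ t in (0 : ℝ)..T, (2 * (forceCoeff e Q F u k t * U t) + 2 * μ * W t ^ 2
          - 2 * α k * U t ^ 2)
          = (2 * μ * (U T * W T) + U T ^ 2) - (2 * μ * (U 0 * W 0) + U 0 ^ 2) := by
        refine intervalIntegral.integral_eq_sub_of_hasDerivAt
          (f := fun t => 2 * μ * (U t * W t) + U t ^ 2) (fun t _ => ?_)
          ((((hfU.const_mul 2).add (hW2.const_mul _)).sub (hU2.const_mul _)).intervalIntegrable
            _ _)
        refine ((((hd t).fun_mul (hd' t)).const_mul (2 * μ)).fun_add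
          ((hd t).fun_pow 2)).congr_deriv ?_
        simp only [Nat.cast_ofNat, Nat.add_one_sub_one, pow_one]
        field_simp
        ring
      rw [intervalIntegral.integral_sub
        (f := fun t => 2 * (forceCoeff e Q F u k t * U t) + 2 * μ * W t ^ 2)
        (((hfU.const_mul 2).add (hW2.const_mul _)).intervalIntegrable _ _)
        ((hU2.const_mul _).intervalIntegrable _ _), intervalIntegral.integral_add
        ((hfU.const_mul 2).intervalIntegrable _ _) ((hW2.const_mul _).intervalIntegrable _ _),
        intervalIntegral.integral_const_mul, intervalIntegral.integral_const_mul,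
        intervalIntegral.integral_const_mul, intervalIntegral.integral_of_le hT,
        intervalIntegral.integral_of_le hT, intervalIntegral.integral_of_le hT] at h1
      have h2 : ∫ s in Ioc 0 T, e.repr (u s) k ^ 2 = ∫ s in Ioc 0 T, U s ^ 2 :=
        setIntegral_congr_fun measurableSet_Ioc fun s hs => by
          simp only [(hrep s hs.1.le k).1]; rfl
      have h3 : ∫ s in Ioc 0 T, forceCoeff e Q F u k s * e.repr (u s) k
          = ∫ s in Ioc 0 T, forceCoeff e Q F u k s * U s :=
        setIntegral_congr_fun measurableSet_Ioc fun s hs => by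
          simp only [(hrep s hs.1.le k).1]; rfl
      have h3' : ∫ s in Ioc 0 T, e.repr (w s) k ^ 2 = ∫ s in Ioc 0 T, W s ^ 2 :=
        setIntegral_congr_fun measurableSet_Ioc fun s hs => by
          simp only [(hrep s hs.1.le k).2]; rfl
      have hU0 : U 0 = e.repr ξ k := waveMode_zero _ _ _ _ _
      have hW0 : W 0 = e.repr ζ k := waveVel_zero _ _ _ _ _
      have hWT : e.repr (w T) k = W T := (hrep T hT k).2
      rw [hU0, hW0] at h1
      rw [h2, h3, h3', hWT]
      have h4 : 0 ≤ ∫ s in Ioc 0 T, U s ^ 2 := integral_nonneg fun s => sq_nonneg _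
      have h5 := mul_le_mul_of_nonneg_right (hmono (Nat.zero_le k)) h4
      -- completing the square absorbs `2 μ U W` at time `T`, at the price of `μ² W²`
      nlinarith [sq_nonneg (U T + μ * W T)]
    · have h6 := mul_le_mul_of_nonneg_left (hmain T hT) hμ.le
      have h7 : 0 ≤ μ * ∫ t in Ioc 0 T, ‖w t‖ ^ 2 :=
        mul_nonneg hμ.le (integral_nonneg fun s => sq_nonneg _)
      have h8 : 0 ≤ μ * (μ * ‖w T‖ ^ 2) := by positivity
      nlinarith

end Relaxation

/-! ### The cost of the reversed path -/

section Cost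

/-- A smooth transition from `0` at time `0` to `1` at time `1`. -/
def ramp : ℝ → ℝ := Real.smoothTransition

lemma ramp_contDiff {n : ℕ∞} : ContDiff ℝ n ramp := Real.smoothTransition.contDiff

lemma ramp_hasDerivAt (t : ℝ) : HasDerivAt ramp (deriv ramp t) t :=
  ((ramp_contDiff (n := 1)).differentiable (by norm_num) t).hasDerivAt

lemma contDiff_deriv_ramp : ContDiff ℝ 1 (deriv ramp) :=
  ((contDiff_succ_iff_deriv (n := 1)).1 (ramp_contDiff (n := 2))).2.2

lemma deriv_ramp_hasDerivAt (t : ℝ) : HasDerivAt (deriv ramp) (deriv (deriv ramp) t) t :=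
  (contDiff_deriv_ramp.differentiable (by norm_num) t).hasDerivAt

lemma continuous_deriv_ramp : Continuous (deriv ramp) := contDiff_deriv_ramp.continuous

lemma continuous_deriv_deriv_ramp : Continuous (deriv (deriv ramp)) :=
  contDiff_deriv_ramp.continuous_deriv (by norm_num)

lemma continuous_ramp : Continuous ramp := (ramp_contDiff (n := 0)).continuous

lemma ramp_zero : ramp 0 = 0 := Real.smoothTransition.zero

lemma ramp_of_one_le {t : ℝ} (ht : 1 ≤ t) : ramp t = 1 := Real.smoothTransition.one_of_one_le ht

lemma abs_ramp_le (t : ℝ) : |ramp t| ≤ 1 := by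
  rw [ramp, abs_of_nonneg (Real.smoothTransition.nonneg t)]
  exact Real.smoothTransition.le_one t

lemma deriv_ramp_zero : deriv ramp 0 = 0 := by
  have h1 : IsLocalMin ramp 0 := Eventually.of_forall fun x => by
    rw [ramp_zero]; exact Real.smoothTransition.nonneg x
  exact h1.deriv_eq_zero

lemma deriv_ramp_of_one_le {t : ℝ} (ht : 1 ≤ t) : deriv ramp t = 0 := by
  have h1 : IsLocalMax ramp t := Eventually.of_forall fun x => by
    rw [ramp_of_one_le ht]; exact Real.smoothTransition.le_one x
  exact h1.deriv_eq_zero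

lemma deriv_deriv_ramp_of_one_lt {t : ℝ} (ht : 1 < t) : deriv (deriv ramp) t = 0 := by
  have h1 : deriv ramp =ᶠ[𝓝 t] fun _ => 0 := by
    filter_upwards [lt_mem_nhds ht] with s hs using deriv_ramp_of_one_le hs.le
  rw [h1.deriv_eq, deriv_const]

lemma ae_reflect {p : ℝ → Prop} {T : ℝ} (h : ∀ᵐ t ∂volume.restrict (Ioc 0 T), p t) :
    ∀ᵐ t ∂volume.restrict (Ioc 0 T), p (T - t) := by
  rw [← Measure.restrict_congr_set Ioo_ae_eq_Ioc, ae_restrict_iff' measurableSet_Ioo] at h ⊢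
  have h1 := (Measure.measurePreserving_sub_left volume T).quasiMeasurePreserving.ae h
  filter_upwards [h1] with t ht htT
  exact ht ⟨by linarith [htT.2], by linarith [htT.1]⟩

lemma MeasureTheory.MemLp.reflect {E : Type*} [NormedAddCommGroup E] {f : ℝ → E} {T : ℝ}
    (hf : MemLp f 2 (volume.restrict (Ioc 0 T))) :
    MemLp (fun t => f (T - t)) 2 (volume.restrict (Ioc 0 T)) := by
  rw [← Measure.restrict_congr_set Ioo_ae_eq_Ioc] at hf ⊢
  have h1 := (Measure.measurePreserving_sub_left volume T).restrict_preimage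
    (measurableSet_Ioo (a := (0 : ℝ)) (b := T))
  have h2 : (fun t => T - t) ⁻¹' Ioo 0 T = Ioo 0 T := by
    ext t
    simp only [mem_preimage, mem_Ioo]
    constructor <;> rintro ⟨h, h'⟩ <;> constructor <;> linarith
  rw [h2] at h1
  exact hf.comp_measurePreserving h1

lemma MeasureTheory.MemLp.continuous_smul {E : Type*} [NormedAddCommGroup E] [NormedSpace ℝ E]
    {f : ℝ → E} {T : ℝ} (hf : MemLp f 2 (volume.restrict (Ioc 0 T))) {c : ℝ → ℝ}
    (hc : Continuous c) : MemLp (fun t => c t • f t) 2 (volume.restrict (Ioc 0 T)) := by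
  obtain ⟨C, hC⟩ := (isCompact_Icc (a := (0 : ℝ)) (b := T)).exists_bound_of_continuousOn
    hc.continuousOn
  refine MemLp.of_le_mul (c := C) hf (hc.aestronglyMeasurable.smul hf.1) ?_
  refine (ae_restrict_iff' measurableSet_Ioc).2 (Eventually.of_forall fun t ht => ?_)
  rw [norm_smul]
  exact mul_le_mul_of_nonneg_right (hC t (Ioc_subset_Icc_self ht)) (norm_nonneg _)

variable {H : Type*} [NormedAddCommGroup H] [InnerProductSpace ℝ H]

/-- An integrable density on `[0, ∞)` has small mass on some interval `(n, n + 1]`. -/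
lemma exists_small_window {q : ℝ → ℝ} (hq : ∀ T, 0 ≤ T → IntervalIntegrable q volume 0 T) {C : ℝ}
    (hC : ∀ T, 0 ≤ T → ∫ t in (0 : ℝ)..T, q t ≤ C) {δ : ℝ} (hδ : 0 < δ) :
    ∃ n : ℕ, ∫ t in (n : ℝ)..(n + 1 : ℝ), q t ≤ δ := by
  by_contra! hcon
  have h1 : ∀ n : ℕ, n * δ ≤ ∫ t in (0 : ℝ)..n, q t := by
    intro n
    induction n with
    | zero => simp
    | succ n ih =>
      have h2 := intervalIntegral.integral_add_adjacent_intervals (hq n (by positivity))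
        ((hq n (by positivity)).symm.trans (hq (n + 1) (by positivity)))
      push_cast
      rw [← h2]
      linarith [hcon n]
  obtain ⟨n, hn⟩ := exists_nat_gt (C / δ)
  rw [div_lt_iff₀ hδ] at hn
  linarith [h1 n, hC n (by positivity)]

variable {e : HilbertBasis ℕ ℝ H} {u w : ℝ → H} {U W : ℕ → ℝ → ℝ} {M : ℝ}

lemma IsRelaxation.exists_small_window (hr : IsRelaxation e u w U W M) {δ : ℝ} (hδ : 0 < δ) :
    ∃ n : ℕ, ∫ t in (n : ℝ)..(n + 1 : ℝ), (‖w t‖ ^ 2 + ‖u t‖ ^ 2) ≤ δ := by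
  obtain ⟨C, hC⟩ := hr.bound
  have hw : ∀ T, 0 ≤ T → IntervalIntegrable (fun t => ‖w t‖ ^ 2) volume 0 T := fun T hT => by
    rw [intervalIntegrable_iff_integrableOn_Ioc_of_le hT]
    simpa [IntegrableOn] using (hr.memLp T hT).integrable_norm_pow (by norm_num)
  have hu : ∀ T, IntervalIntegrable (fun t => ‖u t‖ ^ 2) volume 0 T := fun T =>
    (hr.continuous.norm.pow 2).intervalIntegrable _ _
  refine _root_.exists_small_window (fun T hT => (hw T hT).add (hu T)) (C := M / 2 + C)
    (fun T hT => ?_) hδ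
  rw [intervalIntegral.integral_add (hw T hT) (hu T), intervalIntegral.integral_of_le hT,
    intervalIntegral.integral_of_le hT]
  linarith [hC T hT, hr.action_le T hT]

variable [CompleteSpace H] {Q : H →L[ℝ] H} {lam : ℕ → ℝ} {F : H → ℝ} {κ : ℝ}

/-- The path `ramp t • u (T - t)`: the time reversal of `u`, cut off near time `0`. -/
def revPath (u : ℝ → H) (T t : ℝ) : H := ramp t • u (T - t)

/-- The force `μ η'' + η' - A η` along `η = revPath u T`, when `u` solves
`μ u'' = A u - u' - Q DF(Q u)` and `w = u'`. -/
def revForce (Q : H →L[ℝ] H) (F : H → ℝ) (μ : ℝ) (u w : ℝ → H) (T t : ℝ) : H :=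
  -(ramp t • ((2 : ℝ) • w (T - t) + pullGrad Q F (u (T - t))))
    + (-(2 * μ * deriv ramp t)) • w (T - t)
    + (μ * deriv (deriv ramp) t + deriv ramp t) • u (T - t)

/-- The control that produces the path `Q (revPath u T)`. -/
def revControl (Q : H →L[ℝ] H) (F : H → ℝ) (μ : ℝ) (u w : ℝ → H) (T t : ℝ) : H :=
  revForce Q F μ u w T t + pullGrad Q F (revPath u T t)

omit [CompleteSpace H] in
lemma continuous_revPath (hu : Continuous u) (T : ℝ) : Continuous (revPath u T) :=
  continuous_ramp.smul (hu.comp (continuous_const.sub continuous_id))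

lemma IsPotential.memLp_revForce (h : IsPotential e Q lam F κ) (hr : IsRelaxation e u w U W M)
    (μ : ℝ) {T : ℝ} (hT : 0 ≤ T) :
    MemLp (revForce Q F μ u w T) 2 (volume.restrict (Ioc 0 T)) := by
  have hw := (hr.memLp T hT).reflect
  have hu := (hr.continuous.memLp_two_Ioc T).reflect
  have hN : MemLp (fun t => pullGrad Q F (u (T - t))) 2 (volume.restrict (Ioc 0 T)) :=
    ((h.continuous_pullGrad.comp hr.continuous).memLp_two_Ioc T).reflect
  have h1 := continuous_deriv_ramp
  have h2 := continuous_deriv_deriv_ramp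
  exact ((((hw.const_smul (2 : ℝ)).add hN).continuous_smul continuous_ramp).neg.add
    (hw.continuous_smul (by fun_prop))).add (hu.continuous_smul (by fun_prop))

lemma IsPotential.memLp_revControl (h : IsPotential e Q lam F κ)
    (hr : IsRelaxation e u w U W M) (μ : ℝ) {T : ℝ} (hT : 0 ≤ T) :
    MemLp (revControl Q F μ u w T) 2 (volume.restrict (Ioc 0 T)) :=
  (h.memLp_revForce hr μ hT).add
    ((h.continuous_pullGrad.comp (continuous_revPath hr.continuous T)).memLp_two_Ioc T)

/-- After the cut-off, the control is twice the velocity of the reversed path: the drift has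
cancelled against the equation for `u`. -/
lemma revControl_of_one_lt (μ : ℝ) (u w : ℝ → H) (T : ℝ) {t : ℝ} (ht : 1 < t) :
    revControl Q F μ u w T t = (-2 : ℝ) • w (T - t) := by
  rw [revControl, revForce, revPath, ramp_of_one_le ht.le, deriv_ramp_of_one_le ht.le,
    deriv_deriv_ramp_of_one_lt ht]
  simp

/-- During the cut-off, the control is controlled by `u` and its velocity, uniformly in `T`. -/
lemma IsPotential.exists_revControl_bound (h : IsPotential e Q lam F κ) (μ : ℝ) (u w : ℝ → H) :
    ∃ D, 0 ≤ D ∧ ∀ T, ∀ t ∈ Icc (0 : ℝ) 1,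
      ‖revControl Q F μ u w T t‖ ^ 2 ≤ D * (‖w (T - t)‖ ^ 2 + ‖u (T - t)‖ ^ 2) := by
  have h1 := continuous_deriv_ramp
  have h2 := continuous_deriv_deriv_ramp
  obtain ⟨c₁, hc₁⟩ := (isCompact_Icc (a := (0 : ℝ)) (b := 1)).exists_bound_of_continuousOn
    (f := fun t => -(2 * μ * deriv ramp t)) (by fun_prop)
  obtain ⟨c₂, hc₂⟩ := (isCompact_Icc (a := (0 : ℝ)) (b := 1)).exists_bound_of_continuousOn
    (f := fun t => μ * deriv (deriv ramp) t + deriv ramp t) (by fun_prop)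
  set L := ‖Q‖ * (|κ| * ‖Q‖) with hL
  have hL0 : 0 ≤ L := by positivity
  have hc₁0 : 0 ≤ c₁ := (norm_nonneg _).trans (hc₁ 0 (by simp))
  have hc₂0 : 0 ≤ c₂ := (norm_nonneg _).trans (hc₂ 0 (by simp))
  set A := 2 + c₁ + c₂ + 2 * L with hA
  refine ⟨2 * A ^ 2, by positivity, fun T t ht => ?_⟩
  set a := ‖w (T - t)‖ with ha
  set b := ‖u (T - t)‖ with hb
  have ha0 : 0 ≤ a := norm_nonneg _
  have hb0 : 0 ≤ b := norm_nonneg _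
  have e1 : ‖-(ramp t • ((2 : ℝ) • w (T - t) + pullGrad Q F (u (T - t))))‖ ≤ 2 * a + L * b := by
    rw [norm_neg, norm_smul]
    have h3 : ‖(2 : ℝ) • w (T - t) + pullGrad Q F (u (T - t))‖ ≤ 2 * a + L * b := by
      refine (norm_add_le _ _).trans (add_le_add ?_ (h.norm_pullGrad_le _))
      rw [norm_smul]
      norm_num [ha]
    calc _ ≤ 1 * (2 * a + L * b) :=
          mul_le_mul (abs_ramp_le t) h3 (norm_nonneg _) zero_le_one
      _ = _ := one_mul _
  have e2 : ‖(-(2 * μ * deriv ramp t)) • w (T - t)‖ ≤ c₁ * a := by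
    rw [norm_smul]
    exact mul_le_mul_of_nonneg_right (hc₁ t ht) ha0
  have e3 : ‖(μ * deriv (deriv ramp) t + deriv ramp t) • u (T - t)‖ ≤ c₂ * b := by
    rw [norm_smul]
    exact mul_le_mul_of_nonneg_right (hc₂ t ht) hb0
  have e4 : ‖pullGrad Q F (revPath u T t)‖ ≤ L * b := by
    refine (h.norm_pullGrad_le _).trans (mul_le_mul_of_nonneg_left ?_ hL0)
    rw [revPath, norm_smul]
    calc _ ≤ 1 * b := mul_le_mul_of_nonneg_right (abs_ramp_le t) hb0
      _ = b := one_mul b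
  have e5 : ‖revControl Q F μ u w T t‖ ≤ A * (a + b) := by
    have h4 : ‖revControl Q F μ u w T t‖ ≤ (2 * a + L * b) + c₁ * a + c₂ * b + L * b := by
      refine (norm_add_le _ _).trans (add_le_add ?_ e4)
      refine (norm_add_le _ _).trans (add_le_add ?_ e3)
      exact (norm_add_le _ _).trans (add_le_add e1 e2)
    have h5 : (2 * a + L * b) + c₁ * a + c₂ * b + L * b ≤ A * (a + b) := by
      rw [hA]
      nlinarith [mul_nonneg hc₁0 hb0, mul_nonneg hc₂0 ha0, mul_nonneg hL0 ha0]
    exact h4.trans h5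
  calc _ ≤ (A * (a + b)) ^ 2 := pow_le_pow_left₀ (norm_nonneg _) e5 2
    _ = A ^ 2 * (a + b) ^ 2 := by ring
    _ ≤ A ^ 2 * (2 * (a ^ 2 + b ^ 2)) := by
        gcongr
        nlinarith [sq_nonneg (a - b)]
    _ = _ := by ring

/-- Reversing the uncontrolled flow, and cutting it off at a late time, costs at most `M` up to an
arbitrarily small error. -/
lemma IsPotential.exists_cheap_time (h : IsPotential e Q lam F κ) (hr : IsRelaxation e u w U W M)
    (μ : ℝ) {ε : ℝ} (hε : 0 < ε) :
    ∃ T, 1 ≤ T ∧ (∫ s in Ioc 0 T, ‖revControl Q F μ u w T s‖ ^ 2) / 2 ≤ M + ε := by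
  obtain ⟨D, hD0, hD⟩ := h.exists_revControl_bound μ u w
  -- the cut-off takes place for `t ∈ [0, 1]`, where `T - t` runs through `[n, n + 1]`
  obtain ⟨n, hn⟩ := hr.exists_small_window (δ := 2 * ε / (D + 1)) (by positivity)
  set T : ℝ := n + 1 with hT
  have hn0 : (0 : ℝ) ≤ n := Nat.cast_nonneg n
  have hT0 : 0 ≤ T := by positivity
  have hψ : IntervalIntegrable (fun s => ‖revControl Q F μ u w T s‖ ^ 2) volume 0 T := by
    rw [intervalIntegrable_iff_integrableOn_Ioc_of_le hT0]
    simpa [IntegrableOn] using (h.memLp_revControl hr μ hT0).integrable_norm_pow (by norm_num)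
  have hwi : IntervalIntegrable (fun t => ‖w t‖ ^ 2) volume 0 T := by
    rw [intervalIntegrable_iff_integrableOn_Ioc_of_le hT0]
    simpa [IntegrableOn] using (hr.memLp T hT0).integrable_norm_pow (by norm_num)
  have hqi : IntervalIntegrable (fun t => ‖w t‖ ^ 2 + ‖u t‖ ^ 2) volume 0 T :=
    hwi.add ((hr.continuous.norm.pow 2).intervalIntegrable _ _)
  have hqr : IntervalIntegrable (fun t => ‖w (T - t)‖ ^ 2 + ‖u (T - t)‖ ^ 2) volume 0 T := by
    simpa using (hqi.comp_sub_left T).symm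
  have hsub1 : uIcc (0 : ℝ) 1 ⊆ uIcc 0 T := by
    rw [uIcc_of_le zero_le_one, uIcc_of_le hT0]
    exact Icc_subset_Icc_right (by linarith)
  have hsub2 : uIcc 1 T ⊆ uIcc 0 T := by
    rw [uIcc_of_le (by linarith : (1 : ℝ) ≤ T), uIcc_of_le hT0]
    exact Icc_subset_Icc_left zero_le_one
  have h1 := intervalIntegral.integral_add_adjacent_intervals (hψ.mono_set hsub1)
    (hψ.mono_set hsub2)
  have h2 : ∫ s in (0 : ℝ)..1, ‖revControl Q F μ u w T s‖ ^ 2 ≤ 2 * ε := by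
    calc _ ≤ ∫ s in (0 : ℝ)..1, D * (‖w (T - s)‖ ^ 2 + ‖u (T - s)‖ ^ 2) :=
          intervalIntegral.integral_mono_on zero_le_one (hψ.mono_set hsub1)
            ((hqr.mono_set hsub1).const_mul D) fun t ht => hD T t ht
      _ = D * ∫ t in (n : ℝ)..(n + 1 : ℝ), (‖w t‖ ^ 2 + ‖u t‖ ^ 2) := by
          rw [intervalIntegral.integral_const_mul, intervalIntegral.integral_comp_sub_left
            (fun t => ‖w t‖ ^ 2 + ‖u t‖ ^ 2) T, sub_zero, hT, add_sub_cancel_right]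
      _ ≤ D * (2 * ε / (D + 1)) := by gcongr
      _ ≤ 2 * ε := by
          rw [mul_div_assoc', div_le_iff₀ (by positivity)]
          nlinarith
  have h3 : ∫ s in (1 : ℝ)..T, ‖revControl Q F μ u w T s‖ ^ 2 ≤ 2 * M := by
    have h4 : ∫ s in (1 : ℝ)..T, ‖revControl Q F μ u w T s‖ ^ 2
        = ∫ s in (1 : ℝ)..T, 4 * ‖w (T - s)‖ ^ 2 := by
      refine intervalIntegral.integral_congr_ae (Eventually.of_forall fun s hs => ?_)
      rw [uIoc_of_le (by linarith)] at hs
      rw [revControl_of_one_lt μ u w T hs.1, norm_smul, mul_pow]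
      norm_num
    rw [h4, intervalIntegral.integral_const_mul,
      intervalIntegral.integral_comp_sub_left (fun t => ‖w t‖ ^ 2) T, sub_self, hT,
      add_sub_cancel_right, intervalIntegral.integral_of_le hn0]
    linarith [hr.action_le n hn0]
  refine ⟨T, by linarith, ?_⟩
  rw [intervalIntegral.integral_of_le hT0] at h1
  linarith

end Cost

/-! ### The reversed path solves the skeleton equation -/

section Reversal

/-- A classical solution of the mode equation is the mild one; the forcing matters only up to a null
set. -/
lemma heatMode_eq_of_hasDerivAt {a t : ℝ} (ht : 0 ≤ t) {X h g : ℝ → ℝ} (hh : Continuous h)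
    (hX : ∀ s, HasDerivAt X (-a * X s + h s) s) (hX0 : X 0 = 0)
    (hg : IntervalIntegrable g volume 0 t) (hgh : ∀ᵐ s ∂volume.restrict (Ioc 0 t), g s = h s) :
    heatMode a 0 g t = X t := by
  have h1 := (isExpOf_heatExp a).duhamel (b := fun _ => 1) (X := fun _ => X) (h := h) ht
    (fun _ => (continuous_iff_continuousAt.2 fun s => (hX s).continuousAt).continuousOn)
    hh.continuousOn (fun _ s _ => by simpa using hX s) ()
  have h2 := (isExpOf_heatExp a).modeSol_eq (fun _ => 1) (fun _ => 0) hg ()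
  rw [h1, heatMode, h2, hX0, intervalIntegral.integral_of_le ht, intervalIntegral.integral_of_le ht]
  congr 1
  exact integral_congr_ae (hgh.mono fun s hs => by simp only [hs])

lemma waveMode_eq_of_hasDerivAt {μ a t : ℝ} (ht : 0 ≤ t) {X Y h g : ℝ → ℝ} (hh : Continuous h)
    (hX : ∀ s, HasDerivAt X (Y s) s)
    (hY : ∀ s, HasDerivAt Y (-(a / μ) * X s + -(1 / μ) * Y s + 1 / μ * h s) s)
    (hX0 : X 0 = 0) (hY0 : Y 0 = 0)
    (hg : IntervalIntegrable g volume 0 t) (hgh : ∀ᵐ s ∂volume.restrict (Ioc 0 t), g s = h s) :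
    waveMode μ a 0 0 g t = X t ∧ waveVel μ a 0 0 g t = Y t := by
  have hXc : Continuous X := continuous_iff_continuousAt.2 fun s => (hX s).continuousAt
  have hYc : Continuous Y := continuous_iff_continuousAt.2 fun s => (hY s).continuousAt
  have h1 := (isExpOf_waveExp μ a).duhamel (b := waveDir μ) (X := ![X, Y]) (h := h) ht
    (by intro i; fin_cases i; exacts [hXc.continuousOn, hYc.continuousOn]) hh.continuousOn
    (by
      intro i s _
      fin_cases i
      · simpa [waveMatrix, waveDir] using hX s
      · simpa [waveMatrix, waveDir] using hY s)
  have h0 : (fun j => ![X, Y] j 0) = ![0, 0] := by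
    funext j; fin_cases j <;> simp [hX0, hY0]
  have h2 : ∀ i, modeSol (waveExp μ a) (waveDir μ) ![0, 0] g i t = ![X, Y] i t := by
    intro i
    rw [(isExpOf_waveExp μ a).modeSol_eq _ _ hg, h1 i, h0, intervalIntegral.integral_of_le ht,
      intervalIntegral.integral_of_le ht]
    congr 1
    exact integral_congr_ae (hgh.mono fun s hs => by simp only [hs])
  exact ⟨h2 0, h2 1⟩

/-- The Fourier coefficient of `revForce`, in terms of the mode `U`, its velocity `W` and the
coefficient `f` of `-Q DF(Q u)`. -/
def revCoeff (μ : ℝ) (U W f : ℝ → ℝ) (T t : ℝ) : ℝ :=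
  -(ramp t * (2 * W (T - t) - f (T - t))) + -(2 * μ * deriv ramp t) * W (T - t)
    + (μ * deriv (deriv ramp) t + deriv ramp t) * U (T - t)

lemma continuous_revCoeff (μ : ℝ) {U W f : ℝ → ℝ} (hU : Continuous U) (hW : Continuous W)
    (hf : Continuous f) (T : ℝ) : Continuous (revCoeff μ U W f T) := by
  have h0 := continuous_ramp
  have h1 := continuous_deriv_ramp
  have h2 := continuous_deriv_deriv_ramp
  unfold revCoeff
  fun_prop

lemma hasDerivAt_ramp_mul_reflect {U : ℝ → ℝ} {U' T s : ℝ} (hU : HasDerivAt U U' (T - s)) :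
    HasDerivAt (fun s => ramp s * U (T - s)) (deriv ramp s * U (T - s) - ramp s * U') s :=
  ((ramp_hasDerivAt s).fun_mul (hU.comp_const_sub T s)).congr_deriv (by ring)

lemma hasDerivAt_deriv_ramp_mul_reflect {U : ℝ → ℝ} {U' T s : ℝ} (hU : HasDerivAt U U' (T - s)) :
    HasDerivAt (fun s => deriv ramp s * U (T - s))
      (deriv (deriv ramp) s * U (T - s) - deriv ramp s * U') s :=
  ((deriv_ramp_hasDerivAt s).fun_mul (hU.comp_const_sub T s)).congr_deriv (by ring)

variable {H : Type*} [NormedAddCommGroup H] [InnerProductSpace ℝ H] [CompleteSpace H]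
  {e : HilbertBasis ℕ ℝ H} {Q : H →L[ℝ] H} {lam : ℕ → ℝ} {F : H → ℝ} {κ : ℝ} {α : ℕ → ℝ} {μ : ℝ}
  {u w : ℝ → H} {U W : ℕ → ℝ → ℝ} {M : ℝ}

omit [CompleteSpace H] in
lemma IsRelaxation.repr_revPath (hr : IsRelaxation e u w U W M) {T t : ℝ} (ht : t ∈ Icc 0 T)
    (k : ℕ) : e.repr (revPath u T t) k = ramp t * U k (T - t) := by
  rw [revPath, map_smul, lp.coeFn_smul, Pi.smul_apply, hr.repr_pos _ (by linarith [ht.2]),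
    smul_eq_mul]

lemma IsRelaxation.ae_repr_revForce (hr : IsRelaxation e u w U W M) (μ : ℝ) {T : ℝ}
    (hT : 0 ≤ T) : ∀ᵐ t ∂volume.restrict (Ioc 0 T), ∀ k,
      e.repr (revForce Q F μ u w T t) k
        = revCoeff μ (U k) (W k) (forceCoeff e Q F u k) T t := by
  filter_upwards [ae_reflect (hr.repr_vel T hT), ae_restrict_mem measurableSet_Ioc]
    with t ht htT k
  simp only [revForce, revCoeff, forceCoeff, map_add, map_neg, map_smul, lp.coeFn_add,
    lp.coeFn_neg, lp.coeFn_smul, Pi.add_apply, Pi.neg_apply, Pi.smul_apply, smul_eq_mul, ht k,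
    hr.repr_pos _ (sub_nonneg.2 htT.2) k]
  ring

lemma netForcing_revControl (Q : H →L[ℝ] H) (F : H → ℝ) (μ : ℝ) (u w : ℝ → H) (T : ℝ) :
    (netForcing Q F (revControl Q F μ u w T) fun s => Q (revPath u T s))
      = revForce Q F μ u w T := by
  funext s
  simp [netForcing, revControl, pullGrad]

/-- Every endpoint of finite energy is reached by the heat equation at a cost arbitrarily close to
its energy. -/
lemma IsPotential.heat_upper (h : IsPotential e Q lam F κ) (hα : 0 < α 0)
    (hmono : Monotone α) {B : H → H} (hB : ∀ x, B x = -Q (Q (gradient F x)))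
    (ξ : H) (hξ : Summable fun k => α k * e.repr ξ k ^ 2) {ε : ℝ} (hε : 0 < ε) :
    ∃ (T : ℝ) (φ ψ : ℝ → H), 0 < T ∧ ContinuousOn φ (Icc 0 T) ∧ φ 0 = 0 ∧ φ T = Q ξ ∧
      MemLp ψ 2 (volume.restrict (Ioc 0 T)) ∧ IsHeatSkeleton e α Q B 0 T ψ φ ∧
      (∫ s in Ioc 0 T, ‖ψ s‖ ^ 2) / 2
        ≤ ∑' k, α k * e.repr ξ k ^ 2 + 2 * F (Q ξ) + ε := by
  have hα' : ∀ k, 0 < α k := fun k => hα.trans_le (hmono (Nat.zero_le k))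
  obtain ⟨u, w, hu0, hr⟩ := h.heat_relaxation hα hmono ξ hξ
  obtain ⟨T, hT1, hcost⟩ := h.exists_cheap_time hr 0 hε
  have hT : 0 ≤ T := by linarith
  have hψ := h.memLp_revControl hr 0 hT
  have hφ : Continuous fun t => Q (revPath u T t) :=
    Q.continuous.comp (continuous_revPath hr.continuous T)
  have hφ0 : Q (revPath u T 0) = 0 := by simp [revPath, ramp_zero]
  refine ⟨T, fun t => Q (revPath u T t), revControl Q F 0 u w T, by linarith, hφ.continuousOn,
    hφ0, ?_, hψ, ?_, hcost⟩
  · simp [revPath, ramp_of_one_le hT1, hu0]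
  · refine (h.isHeatSkeleton_iff hα' hB hψ hφ.continuousOn hφ0).2 fun t ht => ?_
    rw [netForcing_revControl]
    congr 1
    have hf := (h.memLp_revForce hr 0 hT).intervalIntegrable_two ht
    refine e.repr_inj fun k => ?_
    have hfk : IntervalIntegrable (fun s => e.repr (revForce Q F 0 u w T s) k) volume 0 t :=
      hf.repr e k
    have hfc := h.continuous_forceCoeff hr.continuous k
    have hd := fun s => heatMode_hasDerivAt (α k) (e.repr ξ k) hfc s
    have hUc := continuous_iff_continuousAt.2 fun s => (hd s).continuousAt
    rw [repr_conv_heat hα' ht.1 hf, hr.repr_revPath ht]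
    symm
    refine heatMode_eq_of_hasDerivAt ht.1
      (h := revCoeff 0 (heatMode (α k) (e.repr ξ k) (forceCoeff e Q F u k))
        (heatVel (α k) (e.repr ξ k) (forceCoeff e Q F u k)) (forceCoeff e Q F u k) T)
      (X := fun s => ramp s * heatMode (α k) (e.repr ξ k) (forceCoeff e Q F u k) (T - s))
      (continuous_revCoeff 0 hUc (hfc.sub (continuous_const.mul hUc)) hfc T) (fun s => ?_)
      (by simp [ramp_zero]) hfk ?_
    · refine (hasDerivAt_ramp_mul_reflect (hd (T - s))).congr_deriv ?_
      simp only [revCoeff, heatVel]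
      ring
    · exact ae_mono (Measure.restrict_mono (Ioc_subset_Ioc_right ht.2) le_rfl)
        ((hr.ae_repr_revForce 0 hT).mono fun s hs => hs k)

/-- Every endpoint of finite energy is reached by the wave equation at a cost arbitrarily close to
its energy. -/
lemma IsPotential.wave_upper (h : IsPotential e Q lam F κ) (hα : 0 < α 0)
    (hmono : Monotone α) (hμ : 0 < μ) {B : H → H} (hB : ∀ x, B x = -Q (Q (gradient F x)))
    (ξ ζ : H) (hξ : Summable fun k => α k * e.repr ξ k ^ 2) {ε : ℝ} (hε : 0 < ε) :
    ∃ (T : ℝ) (z : ℝ → Phase H α) (ψ : ℝ → H), 0 < T ∧ ContinuousOn z (Icc 0 T) ∧ z 0 = 0 ∧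
      z T = (Q ξ, toHNeg e α (Q ζ)) ∧
      MemLp ψ 2 (volume.restrict (Ioc 0 T)) ∧ IsWaveSkeleton e α Q B μ 0 T ψ z ∧
      (∫ s in Ioc 0 T, ‖ψ s‖ ^ 2) / 2
        ≤ ∑' k, α k * e.repr ξ k ^ 2 + 2 * F (Q ξ) + μ * ‖ζ‖ ^ 2 + ε := by
  have hα' : ∀ k, 0 < α k := fun k => hα.trans_le (hmono (Nat.zero_le k))
  -- reversing time changes the sign of the velocity
  obtain ⟨u, w, hu0, hw0, hw, hwk, hr⟩ := h.wave_relaxation hα hmono hμ ξ (-ζ) hξ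
  rw [norm_neg] at hr
  obtain ⟨T, hT1, hcost⟩ := h.exists_cheap_time hr μ hε
  have hT : 0 ≤ T := by linarith
  have hψ := h.memLp_revControl hr μ hT
  set v : ℝ → H := fun t => deriv ramp t • u (T - t) - ramp t • w (T - t) with hv
  have hφ : Continuous fun t => Q (revPath u T t) :=
    Q.continuous.comp (continuous_revPath hr.continuous T)
  have hvc : Continuous v := by
    have h1 := continuous_ramp
    have h2 := continuous_deriv_ramp
    have h3 := hr.continuous
    fun_prop
  have hzc : Continuous fun t => ((Q (revPath u T t), toHNeg e α (Q (v t))) : Phase H α) := by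
    simp only [← negIncl_apply hα hmono]
    exact hφ.prodMk ((negIncl hα hmono e).continuous.comp (Q.continuous.comp hvc))
  have hz0 : ((Q (revPath u T 0), toHNeg e α (Q (v 0))) : Phase H α) = 0 := by
    have h1 : toHNeg e α (0 : H) = 0 := (negIncl hα hmono e).map_zero
    simp [revPath, hv, ramp_zero, deriv_ramp_zero, h1]
  refine ⟨T, fun t => (Q (revPath u T t), toHNeg e α (Q (v t))), revControl Q F μ u w T,
    by linarith, hzc.continuousOn, hz0, ?_, hψ, ?_, hcost⟩
  · simp [revPath, hv, ramp_of_one_le hT1, deriv_ramp_of_one_le hT1, hu0, hw0]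
  · refine (h.isWaveSkeleton_iff hα hmono hμ hB hψ hzc.continuousOn hz0).2 fun t ht => ?_
    simp only
    rw [netForcing_revControl]
    have hf := (h.memLp_revForce hr μ hT).intervalIntegrable_two ht
    have key : ∀ k, e.repr (conv e (wavePosSym α μ) (revForce Q F μ u w T) t) k
          = e.repr (revPath u T t) k ∧
        e.repr (conv e (waveVelSym α μ) (revForce Q F μ u w T) t) k = e.repr (v t) k := by
      intro k
      have hfk : IntervalIntegrable (fun s => e.repr (revForce Q F μ u w T s) k) volume 0 t :=
        hf.repr e k
      have hfc := h.continuous_forceCoeff hr.continuous k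
      have hvk : e.repr (v t) k = deriv ramp t * waveMode μ (α k) (e.repr ξ k) (e.repr (-ζ) k)
            (forceCoeff e Q F u k) (T - t)
          - ramp t * waveVel μ (α k) (e.repr ξ k) (e.repr (-ζ) k)
            (forceCoeff e Q F u k) (T - t) := by
        rw [← hwk _ (sub_nonneg.2 ht.2), ← hr.repr_pos _ (sub_nonneg.2 ht.2)]
        simp [hv]
        rfl
      rw [repr_conv_wavePos hα hmono hμ ht.1 hf, repr_conv_waveVel hα' hμ ht.1 hf,
        hr.repr_revPath ht, hvk]
      have hae := ae_mono (Measure.restrict_mono (Ioc_subset_Ioc_right ht.2) le_rfl)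
        ((hr.ae_repr_revForce (Q := Q) (F := F) μ hT).mono fun s hs => hs k)
      have hd := fun s => waveMode_hasDerivAt μ (α k) (e.repr ξ k) (e.repr (-ζ) k) hfc s
      have hd' := fun s => waveVel_hasDerivAt μ (α k) (e.repr ξ k) (e.repr (-ζ) k) hfc s
      set U := waveMode μ (α k) (e.repr ξ k) (e.repr (-ζ) k) (forceCoeff e Q F u k)
      set W := waveVel μ (α k) (e.repr ξ k) (e.repr (-ζ) k) (forceCoeff e Q F u k)
      have hUc := continuous_iff_continuousAt.2 fun s => (hd s).continuousAt
      have hWc := continuous_iff_continuousAt.2 fun s => (hd' s).continuousAt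
      refine waveMode_eq_of_hasDerivAt ht.1 (X := fun s => ramp s * U (T - s))
        (Y := fun s => deriv ramp s * U (T - s) - ramp s * W (T - s))
        (continuous_revCoeff μ hUc hWc hfc T) (fun s => hasDerivAt_ramp_mul_reflect (hd (T - s)))
        (fun s => ?_) (by simp [ramp_zero]) (by simp [ramp_zero, deriv_ramp_zero]) hfk hae
      refine ((hasDerivAt_deriv_ramp_mul_reflect (hd (T - s))).fun_sub
        (hasDerivAt_ramp_mul_reflect (hd' (T - s)))).congr_deriv ?_
      simp only [revCoeff]
      field_simp
      ring
    rw [e.repr_inj fun k => (key k).1, e.repr_inj fun k => (key k).2]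

end Reversal

/-! ### The pseudo-inverse of `Q` and the square root of `-A` -/

section Inverse

variable {H : Type*} [NormedAddCommGroup H] [InnerProductSpace ℝ H]
  {e : HilbertBasis ℕ ℝ H} {Q : H →L[ℝ] H} {lam : ℕ → ℝ} {α : ℕ → ℝ}

/-- `Q` is injective on `(ker Q)ᗮ`, so that `LinearPMap.inverse` is a genuine inverse in `opInv`. -/
lemma ker_toPMap_orthogonal_ker (Q : H →L[ℝ] H) :
    LinearMap.ker ((Q : H →ₗ[ℝ] H).toPMap (LinearMap.ker (Q : H →ₗ[ℝ] H))ᗮ).toFun = ⊥ := by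
  rw [LinearMap.ker_eq_bot']
  rintro ⟨x, hx⟩ h
  have h1 : x ∈ LinearMap.ker (Q : H →ₗ[ℝ] H) := h
  have h2 : inner ℝ x x = 0 := hx x h1
  exact Subtype.ext (inner_self_eq_zero.1 h2)

lemma mem_opInv_domain {x : H} :
    x ∈ (opInv Q).domain ↔ ∃ ξ : (LinearMap.ker (Q : H →ₗ[ℝ] H))ᗮ, Q ξ = x := by
  rw [opInv, LinearPMap.inverse_domain]
  rfl

lemma apply_opInv (x : (opInv Q).domain) : Q (opInv Q x) = x := by
  obtain ⟨ξ, hξ⟩ := mem_opInv_domain.1 x.2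
  have h2 : opInv Q x = ξ := LinearPMap.inverse_apply_eq (ker_toPMap_orthogonal_ker Q)
    (x := ξ) hξ
  rw [h2]
  exact hξ

/-- Every preimage `η` of `x` has Fourier coefficients at least as large as those of `Q⁻¹ x`: the
latter is obtained from `η` by discarding the coefficients along the kernel of `Q`. -/
lemma opInv_of_apply_eq (hQ : ∀ k, Q (e k) = lam k • e k) {η x : H} (hη : Q η = x) :
    ∃ hx : x ∈ (opInv Q).domain, ∀ k, e.repr (opInv Q ⟨x, hx⟩) k ^ 2 ≤ e.repr η k ^ 2 := by
  classical
  obtain ⟨ξ, hξ⟩ := e.exists_repr_eq (c := fun k => if lam k = 0 then 0 else e.repr η k)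
    ((e.hasSum_repr_sq η).summable.of_nonneg_of_le (fun k => sq_nonneg _)
      (fun k => by split_ifs <;> simp [sq_nonneg]))
  have hQξ : Q ξ = x := by
    rw [← hη]
    refine e.repr_inj fun k => ?_
    rw [repr_of_diag e hQ, repr_of_diag e hQ, hξ]
    split_ifs with h0 <;> simp [h0]
  have hker : ξ ∈ (LinearMap.ker (Q : H →ₗ[ℝ] H))ᗮ := by
    intro v hv
    have hv' : Q v = 0 := hv
    refine (e.hasSum_repr_mul_repr v ξ).unique ?_
    convert hasSum_zero with k
    have h1 : lam k * e.repr v k = 0 := by rw [← repr_of_diag e hQ, hv']; simp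
    rw [hξ]
    rcases mul_eq_zero.1 h1 with h2 | h2 <;> simp [h2]
  have hx : x ∈ (opInv Q).domain := mem_opInv_domain.2 ⟨⟨ξ, hker⟩, hQξ⟩
  have h2 : opInv Q ⟨x, hx⟩ = ξ := LinearPMap.inverse_apply_eq
    (ker_toPMap_orthogonal_ker Q) (x := ⟨ξ, hker⟩) hQξ
  refine ⟨hx, fun k => ?_⟩
  rw [h2, hξ]
  split_ifs <;> simp [sq_nonneg]

lemma mem_sqrtNeg_domain (hα : ∀ k, 0 < α k) {v : H} :
    v ∈ (sqrtNeg e α).domain ↔ Summable fun k => α k * e.repr v k ^ 2 := by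
  change Memℓp (fun k => Real.sqrt (α k) * e.repr v k) 2 ↔ _
  rw [memℓp_gen_iff (by norm_num)]
  simp [mul_pow, Real.sq_sqrt (hα _).le]

lemma norm_sqrtNeg_sq (hα : ∀ k, 0 < α k) (v : (sqrtNeg e α).domain) :
    ‖sqrtNeg e α v‖ ^ 2 = ∑' k, α k * e.repr (v : H) k ^ 2 := by
  have h1 : ∀ k, e.repr (sqrtNeg e α v) k = Real.sqrt (α k) * e.repr (v : H) k := fun k => by
    change e.repr (e.repr.symm (diagSeq e (fun k => Real.sqrt (α k)) v)) k = _
    rw [LinearIsometryEquiv.apply_symm_apply]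
    rfl
  rw [← (e.hasSum_repr_sq (sqrtNeg e α v)).tsum_eq]
  exact tsum_congr fun k => by rw [h1, mul_pow, Real.sq_sqrt (hα k).le]

/-- `Q⁻¹ x` has the least energy among all preimages of `x`. -/
lemma energy_opInv_le (hα : ∀ k, 0 < α k) (hQ : ∀ k, Q (e k) = lam k • e k) {η x : H}
    (hη : Q η = x) (hs : Summable fun k => α k * e.repr η k ^ 2) :
    ∃ (hx : x ∈ (opInv Q).domain) (hx' : opInv Q ⟨x, hx⟩ ∈ (sqrtNeg e α).domain),
      ‖sqrtNeg e α ⟨opInv Q ⟨x, hx⟩, hx'⟩‖ ^ 2 ≤ ∑' k, α k * e.repr η k ^ 2 := by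
  obtain ⟨hx, hle⟩ := opInv_of_apply_eq hQ hη
  have hle' : ∀ k, α k * e.repr (opInv Q ⟨x, hx⟩) k ^ 2 ≤ α k * e.repr η k ^ 2 := fun k =>
    mul_le_mul_of_nonneg_left (hle k) (hα k).le
  have hs' : Summable fun k => α k * e.repr (opInv Q ⟨x, hx⟩) k ^ 2 :=
    hs.of_nonneg_of_le (fun k => mul_nonneg (hα k).le (sq_nonneg _)) hle'
  refine ⟨hx, (mem_sqrtNeg_domain hα).2 hs', ?_⟩
  rw [norm_sqrtNeg_sq hα]
  exact hs'.tsum_le_tsum hle' hs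

lemma norm_opInv_le (hQ : ∀ k, Q (e k) = lam k • e k) {η x : H} (hη : Q η = x)
    (hx : x ∈ (opInv Q).domain) : ‖opInv Q ⟨x, hx⟩‖ ^ 2 ≤ ‖η‖ ^ 2 := by
  obtain ⟨_, hle⟩ := opInv_of_apply_eq hQ hη
  exact hasSum_le hle (e.hasSum_repr_sq _) (e.hasSum_repr_sq _)

end Inverse

/-! ### The quasi-potentials -/

section QuasiPotential

variable {H : Type*} [NormedAddCommGroup H] [InnerProductSpace ℝ H]

omit [InnerProductSpace ℝ H] in
lemma half_lintegral_sq {ψ : ℝ → H} {T : ℝ} (hψ : MemLp ψ 2 (volume.restrict (Ioc 0 T))) :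
    (1 / 2) * ∫⁻ s in Ioo 0 T, ‖ψ s‖ₑ ^ 2
      = ENNReal.ofReal ((∫ s in Ioc 0 T, ‖ψ s‖ ^ 2) / 2) := by
  have h1 : Integrable (fun s => ‖ψ s‖ ^ 2) (volume.restrict (Ioc 0 T)) := by
    simpa using hψ.integrable_norm_pow (by norm_num)
  rw [Measure.restrict_congr_set Ioo_ae_eq_Ioc, div_eq_inv_mul,
    ENNReal.ofReal_mul (by norm_num), ofReal_integral_eq_lintegral_ofReal h1
      (Eventually.of_forall fun s => sq_nonneg _)]
  congr 1
  · rw [ENNReal.ofReal_inv_of_pos (by norm_num)]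
    simp
  · refine lintegral_congr fun s => ?_
    rw [ENNReal.ofReal_pow (norm_nonneg _), ofReal_norm]

variable [CompleteSpace H]
  {e : HilbertBasis ℕ ℝ H} {Q : H →L[ℝ] H} {lam : ℕ → ℝ} {F : H → ℝ} {κ : ℝ} {α : ℕ → ℝ} {μ : ℝ}
  {B : H → H}

omit [CompleteSpace H] in
lemma le_waveQuasiPotential {x : H} {y : HSob α (-1)} {c : ℝ≥0∞}
    (hc : ∀ (T : ℝ) (z : ℝ → Phase H α) (ψ : ℝ → H), 0 ≤ T → ContinuousOn z (Icc 0 T) →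
      z 0 = 0 → z T = (x, y) → MemLp ψ 2 (volume.restrict (Ioc 0 T)) →
      IsWaveSkeleton e α Q B μ 0 T ψ z →
      c ≤ ENNReal.ofReal ((∫ s in Ioc 0 T, ‖ψ s‖ ^ 2) / 2)) :
    c ≤ waveQuasiPotential e α Q B μ x y := by
  refine le_iInf fun T => le_iInf fun hT => le_iInf fun z => le_iInf fun hz => le_iInf fun hz0 =>
    le_iInf fun hzT => ?_
  have h0 : (1 / 2 : ℝ≥0∞) ≠ 0 := by simp
  have ht : (1 / 2 : ℝ≥0∞) ≠ ⊤ := by simp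
  rw [waveRate, ENNReal.mul_iInf_of_ne h0 ht]
  refine le_iInf fun ψ => ?_
  rw [ENNReal.mul_iInf_of_ne h0 ht]
  refine le_iInf fun hψ => ?_
  rw [ENNReal.mul_iInf_of_ne h0 ht]
  refine le_iInf fun hs => ?_
  rw [Measure.restrict_congr_set Ioo_ae_eq_Ioc] at hψ
  rw [half_lintegral_sq hψ]
  exact hc T z ψ hT.le hz hz0 hzT hψ hs

omit [CompleteSpace H] in
lemma le_heatQuasiPotential {x : H} {c : ℝ≥0∞}
    (hc : ∀ (T : ℝ) (φ ψ : ℝ → H), 0 ≤ T → ContinuousOn φ (Icc 0 T) →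
      φ 0 = 0 → φ T = x → MemLp ψ 2 (volume.restrict (Ioc 0 T)) →
      IsHeatSkeleton e α Q B 0 T ψ φ →
      c ≤ ENNReal.ofReal ((∫ s in Ioc 0 T, ‖ψ s‖ ^ 2) / 2)) :
    c ≤ heatQuasiPotential e α Q B x := by
  refine le_iInf fun T => le_iInf fun hT => le_iInf fun φ => le_iInf fun hφ => le_iInf fun hφ0 =>
    le_iInf fun hφT => ?_
  have h0 : (1 / 2 : ℝ≥0∞) ≠ 0 := by simp
  have ht : (1 / 2 : ℝ≥0∞) ≠ ⊤ := by simp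
  rw [heatRate, ENNReal.mul_iInf_of_ne h0 ht]
  refine le_iInf fun ψ => ?_
  rw [ENNReal.mul_iInf_of_ne h0 ht]
  refine le_iInf fun hψ => ?_
  rw [ENNReal.mul_iInf_of_ne h0 ht]
  refine le_iInf fun hs => ?_
  rw [Measure.restrict_congr_set Ioo_ae_eq_Ioc] at hψ
  rw [half_lintegral_sq hψ]
  exact hc T φ ψ hT.le hφ hφ0 hφT hψ hs

omit [CompleteSpace H] in
lemma waveQuasiPotential_le {T : ℝ} (hT : 0 < T) {z : ℝ → Phase H α} {ψ : ℝ → H}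
    (hz : ContinuousOn z (Icc 0 T)) (hz0 : z 0 = 0)
    (hψ : MemLp ψ 2 (volume.restrict (Ioc 0 T))) (hs : IsWaveSkeleton e α Q B μ 0 T ψ z) :
    waveQuasiPotential e α Q B μ (z T).1 (z T).2
      ≤ ENNReal.ofReal ((∫ s in Ioc 0 T, ‖ψ s‖ ^ 2) / 2) := by
  rw [← half_lintegral_sq hψ]
  rw [← Measure.restrict_congr_set Ioo_ae_eq_Ioc] at hψ
  exact (iInf₂_le_of_le T hT <| iInf₂_le_of_le z hz <| iInf₂_le_of_le hz0 rfl <|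
    mul_le_mul_right (iInf₂_le_of_le ψ hψ <| iInf_le_of_le hs le_rfl) _)

omit [CompleteSpace H] in
lemma heatQuasiPotential_le {T : ℝ} (hT : 0 < T) {φ ψ : ℝ → H}
    (hφ : ContinuousOn φ (Icc 0 T)) (hφ0 : φ 0 = 0)
    (hψ : MemLp ψ 2 (volume.restrict (Ioc 0 T))) (hs : IsHeatSkeleton e α Q B 0 T ψ φ) :
    heatQuasiPotential e α Q B (φ T)
      ≤ ENNReal.ofReal ((∫ s in Ioc 0 T, ‖ψ s‖ ^ 2) / 2) := by
  rw [← half_lintegral_sq hψ]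
  rw [← Measure.restrict_congr_set Ioo_ae_eq_Ioc] at hψ
  exact (iInf₂_le_of_le T hT <| iInf₂_le_of_le φ hφ <| iInf₂_le_of_le hφ0 rfl <|
    mul_le_mul_right (iInf₂_le_of_le ψ hψ <| iInf_le_of_le hs le_rfl) _)

lemma ENNReal.le_ofReal_of_forall_pos_add {a : ℝ≥0∞} {b : ℝ}
    (h : ∀ ε, 0 < ε → a ≤ ENNReal.ofReal (b + ε)) : a ≤ ENNReal.ofReal b := by
  have h1 : Tendsto (fun ε : ℝ => ENNReal.ofReal (b + ε)) (𝓝[>] 0) (𝓝 (ENNReal.ofReal (b + 0))) :=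
    ((ENNReal.continuous_ofReal.comp (continuous_const.add continuous_id)).tendsto 0).mono_left
      nhdsWithin_le_nhds
  rw [add_zero] at h1
  exact ge_of_tendsto h1 (eventually_mem_nhdsWithin.mono fun ε hε => h ε hε)

lemma IsPotential.waveQuasiPotential_eq (h : IsPotential e Q lam F κ) (hα : 0 < α 0)
    (hmono : Monotone α) (hμ : 0 < μ) (hB : ∀ x, B x = -Q (Q (gradient F x)))
    (x : H) (hx : x ∈ (opInv Q).domain) (hx' : opInv Q ⟨x, hx⟩ ∈ (sqrtNeg e α).domain)
    (y : H) (hy : y ∈ (opInv Q).domain) :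
    waveQuasiPotential e α Q B μ x (toHNeg e α y) =
      ENNReal.ofReal (‖sqrtNeg e α ⟨opInv Q ⟨x, hx⟩, hx'⟩‖ ^ 2 + 2 * F x
        + μ * ‖opInv Q ⟨y, hy⟩‖ ^ 2) := by
  have hα' : ∀ k, 0 < α k := fun k => hα.trans_le (hmono (Nat.zero_le k))
  refine le_antisymm (ENNReal.le_ofReal_of_forall_pos_add fun ε hε => ?_)
    (le_waveQuasiPotential fun T z ψ hT hz hz0 hzT hψ hs => ENNReal.ofReal_le_ofReal ?_)
  · obtain ⟨T, z, ψ, hT, hz, hz0, hzT, hψ, hs, hcost⟩ := h.wave_upper hα hmono hμ hB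
      (opInv Q ⟨x, hx⟩) (opInv Q ⟨y, hy⟩) ((mem_sqrtNeg_domain hα').1 hx') hε
    have h1 := waveQuasiPotential_le hT hz hz0 hψ hs
    rw [hzT, apply_opInv, apply_opInv] at h1
    rw [apply_opInv] at hcost
    rw [norm_sqrtNeg_sq hα']
    exact h1.trans (ENNReal.ofReal_le_ofReal hcost)
  · obtain ⟨η, ζ, hη, hζ, hsum, hle⟩ := h.wave_lower hα hmono hμ hB hT hψ hz hz0 hs
    rw [hzT] at hη hζ
    have hζ' : Q ζ = y := toHNeg_injective hα hmono e hζ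
    obtain ⟨_, _, h2⟩ := energy_opInv_le hα' h.diag hη hsum
    have h3 := mul_le_mul_of_nonneg_left (norm_opInv_le h.diag hζ' hy) hμ.le
    simp only at hη
    rw [hη] at hle
    linarith

lemma IsPotential.heatQuasiPotential_eq (h : IsPotential e Q lam F κ) (hα : 0 < α 0)
    (hmono : Monotone α) (hB : ∀ x, B x = -Q (Q (gradient F x)))
    (x : H) (hx : x ∈ (opInv Q).domain) (hx' : opInv Q ⟨x, hx⟩ ∈ (sqrtNeg e α).domain) :
    heatQuasiPotential e α Q B x =
      ENNReal.ofReal (‖sqrtNeg e α ⟨opInv Q ⟨x, hx⟩, hx'⟩‖ ^ 2 + 2 * F x) := by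
  have hα' : ∀ k, 0 < α k := fun k => hα.trans_le (hmono (Nat.zero_le k))
  refine le_antisymm (ENNReal.le_ofReal_of_forall_pos_add fun ε hε => ?_)
    (le_heatQuasiPotential fun T φ ψ hT hφ hφ0 hφT hψ hs => ENNReal.ofReal_le_ofReal ?_)
  · obtain ⟨T, φ, ψ, hT, hφ, hφ0, hφT, hψ, hs, hcost⟩ := h.heat_upper hα hmono hB
      (opInv Q ⟨x, hx⟩) ((mem_sqrtNeg_domain hα').1 hx') hε
    have h1 := heatQuasiPotential_le hT hφ hφ0 hψ hs
    rw [hφT, apply_opInv] at h1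
    rw [apply_opInv] at hcost
    rw [norm_sqrtNeg_sq hα']
    exact h1.trans (ENNReal.ofReal_le_ofReal hcost)
  · obtain ⟨η, hη, hsum, hle⟩ := h.heat_lower hα' hB hT hψ hφ hφ0 hs
    rw [hφT] at hη
    obtain ⟨_, _, h2⟩ := energy_opInv_le hα' h.diag hη hsum
    rw [hη] at hle
    linarith

/-- The wave quasi-potential dominates the heat quasi-potential, whatever the final velocity. -/
lemma IsPotential.heatQuasiPotential_le_waveQuasiPotential (h : IsPotential e Q lam F κ)
    (hα : 0 < α 0) (hmono : Monotone α) (hμ : 0 < μ) (hB : ∀ x, B x = -Q (Q (gradient F x)))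
    (x : H) (y : HSob α (-1)) :
    heatQuasiPotential e α Q B x ≤ waveQuasiPotential e α Q B μ x y := by
  have hα' : ∀ k, 0 < α k := fun k => hα.trans_le (hmono (Nat.zero_le k))
  refine le_waveQuasiPotential fun T z ψ hT hz hz0 hzT hψ hs => ?_
  obtain ⟨η, ζ, hη, -, hsum, hle⟩ := h.wave_lower hα hmono hμ hB hT hψ hz hz0 hs
  rw [hzT] at hη
  obtain ⟨hx, hx', h2⟩ := energy_opInv_le hα' h.diag hη hsum
  rw [h.heatQuasiPotential_eq hα hmono hB x hx hx']
  have h3 : 0 ≤ μ * ‖ζ‖ ^ 2 := by positivity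
  simp only at hη
  rw [hη] at hle
  exact ENNReal.ofReal_le_ofReal (by linarith)

/-- A point of finite heat quasi-potential lies in the domain of `(-A)^{1/2} Q⁻¹`, where the formula
for `V^μ(x, 0)` applies. -/
lemma IsPotential.waveQuasiPotential_zero_le (h : IsPotential e Q lam F κ)
    (hα : 0 < α 0) (hmono : Monotone α) (hμ : 0 < μ) (hB : ∀ x, B x = -Q (Q (gradient F x)))
    (x : H) : waveQuasiPotential e α Q B μ x 0 ≤ heatQuasiPotential e α Q B x := by
  have hα' : ∀ k, 0 < α k := fun k => hα.trans_le (hmono (Nat.zero_le k))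
  refine le_heatQuasiPotential fun T φ ψ hT hφ hφ0 hφT hψ hs => ?_
  obtain ⟨η, hη, hsum, hle⟩ := h.heat_lower hα' hB hT hψ hφ hφ0 hs
  rw [hφT] at hη
  obtain ⟨hx, hx', h2⟩ := energy_opInv_le hα' h.diag hη hsum
  have h0 : toHNeg e α (0 : H) = 0 := (negIncl hα hmono e).map_zero
  have h1 := h.waveQuasiPotential_eq hα hmono hμ hB x hx hx' 0 (opInv Q).domain.zero_mem
  have h3 : opInv Q ⟨0, (opInv Q).domain.zero_mem⟩ = 0 := (opInv Q).map_zero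
  rw [h0, h3] at h1
  rw [h1]
  rw [hη] at hle
  refine ENNReal.ofReal_le_ofReal ?_
  rw [norm_zero]
  linarith

end QuasiPotential

end

theorem mainTheorem2 {d : ℕ} (O : Set (EuclideanSpace ℝ (Fin d))) (hO : IsOpen O)
    (hOb : Bornology.IsBounded O)
    (e : HilbertBasis ℕ ℝ (L2Dom O)) (α : ℕ → ℝ) (he : IsDirichletEigenbasis O e α)
    (Q : L2Dom O →L[ℝ] L2Dom O) (lam : ℕ → ℝ) (hQ : ∀ k, Q (e k) = lam k • e k)
    (hlam : Summable fun k => lam k ^ 2 / α k)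
    (F : L2Dom O → ℝ) (hF : ContDiff ℝ 1 F) (hF0 : F 0 = 0) (hFnonneg : ∀ x, 0 ≤ F x)
    (hFmono : ∀ x, 0 ≤ inner ℝ (gradient F x) x)
    (κ : ℝ) (hFlip : ∀ x y, ‖gradient F x - gradient F y‖ ≤ κ * ‖x - y‖)
    (B : L2Dom O → L2Dom O) (hB : ∀ x, B x = -Q (Q (gradient F x))) :
    (∀ μ : ℝ, 0 < μ → ∀ (x : L2Dom O) (hx : x ∈ (opInv Q).domain)
        (hx' : opInv Q ⟨x, hx⟩ ∈ (sqrtNeg e α).domain)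
        (y : L2Dom O) (hy : y ∈ (opInv Q).domain),
      waveQuasiPotential e α Q B μ x (toHNeg e α y) =
        ENNReal.ofReal (‖sqrtNeg e α ⟨opInv Q ⟨x, hx⟩, hx'⟩‖ ^ 2 + 2 * F x
          + μ * ‖opInv Q ⟨y, hy⟩‖ ^ 2)) ∧
    (∀ (x : L2Dom O) (hx : x ∈ (opInv Q).domain)
        (hx' : opInv Q ⟨x, hx⟩ ∈ (sqrtNeg e α).domain),
      heatQuasiPotential e α Q B x =
        ENNReal.ofReal (‖sqrtNeg e α ⟨opInv Q ⟨x, hx⟩, hx'⟩‖ ^ 2 + 2 * F x)) ∧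
    (∀ μ : ℝ, 0 < μ → ∀ x : L2Dom O,
      (⨅ y : HSob α (-1), waveQuasiPotential e α Q B μ x y) = waveQuasiPotential e α Q B μ x 0 ∧
      waveQuasiPotential e α Q B μ x 0 = heatQuasiPotential e α Q B x) := by
  have h : IsPotential e Q lam F κ := ⟨hQ, hF, hF0, hFnonneg, hFmono, hFlip⟩
  have hα := he.pos
  have hmono := he.mono
  refine ⟨fun μ hμ x hx hx' y hy => h.waveQuasiPotential_eq hα hmono hμ hB x hx hx' y hy,
    fun x hx hx' => h.heatQuasiPotential_eq hα hmono hB x hx hx', fun μ hμ x => ?_⟩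
  have h1 : waveQuasiPotential e α Q B μ x 0 = heatQuasiPotential e α Q B x :=
    le_antisymm (h.waveQuasiPotential_zero_le hα hmono hμ hB x)
      (h.heatQuasiPotential_le_waveQuasiPotential hα hmono hμ hB x 0)
  refine ⟨le_antisymm (iInf_le _ 0) (le_iInf fun y => ?_), h1⟩
  rw [h1]
  exact h.heatQuasiPotential_le_waveQuasiPotential hα hmono hμ hB x y
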